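/- Let $n\ge 1$ and $0\le k<2n$ be integers. An increasing tableau of shape $2\times n$ with maximum entry $M$ is a filling of the $2\times n$ rectangle of boxes by positive integers that is strictly increasing along rows and down columns and whose set of entries is exactly $\{1,\dots,M\}$. Let $\mathrm{Inc}_k(2\times n)$ be the set of those with $M=2n-k$. The K-promotion $\mathcal P(T)$ of an increasing tableau $T$ with maximum entry $M$ is defined as follows. The SE-neighbors of a box are the (at most two) boxes immediately to its right and immediately below it. Delete the entry $1$ from $T$, leaving an empty box. Repeat the following, simultaneously for all empty boxes, until no empty box has an SE-neighbor: label each empty box that has an SE-neighbor by the minimal label of its SE-neighbors, and remove that label from the SE-neighbor(s) in which it appears. Finally label all empty boxes by $M+1$ and subtract one from every label. Let $[m]_q=1+q+\dots+q^{m-1}$, let $\binom{a}{b}_q$ be the $q$-binomial coefficient, and set $$f(q)=\frac{\binom{n-1}{k}_q\,\binom{2n-k}{n-k-1}_q}{[n-k]_q}\quad (k<n),\qquad f(q)=0\quad (k\ge n).$$ Theorem. $f$ is a polynomial with integer coefficients. There is an action of the cyclic group $\mathcal C_{2n-k}=\langle c\rangle$ of order $2n-k$ on $\mathrm{Inc}_k(2\times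 n)$ in which the generator $c$ acts by K-promotion, and the triple $\big(\mathrm{Inc}_k(2\times n),\mathcal C_{2n-k},f\big)$ has the cyclic sieving phenomenon: the set $\mathrm{Inc}_k(2\times n)$ is finite, and for every integer $m$ and every primitive $(2n-k)$th root of unity $\zeta\in\mathbb C$, $$\#\{T\in \mathrm{Inc}_k(2\times n) : c^m\cdot T=T\}=f(\zeta^m).$$ -/

import Mathlib

open Polynomial

/-- The `q`-integer `[m]_q = 1 + q + ⋯ + q^(m-1)`, as a polynomial in `q` over `ℤ`. -/
noncomputable def qInt (m : ℕ) : ℤ[X] := ∑ i ∈ Finset.range m, (X : ℤ[X]) ^ i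

/-- The `q`-factorial `[m]_q! = [1]_q [2]_q ⋯ [m]_q`. -/
noncomputable def qFactorial : ℕ → ℤ[X]
  | 0 => 1
  | m + 1 => qFactorial m * qInt (m + 1)

/-- The `q`-binomial coefficient, defined by the `q`-Pascal recursion. It vanishes when the lower
argument exceeds the upper one, and otherwise it is the usual quotient of `q`-factorials
(`qBinom_mul_qFactorial`). -/
noncomputable def qBinom : ℕ → ℕ → ℤ[X]
  | _, 0 => 1
  | 0, _ + 1 => 0
  | m + 1, r + 1 => qBinom m r + X ^ (r + 1) * qBinom m (r + 1)

theorem qInt_add (a b : ℕ) : qInt (a + b) = qInt a + X ^ a * qInt b := by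
  simp only [qInt, Finset.sum_range_add, Finset.mul_sum, pow_add]

theorem qBinom_eq_zero_of_lt : ∀ (m r : ℕ), m < r → qBinom m r = 0
  | _, 0, h => by omega
  | 0, _ + 1, _ => by simp [qBinom]
  | m + 1, r + 1, h => by
    rw [qBinom, qBinom_eq_zero_of_lt m r (by omega), qBinom_eq_zero_of_lt m (r + 1) (by omega)]
    simp

/-- `qBinom (r + s) r = [r + s]_q! / ([r]_q! [s]_q!)`. -/
theorem qBinom_mul_qFactorial (r s : ℕ) :
    qBinom (r + s) r * (qFactorial r * qFactorial s) = qFactorial (r + s) := by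
  induction r generalizing s with
  | zero => cases s <;> simp [qBinom, qFactorial]
  | succ r ihr =>
    induction s with
    | zero =>
      have h := ihr 0
      simp only [add_zero] at h ⊢
      rw [qBinom, qBinom_eq_zero_of_lt r (r + 1) (by omega), qFactorial.eq_2 r]
      nth_rewrite 2 [← h]
      ring
    | succ s ihs =>
      have h := ihr (s + 1)
      have e1 : r + 1 + (s + 1) = (r + (s + 1)) + 1 := by omega
      have e2 : r + 1 + s = r + (s + 1) := by omega
      have e3 : r + (s + 1) + 1 = (r + 1) + (s + 1) := by omega
      rw [e2] at ihs
      have hq : qInt (r + (s + 1) + 1) = qInt (r + 1) + X ^ (r + 1) * qInt (s + 1) := by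
        rw [e3, qInt_add]
      rw [e1, qBinom, qFactorial.eq_2 (r + (s + 1)), hq, mul_add (qFactorial (r + (s + 1)))]
      nth_rewrite 1 [← h]
      rw [← ihs, qFactorial.eq_2 r, qFactorial.eq_2 s]
      ring

/-- The polynomial
`f(q) = [n-1 choose k]_q [2n-k choose n-k-1]_q / [n-k]_q`, where `/ₘ` is division by a monic
polynomial in `ℤ[q]`. For `k ≥ n ≥ 1` the numerator vanishes, and `f = 0`. -/
noncomputable def sievingPoly (n k : ℕ) : ℤ[X] :=
  (qBinom (n - 1) k * qBinom (2 * n - k) (n - k - 1)) /ₘ qInt (n - k)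

/-- Let the cyclic group of order `N`, with generator `c = ofAdd 1`, act on `X`. The triple
`(X, C_N, f)` has the cyclic sieving phenomenon if `X` is finite and, for all `m` and every
primitive `N`th root of unity `ζ`, the number of elements of `X` fixed by `c ^ m` is
`f (ζ ^ m)`. -/
def HasCyclicSieving (N : ℕ) (X : Type*) [MulAction (Multiplicative (ZMod N)) X] (f : ℤ[X]) :
    Prop :=
  Finite X ∧ ∀ (m : ℤ) (ζ : ℂ), IsPrimitiveRoot ζ N →
    (Nat.card {x : X // (Multiplicative.ofAdd (1 : ZMod N)) ^ m • x = x} : ℂ) =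
      aeval (ζ ^ m) f

/-- The rectangular Young diagram with `m` rows and `n` columns. -/
def rectDiagram (m n : ℕ) : YoungDiagram where
  cells := Finset.range m ×ˢ Finset.range n
  isLowerSet := by
    intro a b hab ha
    obtain ⟨h1, h2⟩ := Prod.le_def.mp hab
    simp only [Finset.coe_product, Finset.coe_range, Set.mem_prod, Set.mem_Iio] at ha ⊢
    exact ⟨lt_of_le_of_lt h1 ha.1, lt_of_le_of_lt h2 ha.2⟩

/-- Increasing tableaux of shape `μ` with maximum entry `M`: semistandard tableaux (whose columns
are strictly increasing already) with strictly increasing rows, whose set of entries is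
`{1, …, M}`. Boxes are indexed from `0` as (row, column), and `entry` is `0` outside `μ`. -/
structure IncreasingTableau (μ : YoungDiagram) (M : ℕ) extends SemistandardYoungTableau μ where
  row_strict' : ∀ {i j1 j2 : ℕ}, j1 < j2 → (i, j2) ∈ μ → entry i j1 < entry i j2
  entries_eq' : {v : ℕ | ∃ i j : ℕ, (i, j) ∈ μ ∧ entry i j = v} = Set.Icc 1 M

/-- The smaller of two labels, where `0` stands for a missing label. -/
def minLabel (a b : ℕ) : ℕ := if a = 0 then b else if b = 0 then a else min a b

/-- The minimal label of the SE-neighbors of the box `(i, j)`, that is, of the box right of it and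
the box below it; it is `0` if no SE-neighbor has a label. In a partial filling `S` of a Young
diagram, `0` is the value at the empty boxes and outside the diagram. -/
def seLabel (S : ℕ → ℕ → ℕ) (i j : ℕ) : ℕ := minLabel (S i (j + 1)) (S (i + 1) j)

/-- One round of K-jeu de taquin, performed simultaneously on all empty boxes of `μ`: every empty
box receives the minimal label of its SE-neighbors (and stays empty if there is none), and that
label is removed from the SE-neighbors in which it appears. -/
def kSlide (μ : YoungDiagram) (S : ℕ → ℕ → ℕ) (i j : ℕ) : ℕ :=
  if (i, j) ∈ μ then
    if S i j = 0 then seLabel S i j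
    else if (0 < j ∧ S i (j - 1) = 0 ∧ seLabel S i (j - 1) = S i j) ∨
        (0 < i ∧ S (i - 1) j = 0 ∧ seLabel S (i - 1) j = S i j) then 0
    else S i j
  else 0

/-- K-promotion of a tableau `T` of shape `μ` with maximum entry `M`: delete the entry `1`, perform
rounds of K-jeu de taquin until no empty box has an SE-neighbor, label all empty boxes by `M + 1`,
and subtract one from every label.
An empty box that has SE-neighbors moves one antidiagonal further in every round, and a round
changes nothing when no empty box has an SE-neighbor, so that `μ.card` rounds are always enough. -/
def kPromotion (μ : YoungDiagram) (M : ℕ) (T : ℕ → ℕ → ℕ) (i j : ℕ) : ℕ :=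
  let deleted : ℕ → ℕ → ℕ := fun a b => if T a b = 1 then 0 else T a b
  let slid : ℕ → ℕ → ℕ := (kSlide μ)^[μ.card] deleted
  if (i, j) ∈ μ then (if slid i j = 0 then M + 1 else slid i j) - 1 else 0

/-! Put N = 2n-k and, for k < n, b+1 = n-k. A label occurring only in the top row, in both rows, or
only in the bottom row is read as a step 1, 0 or -1. This turns tableaux into closed Motzkin walks
of length N that are nonnegative and have no flat step at height 0. Replacing these steps by the
pairs up-up, down-up, down-down (`doubled`) turns both conditions into nonnegativity of a single ±1
walk. Joining each up step to the down step that closes it gives a noncrossing perfect matching of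
2N points on a circle in which no pair {2i, 2i+1} occurs. It encodes a noncrossing partition of N
points without singletons, and its b+1 blocks are counted by the up steps. K-promotion becomes
rotation by two points (`Represents.kPromotion`): the slide alters only the block of the label 1,
whose second element becomes its first and whose last element is followed by N.

It remains to count matchings fixed by a rotation. Let g = gcd(m, N) and d = N/g, the order of ζ^m.
For d ≥ 2, a matching invariant under translation by 2g can be opened consistently at the points
whose next partner is less than 2g away. The result is an arbitrary closed Motzkin walk of length g,
with no positivity condition (`card_symmetric`). Its number of blocks is d times its number of up
steps, plus one exactly when there is a flat step at the minimal height, which produces a central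
block (`IsWalk.blockCount_arcMap`). For d = 1 the nonnegative walks themselves are counted.

These counts have closed forms: `wordCount_nonneg_noflat`, `wordCount_noflat` and `wordCount_flat`.
On the algebraic side f is written as a difference of products of q-binomials, and the q-Lucas
theorem evaluates it at a primitive d-th root of unity: one of the two terms survives if d divides
b+1 or b, none otherwise. The same trichotomy governs the block count, and the values agree
(`card_symmetric_eq_aeval`). For k ≥ n there are no tableaux and f = 0. -/

/-! ### The sieving polynomial without division. -/

theorem qInt_succ' (m : ℕ) : qInt (m + 1) = 1 + X * qInt m := by
  have h := qInt_add 1 m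
  rw [add_comm 1 m] at h
  rw [h]
  simp [qInt]

theorem qInt_monic (m : ℕ) : (qInt (m + 1)).Monic :=
  monic_geom_sum_X m.succ_ne_zero

theorem qFactorial_ne_zero (m : ℕ) : qFactorial m ≠ 0 := by
  induction m with
  | zero => simp [qFactorial]
  | succ m ih => rw [qFactorial]; exact mul_ne_zero ih (qInt_monic m).ne_zero

theorem qInt_mul_qBinom_succ (r s : ℕ) :
    qInt (r + 1) * qBinom (r + 1 + s) (r + 1) = qInt (s + 1) * qBinom (r + 1 + s) r := by
  have h1 := qBinom_mul_qFactorial (r + 1) s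
  have h2 := qBinom_mul_qFactorial r (s + 1)
  rw [show r + (s + 1) = r + 1 + s by ring, ← h1, qFactorial.eq_2 r, qFactorial.eq_2 s] at h2
  refine mul_right_cancel₀ (mul_ne_zero (qFactorial_ne_zero r) (qFactorial_ne_zero s)) ?_
  linear_combination -h2

theorem qInt_mul_qBinom_pred (b k : ℕ) :
    qInt (b + 1) * qBinom (b + 1 + k) k = qInt (b + 1 + k) * qBinom (b + k) k := by
  have h1 := qBinom_mul_qFactorial k (b + 1)
  have h2 := qBinom_mul_qFactorial k b
  rw [show k + (b + 1) = k + b + 1 by ring, qFactorial.eq_2 b, qFactorial.eq_2 (k + b), ← h2] at h1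
  rw [show b + 1 + k = k + b + 1 by ring, show b + k = k + b by ring]
  refine mul_right_cancel₀ (mul_ne_zero (qFactorial_ne_zero k) (qFactorial_ne_zero b)) ?_
  linear_combination h1

/-- The sieving polynomial without division, for `n = b + 1 + k`. -/
noncomputable def sievingNumerator (b k : ℕ) : ℤ[X] :=
  qBinom (b + k) k * qBinom (2 * (b + 1) + k) (b + 1) -
    X * qBinom (2 * (b + 1) + k) b * qBinom (b + 1 + k) k

/-- A q-analogue of writing Catalan numbers as a difference of binomials. Both terms are multiples
of the left side, with factors [b+k+2] and q[b+k+1], and these factors differ by 1. -/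
theorem sievingNumerator_mul_qInt (b k : ℕ) :
    qBinom (b + k) k * qBinom (2 * (b + 1) + k) b = qInt (b + 1) * sievingNumerator b k := by
  have h1 := qInt_mul_qBinom_succ b (b + 1 + k)
  have h2 := qInt_mul_qBinom_pred b k
  have h3 := qInt_succ' (b + 1 + k)
  rw [show b + 1 + (b + 1 + k) = 2 * (b + 1) + k by ring] at h1
  rw [h3] at h1
  rw [sievingNumerator]
  linear_combination (-qBinom (b + k) k) * h1 + X * qBinom (2 * (b + 1) + k) b * h2

theorem sievingPoly_eq (b k : ℕ) : sievingPoly (b + 1 + k) k = sievingNumerator b k := by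
  rw [sievingPoly, show b + 1 + k - 1 = b + k by omega,
    show 2 * (b + 1 + k) - k = 2 * (b + 1) + k by omega, show b + 1 + k - k - 1 = b by omega,
    show b + 1 + k - k = b + 1 by omega, sievingNumerator_mul_qInt]
  exact mul_divByMonic_cancel_left _ (qInt_monic b)

/-! ### Values at roots of unity and the q-Lucas theorem. -/

section RootOfUnity

variable {ω : ℂ} {d : ℕ}

theorem aeval_qInt_mul (ω : ℂ) (m : ℕ) : aeval ω (qInt m) * (ω - 1) = ω ^ m - 1 := by
  simp only [qInt, map_sum, map_pow, aeval_X]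
  exact geom_sum_mul ω m

theorem aeval_qInt_eq_zero (hd : 2 ≤ d) (hω : IsPrimitiveRoot ω d) : aeval ω (qInt d) = 0 := by
  have h := aeval_qInt_mul ω d
  rw [hω.pow_eq_one, sub_self] at h
  exact (mul_eq_zero.mp h).resolve_right (sub_ne_zero.mpr (hω.ne_one hd))

theorem aeval_qInt_ne_zero (hω : IsPrimitiveRoot ω d) {m : ℕ} (h0 : 0 < m) (hm : m < d) :
    aeval ω (qInt m) ≠ 0 := by
  intro h
  have h' := aeval_qInt_mul ω m
  rw [h, zero_mul] at h'
  exact hω.pow_ne_one_of_pos_of_lt h0.ne' hm (sub_eq_zero.mp h'.symm)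

theorem aeval_qFactorial_ne_zero (hω : IsPrimitiveRoot ω d) {m : ℕ} (hm : m < d) :
    aeval ω (qFactorial m) ≠ 0 := by
  induction m with
  | zero => simp [qFactorial]
  | succ m ih =>
    rw [qFactorial, map_mul]
    exact mul_ne_zero (ih (by omega)) (aeval_qInt_ne_zero hω (by omega) hm)

theorem qBinom_self (m : ℕ) : qBinom m m = 1 := by
  induction m with
  | zero => simp [qBinom]
  | succ m ih => rw [qBinom, ih, qBinom_eq_zero_of_lt m (m + 1) (by omega)]; simp

theorem qBinom_zero_right (m : ℕ) : qBinom m 0 = 1 := by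
  cases m <;> simp [qBinom]

/-- In the quotient of q-factorials the numerator contains [d], which vanishes at ω, and no factor
of the denominator vanishes there. -/
theorem aeval_qBinom_order (hd : 2 ≤ d) (hω : IsPrimitiveRoot ω d) {r : ℕ} (h0 : 0 < r)
    (hr : r < d) : aeval ω (qBinom d r) = 0 := by
  have h := congrArg (aeval ω) (qBinom_mul_qFactorial r (d - r))
  obtain ⟨e, rfl⟩ : ∃ e, d = e + 1 := ⟨d - 1, by omega⟩
  rw [show r + (e + 1 - r) = e + 1 by omega, qFactorial.eq_2 e] at h
  simp only [map_mul] at h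
  rw [aeval_qInt_eq_zero hd hω, mul_zero] at h
  exact (mul_eq_zero.mp h).resolve_right
    (mul_ne_zero (aeval_qFactorial_ne_zero hω hr) (aeval_qFactorial_ne_zero hω (by omega)))

/-- At ω only the two extreme binomials of upper index d survive, so adding d to the upper index
acts like one step of the ordinary Pascal rule. The induction on m uses the q-Pascal rule and ω^d =
1; q-Lucas follows by iterating. -/
theorem aeval_qBinom_add_order (hd : 2 ≤ d) (hω : IsPrimitiveRoot ω d) (m : ℕ) :
    ∀ r, aeval ω (qBinom (m + d) r) =
      aeval ω (qBinom m r) + if d ≤ r then aeval ω (qBinom m (r - d)) else 0 := by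
  induction m with
  | zero =>
    intro r
    rw [zero_add]
    rcases Nat.eq_zero_or_pos r with rfl | hr
    · simp [qBinom_zero_right, show ¬ d ≤ 0 by omega]
    rw [qBinom_eq_zero_of_lt 0 r hr, map_zero, zero_add]
    rcases lt_trichotomy r d with h | h | h
    · rw [aeval_qBinom_order hd hω hr h, if_neg (by omega)]
    · subst h; simp [qBinom_self]
    · rw [qBinom_eq_zero_of_lt d r h, if_pos h.le, qBinom_eq_zero_of_lt 0 (r - d) (by omega)]
  | succ m ih =>
    rintro (_ | r)
    · simp [qBinom_zero_right, show ¬ d ≤ 0 by omega]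
    rw [show m + 1 + d = (m + d) + 1 by ring, qBinom, qBinom]
    simp only [map_add, map_mul, map_pow, aeval_X]
    rw [ih r, ih (r + 1)]
    rcases lt_trichotomy d (r + 1) with h | h | h
    · rw [if_pos (by omega), if_pos (by omega), if_pos (by omega)]
      obtain ⟨s, hs⟩ : ∃ s, r = d + s := ⟨r - d, by omega⟩
      have e1 : r - d = s := by omega
      have e2 : r + 1 - d = s + 1 := by omega
      rw [e1, e2, qBinom]
      simp only [map_add, map_mul, map_pow, aeval_X]
      have : ω ^ (r + 1) = ω ^ (s + 1) := by
        rw [show r + 1 = d + (s + 1) by omega, pow_add, hω.pow_eq_one, one_mul]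
      rw [this]; ring
    · rw [if_neg (by omega), if_pos (by omega), if_pos (by omega)]
      have : ω ^ (r + 1) = 1 := by rw [← h, hω.pow_eq_one]
      rw [this, ← h, Nat.sub_self, qBinom_zero_right, qBinom_zero_right]
      ring
    · rw [if_neg (by omega), if_neg (by omega), if_neg (by omega)]
      ring

/-- The `q`-Lucas theorem. -/
theorem aeval_qBinom_lucas (hd : 2 ≤ d) (hω : IsPrimitiveRoot ω d) (a c r s : ℕ) (hr : r < d)
    (hs : s < d) :
    aeval ω (qBinom (d * a + r) (d * c + s)) = (a.choose c : ℂ) * aeval ω (qBinom r s) := by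
  induction a generalizing c with
  | zero =>
    cases c with
    | zero => simp
    | succ c =>
      rw [qBinom_eq_zero_of_lt _ _ (by nlinarith)]
      simp
  | succ a ih =>
    rw [show d * (a + 1) + r = d * a + r + d by ring, aeval_qBinom_add_order hd hω, ih]
    cases c with
    | zero => rw [if_neg (by omega)]; simp
    | succ c =>
      rw [if_pos (by nlinarith), show d * (c + 1) + s - d = d * c + s by
        rw [mul_add, mul_one]; omega, ih, Nat.choose_succ_succ]
      push_cast; ring

theorem aeval_qBinom_one (m r : ℕ) : aeval (1 : ℂ) (qBinom m r) = (m.choose r : ℂ) := by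
  induction m generalizing r with
  | zero => cases r <;> simp [qBinom]
  | succ m ih =>
    cases r with
    | zero => simp [qBinom]
    | succ r => rw [qBinom, Nat.choose_succ_succ]; simp [ih]

theorem aeval_sievingNumerator_one (b k : ℕ) :
    aeval (1 : ℂ) (sievingNumerator b k) =
      ((b + k).choose k * (2 * (b + 1) + k).choose (b + 1) : ℂ) -
        (2 * (b + 1) + k).choose b * (b + 1 + k).choose k := by
  simp [sievingNumerator, aeval_qBinom_one]

theorem aeval_qBinom_of_not_dvd (hd : 2 ≤ d) (hω : IsPrimitiveRoot ω d) {N r : ℕ} (hN : d ∣ N)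
    (hr : ¬ d ∣ r) : aeval ω (qBinom N r) = 0 := by
  obtain ⟨a, rfl⟩ := hN
  have h := aeval_qBinom_lucas hd hω a (r / d) 0 (r % d) (by omega) (Nat.mod_lt _ (by omega))
  rw [add_zero, Nat.div_add_mod] at h
  rw [h, qBinom_eq_zero_of_lt 0 (r % d) (by rw [Nat.dvd_iff_mod_eq_zero] at hr; omega)]
  simp

theorem aeval_sievingNumerator_eq_zero (hd : 2 ≤ d) (hω : IsPrimitiveRoot ω d) {b k : ℕ}
    (hN : d ∣ 2 * (b + 1) + k) (h0 : ¬ d ∣ b + 1) (h1 : ¬ d ∣ b) :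
    aeval ω (sievingNumerator b k) = 0 := by
  simp [sievingNumerator, aeval_qBinom_of_not_dvd hd hω hN h0, aeval_qBinom_of_not_dvd hd hω hN h1]

/-- Here d divides N but not b, so the subtracted term vanishes and q-Lucas evaluates the other one.
The lower residues are 0, so no power of ω is left. -/
theorem aeval_sievingNumerator_of_dvd (hd : 2 ≤ d) (hω : IsPrimitiveRoot ω d) {b k c j : ℕ}
    (hb : b + 1 = d * c) (hk : k = d * j) :
    aeval ω (sievingNumerator b k) = ((c + j - 1).choose j * (2 * c + j).choose c : ℂ) := by
  have hN : d ∣ 2 * (b + 1) + k := ⟨2 * c + j, by rw [hb, hk]; ring⟩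
  have h1 : ¬ d ∣ b := fun h => by
    have := (Nat.dvd_add_right h).mp ⟨c, hb⟩
    exact absurd (Nat.le_of_dvd one_pos this) (by omega)
  have hc : 0 < c := Nat.pos_of_ne_zero (by rintro rfl; simp at hb)
  have e1 : b + k = d * (c + j - 1) + (d - 1) := by
    obtain ⟨e, rfl⟩ : ∃ e, c = e + 1 := ⟨c - 1, by omega⟩
    rw [show e + 1 + j - 1 = e + j by omega]
    have : d * (e + 1) = d * e + d := by ring
    rw [this] at hb
    rw [hk, mul_add]; omega
  have e2 : 2 * (b + 1) + k = d * (2 * c + j) := by rw [hb, hk]; ring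
  have l1 := aeval_qBinom_lucas hd hω (c + j - 1) j (d - 1) 0 (by omega) (by omega)
  have l2 := aeval_qBinom_lucas hd hω (2 * c + j) c 0 0 (by omega) (by omega)
  rw [← e1, add_zero, ← hk, qBinom_zero_right, map_one, mul_one] at l1
  rw [add_zero, ← e2, add_zero, ← hb, qBinom_zero_right, map_one, mul_one] at l2
  simp [sievingNumerator, aeval_qBinom_of_not_dvd hd hω hN h1, l1, l2]

/-- Now d does not divide b+1, so only the subtracted term survives. Its residues are d-1 over d-2,
and the resulting [d-1] at ω is cancelled, sign included, by the factor -q. -/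
theorem aeval_sievingNumerator_of_dvd_pred (hd : 2 ≤ d) (hω : IsPrimitiveRoot ω d) {b k c j : ℕ}
    (hb : b = d * c) (hk : k + 2 = d * (j + 1)) :
    aeval ω (sievingNumerator b k) = ((c + j).choose j * (2 * c + (j + 1)).choose c : ℂ) := by
  have e2 : 2 * (b + 1) + k = d * (2 * c + (j + 1)) := by
    rw [show 2 * (b + 1) + k = 2 * b + (k + 2) by ring, hk, hb]; ring
  have hN : d ∣ 2 * (b + 1) + k := ⟨_, e2⟩
  have h1 : ¬ d ∣ b + 1 := fun h => by
    have := (Nat.dvd_add_right ⟨c, hb⟩).mp h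
    exact absurd (Nat.le_of_dvd one_pos this) (by omega)
  have e3 : k = d * j + (d - 2) := by
    rw [mul_add, mul_one] at hk; omega
  have e1 : b + 1 + k = d * (c + j) + (d - 1) := by
    rw [mul_add]; omega
  have l1 := aeval_qBinom_lucas hd hω (c + j) j (d - 1) (d - 2) (by omega) (by omega)
  have l2 := aeval_qBinom_lucas hd hω (2 * c + (j + 1)) c 0 0 (by omega) (by omega)
  rw [← e1, ← e3] at l1
  rw [add_zero, ← e2, add_zero, ← hb, qBinom_zero_right, map_one, mul_one] at l2
  -- The binomial is [d-1], and 1 + ω[d-1] = [d] = 0.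
  have l3 : ω * aeval ω (qBinom (d - 1) (d - 2)) = -1 := by
    obtain ⟨e, rfl⟩ : ∃ e, d = e + 2 := ⟨d - 2, by omega⟩
    have h := congrArg (aeval ω) (qInt_mul_qBinom_succ e 0)
    have h0 := aeval_qInt_eq_zero hd hω
    rw [qInt_succ'] at h0
    simp only [map_mul, map_add, map_one, aeval_X, add_zero, qBinom_self, zero_add] at h h0
    rw [show qInt 1 = 1 by simp [qInt], map_one, one_mul, mul_one] at h
    rw [show e + 2 - 1 = e + 1 by omega, show e + 2 - 2 = e by omega, ← h]
    linear_combination h0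
  simp only [sievingNumerator, map_sub, map_mul, aeval_X,
    aeval_qBinom_of_not_dvd hd hω hN h1, l1, l2]
  linear_combination (-((c + j).choose j : ℂ) * (2 * c + (j + 1)).choose c) * l3

end RootOfUnity

/-! ### Motzkin words: depth and flat steps at the minimum. -/

/-- A word over the letters `1`, `0`, `-1` is read as a lattice path starting at height `0`;
`pathDepth` is minus its minimal height. -/
def pathDepth : List SignType → ℕ
  | [] => 0
  | .pos :: l => pathDepth l - 1
  | .zero :: l => pathDepth l
  | .neg :: l => pathDepth l + 1

/-- The path has a flat step at its minimal height. -/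
def FlatAtMin : List SignType → Prop
  | [] => False
  | .pos :: l => pathDepth l ≠ 0 ∧ FlatAtMin l
  | .zero :: l => pathDepth l = 0 ∨ FlatAtMin l
  | .neg :: l => FlatAtMin l

/-- The final height of a path. -/
def pathEnd (l : List SignType) : ℤ := l.count .pos - l.count .neg

theorem pathEnd_cons_pos (l : List SignType) : pathEnd (.pos :: l) = pathEnd l + 1 := by
  simp [pathEnd]; ring

theorem pathEnd_cons_zero (l : List SignType) : pathEnd (.zero :: l) = pathEnd l := by
  simp [pathEnd]

theorem pathEnd_cons_neg (l : List SignType) : pathEnd (.neg :: l) = pathEnd l - 1 := by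
  simp [pathEnd]; ring

theorem neg_pathDepth_le_pathEnd (l : List SignType) : -(pathDepth l : ℤ) ≤ pathEnd l := by
  induction l with
  | nil => simp [pathDepth, pathEnd]
  | cons x l ih =>
    cases x
    · rw [pathEnd_cons_zero, pathDepth]; exact ih
    · rw [pathEnd_cons_neg, pathDepth]; push_cast; linarith
    · rw [pathEnd_cons_pos, pathDepth]; omega

/-- The definitions recurse on the first letter, but nonnegative paths are counted by removing the
last one. This and the following append lemmas translate between the two. -/
theorem pathDepth_append_pos (l : List SignType) : pathDepth (l ++ [.pos]) = pathDepth l := by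
  induction l with
  | nil => simp [pathDepth]
  | cons x l ih => cases x <;> simp only [List.cons_append, pathDepth, ih]

theorem pathDepth_append_zero (l : List SignType) : pathDepth (l ++ [.zero]) = pathDepth l := by
  induction l with
  | nil => simp [pathDepth]
  | cons x l ih => cases x <;> simp only [List.cons_append, pathDepth, ih]

theorem pathDepth_append_neg (l : List SignType) :
    (pathDepth (l ++ [.neg]) : ℤ) = max (pathDepth l : ℤ) (1 - pathEnd l) := by
  induction l with
  | nil => simp [pathDepth, pathEnd]
  | cons x l ih =>
    cases x
    · rw [pathEnd_cons_zero, List.cons_append, pathDepth, pathDepth, ih]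
    · rw [pathEnd_cons_neg, List.cons_append, pathDepth, pathDepth]
      omega
    · rw [pathEnd_cons_pos, List.cons_append, pathDepth, pathDepth]
      omega

theorem flatAtMin_append_pos (l : List SignType) : FlatAtMin (l ++ [.pos]) ↔ FlatAtMin l := by
  induction l with
  | nil => simp [FlatAtMin]
  | cons x l ih => cases x <;> simp only [List.cons_append, FlatAtMin, ih, pathDepth_append_pos]

theorem flatAtMin_append_zero (l : List SignType) :
    FlatAtMin (l ++ [.zero]) ↔ FlatAtMin l ∨ pathEnd l = -pathDepth l := by
  induction l with
  | nil => simp [FlatAtMin, pathEnd, pathDepth]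
  | cons x l ih =>
    have h := neg_pathDepth_le_pathEnd l
    cases x
    · rw [pathEnd_cons_zero, List.cons_append, FlatAtMin, FlatAtMin, ih, pathDepth_append_zero,
        pathDepth]
      tauto
    · rw [pathEnd_cons_neg, List.cons_append, FlatAtMin, FlatAtMin, ih, pathDepth]
      push_cast
      rw [neg_add, ← sub_eq_add_neg, sub_left_inj]
    · rw [pathEnd_cons_pos, List.cons_append, FlatAtMin, FlatAtMin, ih, pathDepth_append_zero,
        pathDepth]
      have : pathEnd l + 1 = -((pathDepth l - 1 : ℕ) : ℤ) ↔
          pathDepth l ≠ 0 ∧ pathEnd l = -pathDepth l := by omega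
      tauto

theorem flatAtMin_append_neg (l : List SignType) :
    FlatAtMin (l ++ [.neg]) ↔ FlatAtMin l ∧ 1 - pathEnd l ≤ pathDepth l := by
  induction l with
  | nil => simp [FlatAtMin]
  | cons x l ih =>
    have h := neg_pathDepth_le_pathEnd l
    have h' := pathDepth_append_neg l
    cases x
    · rw [pathEnd_cons_zero, List.cons_append, FlatAtMin, FlatAtMin, ih, pathDepth]
      have : pathDepth (l ++ [.neg]) = 0 ↔ pathDepth l = 0 ∧ 1 - pathEnd l ≤ pathDepth l := by
        omega
      tauto
    · rw [pathEnd_cons_neg, List.cons_append, FlatAtMin, FlatAtMin, ih, pathDepth]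
      refine and_congr_right fun _ => ?_
      omega
    · rw [pathEnd_cons_pos, List.cons_append, FlatAtMin, FlatAtMin, ih, pathDepth]
      have : (pathDepth (l ++ [.neg]) ≠ 0 ∧ 1 - pathEnd l ≤ pathDepth l) ↔
          (pathDepth l ≠ 0 ∧ 1 - (pathEnd l + 1) ≤ ((pathDepth l - 1 : ℕ) : ℤ)) := by
        omega
      tauto

/-! ### Counting words by their letters. -/

/-- The words with `u` letters `1`, `v` letters `-1`, `k` letters `0` and the property `p`. -/
def wordSet (p : List SignType → Prop) (u v k : ℕ) : Set (List SignType) :=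
  {l | l.count .pos = u ∧ l.count .neg = v ∧ l.count .zero = k ∧ p l}

/-- The number of words with given letter counts and property `p`. -/
noncomputable def wordCount (p : List SignType → Prop) (u v k : ℕ) : ℕ := (wordSet p u v k).ncard

theorem length_eq_count (l : List SignType) :
    l.length = l.count .pos + l.count .neg + l.count .zero := by
  induction l with
  | nil => simp
  | cons x l ih => cases x <;> simp [ih] <;> omega

theorem wordSet_finite (p : List SignType → Prop) (u v k : ℕ) : (wordSet p u v k).Finite := by
  refine (List.finite_length_eq SignType (u + v + k)).subset ?_
  rintro l ⟨rfl, rfl, rfl, -⟩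
  exact length_eq_count l

theorem wordCount_congr {p q : List SignType → Prop} {u v k : ℕ}
    (h : ∀ l, l.count .pos = u → l.count .neg = v → l.count .zero = k → (p l ↔ q l)) :
    wordCount p u v k = wordCount q u v k := by
  refine congrArg Set.ncard (Set.ext fun l => ?_)
  simp only [wordSet, Set.mem_ofPred_eq]
  constructor
  · rintro ⟨h1, h2, h3, h4⟩; exact ⟨h1, h2, h3, (h l h1 h2 h3).mp h4⟩
  · rintro ⟨h1, h2, h3, h4⟩; exact ⟨h1, h2, h3, (h l h1 h2 h3).mpr h4⟩

theorem wordCount_eq_zero {p : List SignType → Prop} {u v k : ℕ}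
    (h : ∀ l, l.count .pos = u → l.count .neg = v → l.count .zero = k → ¬ p l) :
    wordCount p u v k = 0 := by
  rw [wordCount, Set.ncard_eq_zero (wordSet_finite p u v k), Set.eq_empty_iff_forall_notMem]
  rintro l ⟨h1, h2, h3, h4⟩
  exact h l h1 h2 h3 h4

theorem wordCount_split (p q : List SignType → Prop) (u v k : ℕ) :
    wordCount p u v k =
      wordCount (fun l => p l ∧ q l) u v k + wordCount (fun l => p l ∧ ¬ q l) u v k := by
  rw [wordCount, wordCount, wordCount, ← Set.ncard_union_eq _ (wordSet_finite _ _ _ _)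
    (wordSet_finite _ _ _ _)]
  · congr 1; ext l; simp only [wordSet, Set.mem_ofPred_eq, Set.mem_union]; tauto
  · rw [Set.disjoint_left]; rintro l ⟨-, -, -, -, h⟩ ⟨-, -, -, -, h'⟩; exact h' h

theorem wordCount_zero (p : List SignType → Prop) (h : p []) : wordCount p 0 0 0 = 1 := by
  rw [wordCount, Set.ncard_eq_one]
  refine ⟨[], Set.ext fun l => ?_⟩
  simp only [wordSet, Set.mem_ofPred_eq, Set.mem_singleton_iff]
  constructor
  · rintro ⟨h1, h2, h3, -⟩
    have := length_eq_count l
    rw [h1, h2, h3] at this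
    exact List.length_eq_zero_iff.mp this
  · rintro rfl; simp [h]

/-- Splitting words by a distinguished (first or last) letter, added by `f`. -/
theorem wordCount_extend (f : SignType → List SignType → List SignType)
    (hf : ∀ x x' l l', f x l = f x' l' → x = x' ∧ l = l')
    (hc : ∀ x y l, (f x l).count y = (x :: l).count y)
    (hs : ∀ l, l ≠ [] → ∃ x l', l = f x l') (p : List SignType → Prop) (u v k : ℕ)
    (h : 0 < u + v + k) :
    wordCount p u v k =
      (if u = 0 then 0 else wordCount (fun l => p (f .pos l)) (u - 1) v k) +
      (if v = 0 then 0 else wordCount (fun l => p (f .neg l)) u (v - 1) k) +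
      (if k = 0 then 0 else wordCount (fun l => p (f .zero l)) u v (k - 1)) := by
  have hinj : ∀ x, Function.Injective (f x) := fun x l l' e => (hf _ _ _ _ e).2
  have hset : wordSet p u v k =
      (f .pos '' (if u = 0 then ∅ else wordSet (fun l => p (f .pos l)) (u - 1) v k) ∪
      f .neg '' (if v = 0 then ∅ else wordSet (fun l => p (f .neg l)) u (v - 1) k)) ∪
      f .zero '' (if k = 0 then ∅ else wordSet (fun l => p (f .zero l)) u v (k - 1)) := by
    ext l
    constructor
    · rintro ⟨h1, h2, h3, h4⟩
      have hl : l ≠ [] := by rintro rfl; simp at h1 h2 h3; omega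
      obtain ⟨x, l', rfl⟩ := hs l hl
      simp only [hc] at h1 h2 h3
      cases x
      · simp [-SignType.pos_eq_one, -SignType.neg_eq_neg_one, -SignType.zero_eq_zero] at h1 h2 h3
        refine Or.inr ⟨l', ?_, rfl⟩
        rw [if_neg (by omega)]
        exact ⟨h1, h2, by omega, h4⟩
      · simp [-SignType.pos_eq_one, -SignType.neg_eq_neg_one, -SignType.zero_eq_zero] at h1 h2 h3
        refine Or.inl (Or.inr ⟨l', ?_, rfl⟩)
        rw [if_neg (by omega)]
        exact ⟨h1, by omega, h3, h4⟩
      · simp [-SignType.pos_eq_one, -SignType.neg_eq_neg_one, -SignType.zero_eq_zero] at h1 h2 h3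
        refine Or.inl (Or.inl ⟨l', ?_, rfl⟩)
        rw [if_neg (by omega)]
        exact ⟨by omega, h2, h3, h4⟩
    · rintro ((⟨l', hl, rfl⟩ | ⟨l', hl, rfl⟩) | ⟨l', hl, rfl⟩)
      all_goals
        split_ifs at hl with h0
        · exact absurd hl (Set.notMem_empty _)
        · obtain ⟨h1, h2, h3, h4⟩ := hl
          refine ⟨?_, ?_, ?_, h4⟩ <;> rw [hc] <;> simp [-SignType.pos_eq_one, -SignType.neg_eq_neg_one, -SignType.zero_eq_zero] <;> omega
  have hfin : ∀ (x : SignType) (c : Prop) [Decidable c] q u v k,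
      (f x '' (if c then ∅ else wordSet q u v k)).Finite := by
    intro x c _ q u v k
    refine Set.Finite.image _ ?_
    split_ifs
    · exact Set.finite_empty
    · exact wordSet_finite _ _ _ _
  have hdis : ∀ (x y : SignType) (s t : Set (List SignType)), x ≠ y →
      Disjoint (f x '' s) (f y '' t) := by
    intro x y s t hxy
    rw [Set.disjoint_left]
    rintro _ ⟨l, -, rfl⟩ ⟨l', -, e⟩
    exact hxy (hf _ _ _ _ e).1.symm
  rw [wordCount, hset, Set.ncard_union_eq _ ((hfin _ _ _ _ _ _).union (hfin _ _ _ _ _ _))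
    (hfin _ _ _ _ _ _), Set.ncard_union_eq (hdis _ _ _ _ (by decide)) (hfin _ _ _ _ _ _)
    (hfin _ _ _ _ _ _)]
  · simp only [Set.ncard_image_of_injective _ (hinj _), wordCount]
    congr 1
    · congr 1 <;> split_ifs <;> simp
    · split_ifs <;> simp
  · exact Set.disjoint_union_left.mpr ⟨hdis _ _ _ _ (by decide), hdis _ _ _ _ (by decide)⟩

theorem wordCount_cons (p : List SignType → Prop) (u v k : ℕ) (h : 0 < u + v + k) :
    wordCount p u v k =
      (if u = 0 then 0 else wordCount (fun l => p (.pos :: l)) (u - 1) v k) +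
      (if v = 0 then 0 else wordCount (fun l => p (.neg :: l)) u (v - 1) k) +
      (if k = 0 then 0 else wordCount (fun l => p (.zero :: l)) u v (k - 1)) :=
  wordCount_extend List.cons (by simp) (by simp)
    (fun l hl => ⟨l.head hl, l.tail, (List.cons_head_tail hl).symm⟩) p u v k h

theorem wordCount_append (p : List SignType → Prop) (u v k : ℕ) (h : 0 < u + v + k) :
    wordCount p u v k =
      (if u = 0 then 0 else wordCount (fun l => p (l ++ [.pos])) (u - 1) v k) +
      (if v = 0 then 0 else wordCount (fun l => p (l ++ [.neg])) u (v - 1) k) +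
      (if k = 0 then 0 else wordCount (fun l => p (l ++ [.zero])) u v (k - 1)) := by
  refine wordCount_extend (fun x l => l ++ [x]) ?_ ?_
    (fun l hl => ⟨l.getLast hl, l.dropLast, (List.dropLast_append_getLast hl).symm⟩) p u v k h
  · intro x x' l l' e
    have := List.append_inj' e rfl
    exact ⟨by simpa using this.2, this.1⟩
  · intro x y l
    simp [List.count_append, List.count_cons]

/-! ### Closed formulas for the word counts. -/

/-- The binomial coefficient `(m choose v - 1)`, which is `0` for `v = 0`. -/
def choosePred (m : ℕ) : ℕ → ℕ
  | 0 => 0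
  | v + 1 => m.choose v

theorem choosePred_add_one (m v : ℕ) : choosePred m (v + 1) = m.choose v := rfl

theorem choose_succ_eq (m v : ℕ) : (m + 1).choose v = m.choose v + choosePred m v := by
  cases v with
  | zero => simp [choosePred]
  | succ v => rw [Nat.choose_succ_succ, choosePred, add_comm]

theorem choosePred_succ (m v : ℕ) : choosePred (m + 1) (v + 1) = m.choose v + choosePred m v :=
  choose_succ_eq m v

theorem mul_multichoose_succ (u k : ℕ) :
    u * (u + 1).multichoose k = (u + k) * u.multichoose k := by
  rcases u with _ | w
  · cases k <;> simp
  rw [Nat.multichoose_eq, Nat.multichoose_eq, show w + 1 + 1 + k - 1 = w + k + 1 by omega,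
    show w + 1 + k - 1 = w + k by omega]
  have h := Nat.add_one_mul_choose_eq (w + k) w
  rw [Nat.choose_symm_of_eq_add (show w + k = w + k from rfl),
    Nat.choose_symm_of_eq_add (show w + k + 1 = (w + 1) + k by ring)] at h
  linarith

/-- The boundary identity of the reflection principle: one unit below the diagonal the two terms of
`ballot` with c = 1 cancel. -/
theorem multichoose_mul_choose_eq (u k : ℕ) (m : ℕ) (hm : m + 1 = 2 * u + k) :
    u.multichoose k * m.choose u = (u + 1).multichoose k * choosePred m u := by
  rcases u with _ | w
  · cases k with
    | zero => omega
    | succ k => simp [choosePred]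
  rw [choosePred]
  have h1 := mul_multichoose_succ (w + 1) k
  have h2 := Nat.choose_succ_right_eq m w
  rw [show m - w = w + 1 + k by omega] at h2
  have h3 : 0 < (w + 1) * (w + 1 + k) := by positivity
  refine Nat.eq_of_mul_eq_mul_left h3 ?_
  calc _ = ((w + 1 + k) * (w + 1).multichoose k) * (m.choose (w + 1) * (w + 1)) := by ring
    _ = _ := by rw [h2, ← h1]; ring

/-- The reflection formula for paths from `0` staying nonnegative. -/
def ballot (c u v k : ℕ) : ℤ :=
  (u + c).multichoose k * (u + v + k).choose v -
    (u + c + 1).multichoose k * choosePred (u + v + k) v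

/-- Both terms of `ballot` obey the recursion by last letter, by the Pascal rules for `choose` and
`multichoose`. Hence c only matters through the boundary condition: c = 0 and c = 1 forbid and allow
flat steps at height 0. -/
theorem ballot_rec (c u v k : ℕ) :
    ballot c (u + 1) v k = ballot c u v k + (if v = 0 then 0 else ballot c (u + 1) (v - 1) k) +
      (if k = 0 then 0 else ballot c (u + 1) v (k - 1)) := by
  simp only [ballot]
  rcases v with _ | v <;> rcases k with _ | k
  · simp [choosePred]
  · simp only [choosePred, if_true, if_neg (Nat.succ_ne_zero _), Nat.add_sub_cancel]
    rw [show u + 1 + c = u + c + 1 by ring, Nat.multichoose_succ_succ]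
    simp
  · simp only [if_true, if_neg (Nat.succ_ne_zero _), Nat.add_sub_cancel, Nat.multichoose_zero_right]
    rw [show u + 1 + (v + 1) + 0 = (u + v + 1) + 1 by ring,
      show u + (v + 1) + 0 = u + v + 1 by ring, show u + 1 + v + 0 = u + v + 1 by ring,
      choose_succ_eq (u + v + 1) (v + 1), choosePred_succ (u + v + 1) v]
    simp only [choosePred_add_one]
    push_cast; ring
  · simp only [if_neg (Nat.succ_ne_zero _), Nat.add_sub_cancel]
    rw [show u + 1 + (v + 1) + (k + 1) = (u + v + k + 2) + 1 by ring,
      show u + (v + 1) + (k + 1) = u + v + k + 2 by ring,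
      show u + 1 + v + (k + 1) = u + v + k + 2 by ring,
      show u + 1 + (v + 1) + k = u + v + k + 2 by ring,
      show u + 1 + c + 1 = (u + c + 1) + 1 by ring, show u + 1 + c = u + c + 1 by ring,
      choose_succ_eq (u + v + k + 2) (v + 1), choosePred_succ (u + v + k + 2) v,
      Nat.multichoose_succ_succ (u + c + 1), Nat.multichoose_succ_succ (u + c)]
    simp only [choosePred_add_one]
    push_cast; ring

theorem pathEnd_eq (l : List SignType) (u v : ℕ) (hu : l.count .pos = u) (hv : l.count .neg = v) :
    pathEnd l = (u : ℤ) - v := by rw [pathEnd, hu, hv]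

theorem le_of_pathDepth_eq_zero {l : List SignType} {u v : ℕ} (hu : l.count .pos = u)
    (hv : l.count .neg = v) (h : pathDepth l = 0) : v ≤ u := by
  have h1 := neg_pathDepth_le_pathEnd l
  rw [pathEnd_eq l u v hu hv, h] at h1
  omega

/-- Above the diagonal, removing the last letter gives exactly `ballot_rec`. On the diagonal u = v
only a down step can come last, since a flat one would lie at height 0. -/
theorem wordCount_nonneg_noflat (u v k : ℕ) (h : v ≤ u) :
    (wordCount (fun l => pathDepth l = 0 ∧ ¬ FlatAtMin l) u v k : ℤ) = ballot 0 u v k := by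
  induction hM : u + v + k generalizing u v k with
  | zero =>
    obtain ⟨rfl, rfl, rfl⟩ : u = 0 ∧ v = 0 ∧ k = 0 := by omega
    rw [wordCount_zero _ (by simp [pathDepth, FlatAtMin])]
    simp [ballot, choosePred]
  | succ m ih =>
    rw [wordCount_append _ u v k (by omega)]
    have hpos : ∀ l, (pathDepth (l ++ [.pos]) = 0 ∧ ¬ FlatAtMin (l ++ [.pos])) ↔
        (pathDepth l = 0 ∧ ¬ FlatAtMin l) := fun l => by
      rw [pathDepth_append_pos, flatAtMin_append_pos]
    have e2 : (if v = 0 then 0 else wordCount (fun l => pathDepth (l ++ [.neg]) = 0 ∧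
        ¬ FlatAtMin (l ++ [.neg])) u (v - 1) k : ℕ) =
        (if v = 0 then 0 else wordCount (fun l => pathDepth l = 0 ∧ ¬ FlatAtMin l) u (v - 1) k) := by
      split_ifs with hv
      · rfl
      refine wordCount_congr fun l hl1 hl2 _ => ?_
      have h1 := pathDepth_append_neg l
      have h2 := pathEnd_eq l _ _ hl1 hl2
      rw [flatAtMin_append_neg]
      have : pathDepth (l ++ [.neg]) = 0 ↔ pathDepth l = 0 := by omega
      rw [this]
      refine and_congr_right fun h0 => not_congr (and_iff_left ?_)
      omega
    rw [e2]
    simp only [hpos]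
    have h3 : (if k = 0 then 0 else wordCount (fun l => pathDepth (l ++ [.zero]) = 0 ∧
        ¬ FlatAtMin (l ++ [.zero])) u v (k - 1) : ℕ) =
        if k = 0 ∨ u = v then 0 else wordCount (fun l => pathDepth l = 0 ∧ ¬ FlatAtMin l) u v (k - 1) := by
      by_cases hk : k = 0
      · simp [hk]
      rw [if_neg hk]
      split_ifs with huv
      · refine wordCount_eq_zero fun l hl1 hl2 _ ⟨h4, h5⟩ => h5 ?_
        have h2 := pathEnd_eq l _ _ hl1 hl2
        rw [pathDepth_append_zero] at h4
        rw [flatAtMin_append_zero]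
        right; omega
      · refine wordCount_congr fun l hl1 hl2 _ => ?_
        have h2 := pathEnd_eq l _ _ hl1 hl2
        rw [pathDepth_append_zero, flatAtMin_append_zero]
        refine and_congr_right fun h0 => not_congr (or_iff_left ?_)
        omega
    rw [h3]
    have e1 : (if u = 0 then 0 else wordCount (fun l => pathDepth l = 0 ∧ ¬ FlatAtMin l) (u - 1) v k : ℕ)
        = if u = v then 0 else wordCount (fun l => pathDepth l = 0 ∧ ¬ FlatAtMin l) (u - 1) v k := by
      split_ifs with h1 h2 h2
      · rfl
      · omega
      · refine wordCount_eq_zero fun l hl1 hl2 _ h4 => ?_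
        have := le_of_pathDepth_eq_zero hl1 hl2 h4.1
        omega
      · rfl
    rw [e1]
    have i1 : ((if v = 0 then 0 else wordCount (fun l => pathDepth l = 0 ∧ ¬ FlatAtMin l) u (v - 1) k : ℕ) : ℤ)
        = if v = 0 then 0 else ballot 0 u (v - 1) k := by
      split_ifs with hv
      · rfl
      · exact ih u (v - 1) k (by omega) (by omega)
    rw [Nat.cast_add, Nat.cast_add, i1]
    rcases eq_or_lt_of_le h with huv | huv
    · subst huv
      rw [if_pos rfl, if_pos (Or.inr rfl), Nat.cast_zero]
      rcases v with _ | v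
      · rcases k with _ | k
        · omega
        · simp [ballot, choosePred]
      · rw [if_neg (Nat.succ_ne_zero _), Nat.add_sub_cancel]
        have hE := multichoose_mul_choose_eq (v + 1) k m (by omega)
        have hE' : ((v + 1).multichoose k * m.choose (v + 1) : ℤ) =
          (v + 1 + 1).multichoose k * choosePred m (v + 1) := by exact_mod_cast hE
        -- The formal terms of `ballot_rec` for the two impossible last letters, up and flat, cancel
        -- each other on the diagonal.
        have : ballot 0 v (v + 1) k + (if k = 0 then 0 else ballot 0 (v + 1) (v + 1) (k - 1)) = 0 := by
          refine Eq.trans ?_ (sub_eq_zero.mpr hE')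
          rcases k with _ | k
          · simp only [ballot, if_true, show v + (v + 1) + 0 = m by omega]
            simp
          · simp only [ballot, if_neg (Nat.succ_ne_zero _), Nat.add_sub_cancel, add_zero,
              show v + (v + 1) + (k + 1) = m by omega, show v + 1 + (v + 1) + k = m by omega]
            rw [Nat.multichoose_succ_succ (v + 1), Nat.multichoose_succ_succ v]
            push_cast
            ring
        have hr := ballot_rec 0 v (v + 1) k
        rw [if_neg (Nat.succ_ne_zero _), Nat.add_sub_cancel] at hr
        linarith
    · obtain ⟨w, rfl⟩ : ∃ w, u = w + 1 := ⟨u - 1, by omega⟩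
      have hne : w + 1 ≠ v := by omega
      have hr := ballot_rec 0 w v k
      simp only [hne, or_false, if_false, Nat.add_sub_cancel]
      rw [ih w v k (by omega) (by omega)]
      rcases k with _ | k
      · simp only [if_true, Nat.cast_zero] at hr ⊢; linarith
      · rw [if_neg (Nat.succ_ne_zero _), Nat.add_sub_cancel] at hr
        rw [if_neg (Nat.succ_ne_zero _), Nat.add_sub_cancel, ih (w + 1) v k (by omega) (by omega)]
        linarith

/-- The same induction, but a flat last letter is always allowed; on the diagonal only the term of a
last up step has to vanish. -/
theorem wordCount_nonneg (u v k : ℕ) (h : v ≤ u) :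
    (wordCount (fun l => pathDepth l = 0) u v k : ℤ) = ballot 1 u v k := by
  induction hM : u + v + k generalizing u v k with
  | zero =>
    obtain ⟨rfl, rfl, rfl⟩ : u = 0 ∧ v = 0 ∧ k = 0 := by omega
    rw [wordCount_zero _ (by simp [pathDepth])]
    simp [ballot, choosePred]
  | succ m ih =>
    rw [wordCount_append _ u v k (by omega)]
    simp only [pathDepth_append_pos, pathDepth_append_zero]
    have e2 : (if v = 0 then 0 else wordCount (fun l => pathDepth (l ++ [.neg]) = 0) u (v - 1) k : ℕ) =
        (if v = 0 then 0 else wordCount (fun l => pathDepth l = 0) u (v - 1) k) := by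
      split_ifs with hv
      · rfl
      refine wordCount_congr fun l hl1 hl2 _ => ?_
      have h1 := pathDepth_append_neg l
      have h2 := pathEnd_eq l _ _ hl1 hl2
      omega
    have e1 : (if u = 0 then 0 else wordCount (fun l => pathDepth l = 0) (u - 1) v k : ℕ)
        = if u = v then 0 else wordCount (fun l => pathDepth l = 0) (u - 1) v k := by
      split_ifs with h1 h2 h2
      · rfl
      · omega
      · refine wordCount_eq_zero fun l hl1 hl2 _ h4 => ?_
        have := le_of_pathDepth_eq_zero hl1 hl2 h4
        omega
      · rfl
    rw [e1, e2]
    have i1 : ((if v = 0 then 0 else wordCount (fun l => pathDepth l = 0) u (v - 1) k : ℕ) : ℤ)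
        = if v = 0 then 0 else ballot 1 u (v - 1) k := by
      split_ifs with hv
      · rfl
      · exact ih u (v - 1) k (by omega) (by omega)
    have i2 : ((if k = 0 then 0 else wordCount (fun l => pathDepth l = 0) u v (k - 1) : ℕ) : ℤ)
        = if k = 0 then 0 else ballot 1 u v (k - 1) := by
      split_ifs with hv
      · rfl
      · exact ih u v (k - 1) h (by omega)
    rw [Nat.cast_add, Nat.cast_add, i1, i2]
    rcases eq_or_lt_of_le h with huv | huv
    · subst huv
      rw [if_pos rfl]
      rcases v with _ | v
      · rcases k with _ | k
        · omega
        · simp [ballot, choosePred]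
      · have hr := ballot_rec 1 v (v + 1) k
        have hE := multichoose_mul_choose_eq (v + 1) k m (by omega)
        have hE' : ((v + 1).multichoose k * m.choose (v + 1) : ℤ) =
          (v + 1 + 1).multichoose k * choosePred m (v + 1) := by exact_mod_cast hE
        have : ballot 1 v (v + 1) k = 0 := by
          rw [ballot, show v + (v + 1) + k = m by omega, hE', sub_self]
        rw [hr, this]
        push_cast
        ring
    · obtain ⟨w, rfl⟩ : ∃ w, u = w + 1 := ⟨u - 1, by omega⟩
      rw [if_neg (by omega), ballot_rec 1 w v k, Nat.add_sub_cancel, ih w v k (by omega) (by omega)]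

/-- Words are decomposed by their first letter. Prepending a letter changes the property only for
words of depth 0, and these corrections are the ballot counts above; they vanish when there are more
down than up steps. Both ranges of u and v are needed because the induction crosses the diagonal. -/
theorem wordCount_noflat_aux (u v k : ℕ) :
    (v ≤ u → wordCount (fun l => ¬ FlatAtMin l) u v k = u.multichoose k * (u + v + k).choose v) ∧
    (u ≤ v → wordCount (fun l => ¬ FlatAtMin l) u v k = v.multichoose k * (u + v + k).choose u) := by
  induction hM : u + v + k generalizing u v k with
  | zero =>
    obtain ⟨rfl, rfl, rfl⟩ : u = 0 ∧ v = 0 ∧ k = 0 := by omega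
    rw [wordCount_zero _ (by simp [FlatAtMin])]
    simp
  | succ m ih =>
    have hS : ∀ u v k, u < v → wordCount (fun l => pathDepth l = 0 ∧ ¬ FlatAtMin l) u v k = 0 :=
      fun u v k h => wordCount_eq_zero fun l hl1 hl2 _ h4 => by
        have := le_of_pathDepth_eq_zero hl1 hl2 h4.1
        omega
    have hQ : ∀ u v k, u < v → wordCount (fun l => pathDepth l = 0) u v k = 0 :=
      fun u v k h => wordCount_eq_zero fun l hl1 hl2 _ h4 => by
        have := le_of_pathDepth_eq_zero hl1 hl2 h4
        omega
    -- An up step in front of a word of depth 0 creates a new strict minimum, which makes every flat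
    -- step of the word harmless.
    have r1 : ∀ u v k, wordCount (fun l => ¬ FlatAtMin (.pos :: l)) u v k +
        wordCount (fun l => pathDepth l = 0 ∧ ¬ FlatAtMin l) u v k =
        wordCount (fun l => ¬ FlatAtMin l) u v k + wordCount (fun l => pathDepth l = 0) u v k := by
      intro u v k
      have a1 := wordCount_split (fun l => ¬ FlatAtMin (.pos :: l)) FlatAtMin u v k
      have a2 := wordCount_split (fun l => pathDepth l = 0) FlatAtMin u v k
      have a3 : wordCount (fun l => ¬ FlatAtMin (.pos :: l) ∧ FlatAtMin l) u v k =
          wordCount (fun l => pathDepth l = 0 ∧ FlatAtMin l) u v k :=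
        wordCount_congr fun l _ _ _ => by simp only [FlatAtMin]; tauto
      have a4 : wordCount (fun l => ¬ FlatAtMin (.pos :: l) ∧ ¬ FlatAtMin l) u v k =
          wordCount (fun l => ¬ FlatAtMin l) u v k :=
        wordCount_congr fun l _ _ _ => by simp only [FlatAtMin]; tauto
      omega
    -- A flat step in front is itself at the minimum exactly when the rest has depth 0.
    have r2 : ∀ u v k, wordCount (fun l => ¬ FlatAtMin (.zero :: l)) u v k +
        wordCount (fun l => pathDepth l = 0 ∧ ¬ FlatAtMin l) u v k =
        wordCount (fun l => ¬ FlatAtMin l) u v k := by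
      intro u v k
      have a1 := wordCount_split (fun l => ¬ FlatAtMin l) (fun l => pathDepth l = 0) u v k
      have a3 : wordCount (fun l => ¬ FlatAtMin (.zero :: l)) u v k =
          wordCount (fun l => ¬ FlatAtMin l ∧ ¬ pathDepth l = 0) u v k :=
        wordCount_congr fun l _ _ _ => by simp only [FlatAtMin]; tauto
      have a4 : wordCount (fun l => ¬ FlatAtMin l ∧ pathDepth l = 0) u v k =
          wordCount (fun l => pathDepth l = 0 ∧ ¬ FlatAtMin l) u v k :=
        wordCount_congr fun l _ _ _ => by tauto
      omega
    have r3 : ∀ u v k, wordCount (fun l => ¬ FlatAtMin (.neg :: l)) u v k =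
        wordCount (fun l => ¬ FlatAtMin l) u v k := fun u v k => rfl
    have hrec := wordCount_cons (fun l => ¬ FlatAtMin l) u v k (by omega)
    simp only [r3] at hrec
    rcases lt_trichotomy u v with huv | huv | huv
    · refine ⟨fun h => absurd h (by omega), fun _ => ?_⟩
      obtain ⟨w, rfl⟩ : ∃ w, v = w + 1 := ⟨v - 1, by omega⟩
      have b1 := (ih u w k (by omega)).2 (by omega)
      rw [hrec, if_neg w.succ_ne_zero, Nat.add_sub_cancel, b1]
      have b2 : (if u = 0 then 0 else wordCount (fun l => ¬ FlatAtMin (.pos :: l)) (u - 1) (w + 1) k) =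
          (w + 1).multichoose k * choosePred m u := by
        rcases u with _ | u
        · simp [choosePred]
        · have c1 := r1 u (w + 1) k
          rw [hS u _ _ (by omega), hQ u _ _ (by omega), (ih u (w + 1) k (by omega)).2 (by omega)] at c1
          rw [if_neg u.succ_ne_zero, Nat.add_sub_cancel, choosePred_add_one]
          omega
      rw [b2, choose_succ_eq]
      rcases k with _ | k
      · simp; ring
      · have c2 := r2 u (w + 1) k
        rw [hS u _ _ (by omega), (ih u (w + 1) k (by omega)).2 (by omega)] at c2
        rw [if_neg k.succ_ne_zero, Nat.add_sub_cancel, show wordCount (fun l => ¬ FlatAtMin (.zero :: l)) u (w + 1) k = _ by simpa using c2,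
          Nat.multichoose_succ_succ]
        ring
    · subst huv
      suffices h : wordCount (fun l => ¬ FlatAtMin l) u u k = u.multichoose k * (m + 1).choose u from
        ⟨fun _ => h, fun _ => h⟩
      rcases u with _ | u
      · rcases k with _ | k
        · omega
        · have c2 := r2 0 0 k
          have c3 := wordCount_nonneg_noflat 0 0 k le_rfl
          rw [(ih 0 0 k (by omega)).2 le_rfl] at c2
          simp only [ballot, choosePred] at c3
          simp at hrec c3 c2
          rw [c3] at c2
          rw [hrec]
          simp
          omega
      · have hE := multichoose_mul_choose_eq (u + 1) k m (by omega)
        have b1 := (ih (u + 1) u k (by omega)).1 (by omega)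
        have c1 := r1 u (u + 1) k
        rw [hS u _ _ (by omega), hQ u _ _ (by omega), (ih u (u + 1) k (by omega)).2 (by omega), add_zero, add_zero] at c1
        rw [hrec, if_neg u.succ_ne_zero, if_neg u.succ_ne_zero, Nat.add_sub_cancel, b1, c1, choose_succ_eq,
          choosePred_add_one, mul_add, hE, choosePred_add_one]
        rcases k with _ | k
        · simp
        · have c2 := r2 (u + 1) (u + 1) k
          have c3 := wordCount_nonneg_noflat (u + 1) (u + 1) k le_rfl
          rw [(ih (u + 1) (u + 1) k (by omega)).2 le_rfl] at c2
          rw [ballot, add_zero, show u + 1 + (u + 1) + k = m by omega, choosePred_add_one] at c3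
          rw [if_neg k.succ_ne_zero, Nat.add_sub_cancel]
          zify at *
          rw [c3] at c2
          rw [Nat.multichoose_succ_succ (u + 1) k]
          push_cast
          linarith
    · refine ⟨fun _ => ?_, fun h => absurd h (by omega)⟩
      obtain ⟨w, rfl⟩ : ∃ w, u = w + 1 := ⟨u - 1, by omega⟩
      have c1 := r1 w v k
      rw [(ih w v k (by omega)).1 (by omega)] at c1
      have d1 := wordCount_nonneg_noflat w v k (by omega)
      have d2 := wordCount_nonneg w v k (by omega)
      have b2 : (if v = 0 then 0 else wordCount (fun l => ¬ FlatAtMin l) (w + 1) (v - 1) k) =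
          (w + 1).multichoose k * choosePred m v := by
        rcases v with _ | v
        · simp [choosePred]
        · rw [if_neg v.succ_ne_zero, Nat.add_sub_cancel, choosePred_add_one]
          exact (ih (w + 1) v k (by omega)).1 (by omega)
      rw [hrec, if_neg w.succ_ne_zero, Nat.add_sub_cancel, b2, choose_succ_eq]
      rw [ballot, add_zero, show w + v + k = m by omega] at d1
      rw [ballot, show w + v + k = m by omega] at d2
      rcases k with _ | k
      · simp only [Nat.multichoose_zero_right] at *
        simp only [if_true]
        omega
      · have c2 := r2 (w + 1) v k
        rw [(ih (w + 1) v k (by omega)).1 (by omega)] at c2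
        have d3 := wordCount_nonneg_noflat (w + 1) v k (by omega)
        rw [ballot, add_zero, show w + 1 + v + k = m by omega] at d3
        rw [if_neg k.succ_ne_zero, Nat.add_sub_cancel]
        rw [Nat.multichoose_succ_succ (w + 1), Nat.multichoose_succ_succ w] at d2
        rw [Nat.multichoose_succ_succ w] at d1
        rw [Nat.multichoose_succ_succ w]
        replace c1 := congrArg (Nat.cast : ℕ → ℤ) c1
        replace c2 := congrArg (Nat.cast : ℕ → ℤ) c2
        apply Nat.cast_injective (R := ℤ)
        push_cast at c1 c2 d1 d2 d3 ⊢
        rw [d1, d2] at c1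
        rw [d3] at c2
        linarith

theorem wordCount_noflat (u k : ℕ) :
    wordCount (fun l => ¬ FlatAtMin l) u u k = u.multichoose k * (2 * u + k).choose u := by
  rw [(wordCount_noflat_aux u u k).1 le_rfl, two_mul]

/-- A multinomial coefficient, factored so that for u = v it shares its binomial with
`wordCount_noflat`. -/
theorem wordCount_true (u v k : ℕ) :
    wordCount (fun _ => True) u v k = (v + 1).multichoose k * (u + v + k).choose u := by
  induction hM : u + v + k generalizing u v k with
  | zero =>
    obtain ⟨rfl, rfl, rfl⟩ : u = 0 ∧ v = 0 ∧ k = 0 := by omega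
    rw [wordCount_zero _ trivial]
    simp
  | succ m ih =>
    rw [wordCount_cons _ _ _ _ (by omega), choose_succ_eq]
    have b1 : (if u = 0 then 0 else wordCount (fun _ => True) (u - 1) v k) =
        (v + 1).multichoose k * choosePred m u := by
      rcases u with _ | u
      · simp [choosePred]
      · rw [if_neg u.succ_ne_zero, Nat.add_sub_cancel, choosePred_add_one, ih _ _ _ (by omega)]
    rw [b1, mul_add, add_comm (_ * m.choose u), add_assoc]
    congr 1
    rcases v with _ | v <;> rcases k with _ | k
    · simp
      rw [Nat.choose_eq_zero_of_lt (by omega)]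
    · rw [if_pos rfl, if_neg k.succ_ne_zero, Nat.add_sub_cancel, ih _ _ _ (by omega)]
      simp
    · rw [if_pos rfl, if_neg v.succ_ne_zero, Nat.add_sub_cancel, ih _ _ _ (by omega)]
      simp
    · rw [if_neg v.succ_ne_zero, if_neg k.succ_ne_zero, Nat.add_sub_cancel, Nat.add_sub_cancel, ih _ _ _ (by omega),
        ih _ _ _ (by omega), Nat.multichoose_succ_succ (v + 1)]
      ring

/-- Complementary counting; the Pascal rule for `multichoose` turns the difference into one product.
-/
theorem wordCount_flat (u k : ℕ) :
    wordCount FlatAtMin u u (k + 1) = (u + 1).multichoose k * (2 * u + (k + 1)).choose u := by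
  have h1 := wordCount_split (fun _ => True) FlatAtMin u u (k + 1)
  simp only [true_and] at h1
  rw [wordCount_noflat, wordCount_true, Nat.multichoose_succ_succ, ← two_mul, add_mul] at h1
  exact (Nat.add_left_cancel (h1.trans (add_comm _ _))).symm

/-! ### Periodic ±1 walks and noncrossing matchings. -/

section Arcs

/-- An arc of a `±1` walk joins an up step to the down step that first returns to its height. -/
def IsArc (H : ℤ → ℤ) (p q : ℤ) : Prop :=
  p < q ∧ H (q + 1) = H p ∧ ∀ t, p < t → t ≤ q → H p < H t

/-- Periodic walks with steps `±1`. -/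
structure IsUnitWalk (P : ℤ) (H : ℤ → ℤ) : Prop where
  pos : 0 < P
  step : ∀ p, H (p + 1) = H p + 1 ∨ H (p + 1) = H p - 1
  periodic : ∀ p, H (p + P) = H p

variable {H : ℤ → ℤ} {P : ℤ}

theorem IsUnitWalk.exists_arc_of_up (hH : IsUnitWalk P H) {p : ℤ} (hp : H (p + 1) = H p + 1) :
    ∃ q, IsArc H p q := by
  classical
  have hex : ∃ n : ℕ, H (p + 2 + n) ≤ H p := by
    -- The walk is back at its height after two periods. One period might end before p + 2, as only
    -- 0 < P is known.
    refine ⟨(2 * P - 2).toNat, ?_⟩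
    have := hH.pos
    rw [Int.toNat_of_nonneg (by omega), show p + 2 + (2 * P - 2) = p + P + P by ring,
      hH.periodic, hH.periodic]
  set n := Nat.find hex with hn
  have h1 : H (p + 2 + n) ≤ H p := Nat.find_spec hex
  have h2 : ∀ t, p < t → t ≤ p + 1 + n → H p < H t := by
    intro t ht1 ht2
    by_cases ht : t = p + 1
    · rw [ht, hp]; omega
    · have h3 := Nat.find_min hex (m := (t - p - 2).toNat) (by omega)
      rw [Int.toNat_of_nonneg (by omega), show p + 2 + (t - p - 2) = t by ring] at h3
      omega
  refine ⟨p + 1 + n, by omega, ?_, h2⟩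
  have h3 := h2 (p + 1 + n) (by omega) le_rfl
  have h4 := hH.step (p + 1 + n)
  rw [show p + 1 + (n : ℤ) + 1 = p + 2 + n by ring] at h4 ⊢
  omega

theorem IsUnitWalk.exists_arc_of_down (hH : IsUnitWalk P H) {q : ℤ} (hq : H (q + 1) = H q - 1) :
    ∃ p, IsArc H p q := by
  classical
  have hex : ∃ n : ℕ, H (q - 1 - n) ≤ H (q + 1) := by
    refine ⟨(2 * P - 2).toNat, ?_⟩
    have := hH.pos
    rw [Int.toNat_of_nonneg (by omega), ← hH.periodic, ← hH.periodic,
      show q - 1 - (2 * P - 2) + P + P = q + 1 by ring]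
  set n := Nat.find hex with hn
  have h1 : H (q - 1 - n) ≤ H (q + 1) := Nat.find_spec hex
  have h2 : ∀ t, q - 1 - n < t → t ≤ q → H (q + 1) < H t := by
    intro t ht1 ht2
    by_cases ht : t = q
    · rw [ht, hq]; omega
    · have h3 := Nat.find_min hex (m := (q - 1 - t).toNat) (by omega)
      rw [Int.toNat_of_nonneg (by omega), show q - 1 - (q - 1 - t) = t by ring] at h3
      omega
  have h3 := h2 (q - 1 - n + 1) (by omega) (by omega)
  have h4 := hH.step (q - 1 - n)
  have h5 : H (q + 1) = H (q - 1 - n) := by omega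
  exact ⟨q - 1 - n, by omega, h5, fun t ht1 ht2 => h5 ▸ h2 t ht1 ht2⟩

theorem IsUnitWalk.exists_arc (hH : IsUnitWalk P H) (p : ℤ) :
    (∃ q, IsArc H p q) ∨ ∃ q, IsArc H q p :=
  (hH.step p).imp hH.exists_arc_of_up hH.exists_arc_of_down

theorem IsArc.up (hH : IsUnitWalk P H) {p q : ℤ} (h : IsArc H p q) : H (p + 1) = H p + 1 := by
  obtain ⟨h1, -, h3⟩ := h
  have := h3 (p + 1) (by omega) (by omega)
  have := hH.step p
  omega

theorem IsArc.down (hH : IsUnitWalk P H) {p q : ℤ} (h : IsArc H p q) : H (q + 1) = H q - 1 := by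
  obtain ⟨h1, h2, h3⟩ := h
  have := h3 q h1 le_rfl
  have := hH.step q
  omega

theorem IsArc.right_unique {p q q' : ℤ} (h : IsArc H p q) (h' : IsArc H p q') : q = q' := by
  obtain ⟨h1, h2, h3⟩ := h
  obtain ⟨h1', h2', h3'⟩ := h'
  rcases lt_trichotomy q q' with hlt | heq | hlt
  · have := h3' (q + 1) (by omega) (by omega); omega
  · exact heq
  · have := h3 (q' + 1) (by omega) (by omega); omega

theorem IsArc.left_unique {p p' q : ℤ} (h : IsArc H p q) (h' : IsArc H p' q) : p = p' := by
  obtain ⟨h1, h2, h3⟩ := h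
  obtain ⟨h1', h2', h3'⟩ := h'
  rcases lt_trichotomy p p' with hlt | heq | hlt
  · have := h3 p' (by omega) (by omega); omega
  · exact heq
  · have := h3' p (by omega) (by omega); omega

/-- An inner arc starts strictly higher than the outer one and stays above its start, so it must
close before the outer level is reached. -/
theorem IsArc.nested {p q p' q' : ℤ} (h : IsArc H p q) (h' : IsArc H p' q') (h1 : p < p')
    (h2 : p' < q) : q' < q := by
  obtain ⟨-, e, i⟩ := h
  obtain ⟨h1', e', i'⟩ := h'
  have h3 := i p' h1 h2.le
  by_contra hlt
  rcases eq_or_lt_of_le (not_lt.mp hlt) with heq | hlt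
  · subst heq; omega
  · have := i' (q + 1) (by omega) (by omega); omega

theorem IsArc.shift (hH : ∀ p, H (p + P) = H p) {p q : ℤ} (h : IsArc H p q) :
    IsArc H (p + P) (q + P) := by
  obtain ⟨h1, h2, h3⟩ := h
  refine ⟨by omega, by rw [add_right_comm, hH, hH, h2], fun t ht1 ht2 => ?_⟩
  have := h3 (t - P) (by omega) (by omega)
  rwa [hH, ← sub_add_cancel t P, hH]

theorem IsArc.lt_add (hH : ∀ p, H (p + P) = H p) (hP : 0 < P) {p q : ℤ} (h : IsArc H p q) :
    q < p + P := by
  obtain ⟨h1, h2, h3⟩ := h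
  by_contra hlt
  have := h3 (p + P) (by omega) (by omega)
  rw [hH] at this
  exact lt_irrefl _ this

theorem IsUnitWalk.parity (hH : IsUnitWalk P H) (p : ℤ) (n : ℕ) : (H (p + n) - H p - n) % 2 = 0 := by
  induction n with
  | zero => simp
  | succ n ih =>
    have := hH.step (p + n)
    push_cast
    rw [← add_assoc]
    omega

theorem IsArc.odd (hH : IsUnitWalk P H) {p q : ℤ} (h : IsArc H p q) : (q - p) % 2 = 1 := by
  have h1 := hH.parity p (q + 1 - p).toNat
  have := h.1
  rw [Int.toNat_of_nonneg (by omega), show p + (q + 1 - p) = q + 1 by ring, h.2.1] at h1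
  omega

open Classical in
/-- Going around a circle with `2 N` points, the next endpoint of the chord starting at `p`. -/
noncomputable def arcMap (H : ℤ → ℤ) (N : ℕ) (p : ℤ) : ℤ :=
  if h : ∃ q, IsArc H p q then h.choose
  else if h : ∃ q, IsArc H q p then h.choose + 2 * N else p

theorem IsArc.arcMap_left {N : ℕ} {p q : ℤ} (h : IsArc H p q) : arcMap H N p = q := by
  have hex : ∃ q, IsArc H p q := ⟨q, h⟩
  rw [arcMap, dif_pos hex]
  exact hex.choose_spec.right_unique h

theorem IsArc.arcMap_right (hH : IsUnitWalk P H) {N : ℕ} {p q : ℤ} (h : IsArc H p q) :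
    arcMap H N q = p + 2 * N := by
  have hex : ∃ p, IsArc H p q := ⟨p, h⟩
  have hno : ¬ ∃ r, IsArc H q r := by
    rintro ⟨r, hr⟩
    have h1 := hr.up hH
    have h2 := h.down hH
    omega
  rw [arcMap, dif_neg hno, dif_pos hex, hex.choose_spec.left_unique h]

/-- Noncrossing perfect matchings of `2 N` points on a circle, lifted to `ℤ`: `F p` is the next
partner of `p` in clockwise direction. The pairs `{2 i, 2 i + 1}` are excluded. -/
structure IsMatching (N : ℕ) (F : ℤ → ℤ) : Prop where
  lt : ∀ p, p < F p
  invol : ∀ p, F (F p) = p + 2 * N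
  noncrossing : ∀ p q, p < q → q < F p → F q ≤ F p ∨ p + 2 * N ≤ F q
  ne : ∀ i, F (2 * i) ≠ 2 * i + 1

/-- The arcs of a walk are nested or disjoint, and translating by a period reduces every
configuration to `IsArc.nested`. The two hypotheses exclude both shapes in which the pair {2i, 2i+1}
can appear: a shortest arc, or an arc going around the whole circle. -/
theorem arcMap_isMatching {N : ℕ} (hH : IsUnitWalk (2 * N) H)
    (hne : ∀ i, ¬ IsArc H (2 * i) (2 * i + 1))
    (hne' : ∀ i, ¬ IsArc H (2 * i + 1 - 2 * N) (2 * i)) : IsMatching N (arcMap H N) where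
  lt p := by
    rcases hH.exists_arc p with ⟨q, h⟩ | ⟨q, h⟩
    · rw [h.arcMap_left]; exact h.1
    · rw [h.arcMap_right hH]; exact h.lt_add hH.periodic hH.pos
  invol p := by
    rcases hH.exists_arc p with ⟨q, h⟩ | ⟨q, h⟩
    · rw [h.arcMap_left, h.arcMap_right hH]
    · rw [h.arcMap_right hH, (h.shift hH.periodic).arcMap_left]
  noncrossing p q hpq hq := by
    rcases hH.exists_arc p with ⟨r, h⟩ | ⟨r, h⟩ <;> rcases hH.exists_arc q with ⟨s, h'⟩ | ⟨s, h'⟩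
    · rw [h.arcMap_left] at hq
      rw [h.arcMap_left, h'.arcMap_left]
      exact Or.inl (h.nested h' hpq hq).le
    · rw [h.arcMap_left] at hq
      rw [h.arcMap_left, h'.arcMap_right hH]
      right
      by_contra hlt
      have hs : s < p := by omega
      have := h'.nested h hs hpq
      omega
    · rw [h.arcMap_right hH] at hq
      rw [h.arcMap_right hH, h'.arcMap_left]
      by_contra! hlt
      have h2 := h.shift hH.periodic
      have := h'.nested h2 (by omega) (by omega)
      omega
    · rw [h.arcMap_right hH] at hq
      rw [h.arcMap_right hH, h'.arcMap_right hH]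
      by_contra! hlt
      have := h.nested h' (by omega) (by omega)
      omega
  ne i hi := by
    rcases hH.exists_arc (2 * i) with ⟨q, h⟩ | ⟨q, h⟩
    · rw [h.arcMap_left] at hi
      exact hne i (hi ▸ h)
    · rw [h.arcMap_right hH] at hi
      rw [show q = 2 * i + 1 - 2 * N by omega] at h
      exact hne' i h

theorem arcMap_add (hH : IsUnitWalk P H) (hP : ∀ p, H (p + P) = H p) (N : ℕ) (p : ℤ) :
    arcMap H N (p + P) = arcMap H N p + P := by
  rcases hH.exists_arc p with ⟨q, h⟩ | ⟨q, h⟩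
  · rw [h.arcMap_left, (h.shift hP).arcMap_left]
  · rw [h.arcMap_right hH, (h.shift hP).arcMap_right hH]; ring

variable {N : ℕ} {F : ℤ → ℤ}

theorem IsMatching.add_period (hF : IsMatching N F) (p : ℤ) : F (p + 2 * N) = F p + 2 * N := by
  rw [← hF.invol p, hF.invol]

theorem IsMatching.sub_period (hF : IsMatching N F) (p : ℤ) : F (p - 2 * N) = F p - 2 * N := by
  have := hF.add_period (p - 2 * N)
  rw [sub_add_cancel] at this
  omega

theorem IsMatching.lt_add (hF : IsMatching N F) (p : ℤ) : F p < p + 2 * N := by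
  have := hF.lt (F p)
  rwa [hF.invol] at this

theorem IsMatching.injective (hF : IsMatching N F) {p q : ℤ} (h : F p = F q) : p = q := by
  have h1 := hF.invol p
  rw [h, hF.invol] at h1
  omega

/-- A choice of an opening point in every pair of a lifted matching, with all pairs nested. -/
structure IsOrientation (N : ℕ) (F : ℤ → ℤ) (up : ℤ → Prop) : Prop where
  swap : ∀ p, up (F p) ↔ ¬ up p
  nested : ∀ p q, up p → up q → p < q → q < F p → F q < F p

/-- Pairs oriented in a nested way behave like parentheses, and these are determined by the
positions of the opening ones. The induction is on the shorter of the two candidate arcs at p: if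
they differed, a strictly inner arc would contradict the induction hypothesis. -/
theorem IsMatching.eq_arcMap (hF : IsMatching N F) (hH : IsUnitWalk P H)
    (hup : IsOrientation N F fun p => H (p + 1) = H p + 1) : F = arcMap H N := by
  have hdown : ∀ p, ¬ H (p + 1) = H p + 1 → H (p + 1) = H p - 1 := fun p h =>
    (hH.step p).resolve_left h
  have key : ∀ n : ℕ, ∀ p q, IsArc H p q → min (F p) q - p ≤ n → F p = q := by
    intro n
    induction n with
    | zero =>
      intro p q h hn
      have := h.1
      have := hF.lt p
      omega
    | succ n ih =>
      intro p q h hn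
      have hpq := h.1
      have hpF := hF.lt p
      have hp : H (p + 1) = H p + 1 := h.up hH
      rcases lt_trichotomy (F p) q with hlt | heq | hlt
      · exfalso
        have hr : ¬ H (F p + 1) = H (F p) + 1 := fun h' => (hup.swap p).mp h' hp
        obtain ⟨p', hp'⟩ := hH.exists_arc_of_down (hdown _ hr)
        have h1 : p < p' := by
          rcases lt_trichotomy p p' with h' | h' | h'
          · exact h'
          · subst h'; have := h.right_unique hp'; omega
          · have := hp'.nested h h' hpF; omega
        have h2 := hp'.1
        have h3 := hup.nested p p' hp (hp'.up hH) h1 h2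
        have h4 := ih p' (F p) hp' (by omega)
        omega
      · exact heq
      · exfalso
        have hq : ¬ H (q + 1) = H q + 1 := by have := h.down hH; omega
        have h1 : F (F q - 2 * N) = q := by rw [hF.sub_period, hF.invol]; ring
        have h2 : H (F q - 2 * N + 1) = H (F q - 2 * N) + 1 := by
          by_contra h'
          have := (hup.swap (F q - 2 * N)).mpr h'
          rw [h1] at this
          exact hq this
        set p' := F q - 2 * N with hp'
        have h3 : p' < q := by have := hF.lt p'; omega
        have h4 : p < p' := by
          rcases lt_trichotomy p p' with h' | h' | h'
          · exact h'
          · rw [← h'] at h1; omega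
          · have := hup.nested p' p h2 hp h' (by omega); omega
        obtain ⟨q', hq'⟩ := hH.exists_arc_of_up h2
        have h5 := h.nested hq' h4 h3
        have h6 := ih p' q' hq' (by omega)
        omega
  funext p
  rcases hH.exists_arc p with ⟨q, h⟩ | ⟨q, h⟩
  · rw [h.arcMap_left]
    have := h.1
    have := hF.lt p
    exact key (min (F p) q - p).toNat p q h (by omega)
  · rw [h.arcMap_right hH]
    have := h.1
    have := hF.lt q
    rw [← hF.invol q, key (min (F q) p - q).toNat q p h (by omega)]

end Arcs

/-! ### Motzkin walks and their doublings. -/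

/-- Periodic Motzkin walks: steps `1`, `0`, `-1`, period `L`, starting at `0`. -/
structure IsWalk (L : ℕ) (h : ℤ → ℤ) : Prop where
  pos : 0 < L
  zero : h 0 = 0
  step : ∀ t, h (t + 1) = h t + 1 ∨ h (t + 1) = h t ∨ h (t + 1) = h t - 1
  periodic : ∀ t, h (t + L) = h t

/-- The `±1` walk obtained by replacing the steps `1`, `0`, `-1` by the pairs of steps `1, 1`,
`-1, 1` and `-1, -1`. -/
def doubled (h : ℤ → ℤ) (p : ℤ) : ℤ :=
  if p % 2 = 0 then 2 * h (p / 2)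
  else if h (p / 2 + 1) = h (p / 2) + 1 then 2 * h (p / 2) + 1 else 2 * h (p / 2) - 1

theorem doubled_even (h : ℤ → ℤ) (t : ℤ) : doubled h (2 * t) = 2 * h t := by
  rw [doubled, if_pos (by omega), show 2 * t / 2 = t by omega]

theorem doubled_odd (h : ℤ → ℤ) (t : ℤ) :
    doubled h (2 * t + 1) = if h (t + 1) = h t + 1 then 2 * h t + 1 else 2 * h t - 1 := by
  rw [doubled, if_neg (by omega), show (2 * t + 1) / 2 = t by omega]

theorem doubled_up_even (h : ℤ → ℤ) (t : ℤ) :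
    doubled h (2 * t + 1) = doubled h (2 * t) + 1 ↔ h (t + 1) = h t + 1 := by
  rw [doubled_odd, doubled_even]
  split_ifs with h1 <;> simp [h1]
  omega

theorem doubled_two_mul_add_two (h : ℤ → ℤ) (t : ℤ) :
    doubled h (2 * t + 1 + 1) = 2 * h (t + 1) := by
  rw [show 2 * t + 1 + 1 = 2 * (t + 1) by ring, doubled_even]

theorem IsWalk.doubled_up_odd {L : ℕ} {h : ℤ → ℤ} (hh : IsWalk L h) (t : ℤ) :
    doubled h (2 * t + 1 + 1) = doubled h (2 * t + 1) + 1 ↔ h (t + 1) ≠ h t - 1 := by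
  rw [doubled_two_mul_add_two, doubled_odd]
  have := hh.step t
  split_ifs with h1 <;> omega

theorem IsWalk.isUnitWalk {L : ℕ} {h : ℤ → ℤ} (hh : IsWalk L h) :
    IsUnitWalk (2 * L) (doubled h) where
  pos := by have := hh.pos; omega
  step p := by
    obtain ⟨t, rfl | rfl⟩ : ∃ t, p = 2 * t ∨ p = 2 * t + 1 := ⟨p / 2, by omega⟩
    · rw [doubled_odd, doubled_even]
      split_ifs <;> simp
    · rw [doubled_two_mul_add_two, doubled_odd]
      have := hh.step t
      split_ifs with h1 <;> omega
  periodic p := by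
    simp only [doubled]
    rw [show (p + 2 * L) % 2 = p % 2 by omega, show (p + 2 * L) / 2 = p / 2 + L by omega,
      hh.periodic, add_right_comm, hh.periodic]

theorem IsWalk.of_dvd {g N : ℕ} {h : ℤ → ℤ} (hh : IsWalk g h) (hN : 0 < N) (hd : g ∣ N) :
    IsWalk N h where
  pos := hN
  zero := hh.zero
  step := hh.step
  periodic t := by
    obtain ⟨d, rfl⟩ := hd
    induction d with
    | zero => simp
    | succ d ih =>
      rcases Nat.eq_zero_or_pos (g * d) with h0 | h0
      · have := hh.periodic t
        rcases Nat.mul_eq_zero.mp h0 with h1 | h1 <;> simp_all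
      · have := ih h0
        rw [mul_add, mul_one, Nat.cast_add, ← add_assoc, hh.periodic, this]

theorem IsWalk.ext {L : ℕ} {h h' : ℤ → ℤ} (hh : IsWalk L h) (hh' : IsWalk L h')
    (he : ∀ p : ℤ, 0 ≤ p → p < 2 * L → (doubled h (p + 1) = doubled h p + 1 ↔
      doubled h' (p + 1) = doubled h' p + 1)) : h = h' := by
  have hL := hh.pos
  have hall : ∀ p, (doubled h (p + 1) = doubled h p + 1 ↔
      doubled h' (p + 1) = doubled h' p + 1) := by
    intro p
    have h1 := he (p % (2 * L)) (Int.emod_nonneg _ (by omega)) (Int.emod_lt_of_pos _ (by omega))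
    have e : ∀ (f : ℤ → ℤ), (∀ p, f (p + 2 * L) = f p) → f (p % (2 * L)) = f p := by
      intro f hf
      have := (show Function.Periodic f (2 * L : ℤ) from hf).sub_zsmul_eq (p / (2 * L)) (x := p)
      rw [Int.emod_def, ← this, smul_eq_mul, mul_comm]
    rw [e _ hh.isUnitWalk.periodic, e _ hh'.isUnitWalk.periodic,
      e (fun p => doubled h (p + 1)) (fun p => by
        rw [add_right_comm]; exact hh.isUnitWalk.periodic _),
      e (fun p => doubled h' (p + 1)) (fun p => by
        rw [add_right_comm]; exact hh'.isUnitWalk.periodic _)] at h1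
    exact h1
  have hstep : ∀ t, h (t + 1) - h t = h' (t + 1) - h' t := by
    intro t
    have h1 := hall (2 * t)
    have h2 := hall (2 * t + 1)
    rw [doubled_up_even, doubled_up_even] at h1
    rw [hh.doubled_up_odd, hh'.doubled_up_odd] at h2
    have := hh.step t
    have := hh'.step t
    omega
  funext t
  induction t using Int.induction_on with
  | zero => rw [hh.zero, hh'.zero]
  | succ t ih => have := hstep t; omega
  | pred t ih => have := hstep (-t - 1); rw [sub_add_cancel] at this; omega

/-! ### Walks with prescribed periodic steps. -/

theorem exists_potential (c : ℤ → ℤ) : ∃ h : ℤ → ℤ, h 0 = 0 ∧ ∀ t, h (t + 1) = h t + c t := by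
  refine ⟨fun t => match t with
    | Int.ofNat n => ∑ i ∈ Finset.range n, c i
    | Int.negSucc n => -∑ i ∈ Finset.range (n + 1), c (-i - 1), rfl, ?_⟩
  rintro (n | n)
  · exact Finset.sum_range_succ _ _
  · rcases n with _ | n
    · change ∑ i ∈ Finset.range 0, c i = -∑ i ∈ Finset.range 1, c (-i - 1) + c (-1)
      simp
    · change -∑ i ∈ Finset.range (n + 1), c (-i - 1) =
        -∑ i ∈ Finset.range (n + 1 + 1), c (-i - 1) + c (Int.negSucc (n + 1))
      rw [Finset.sum_range_succ _ (n + 1), Int.negSucc_eq]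
      push_cast
      rw [show -((n : ℤ) + 1 + 1) = -(n + 1) - 1 by ring]
      ring

theorem periodic_of_step {L : ℕ} {c h : ℤ → ℤ} (hs : ∀ t, h (t + 1) = h t + c t)
    (hc : ∀ t, c (t + L) = c t) (h0 : h L = h 0) (t : ℤ) : h (t + L) = h t := by
  induction t using Int.induction_on with
  | zero => rw [zero_add, h0]
  | succ t ih => rw [hs, add_right_comm, hs, ih, hc]
  | pred t ih =>
    have h1 := hs (-t - 1)
    have h2 := hs (-t - 1 + L)
    rw [sub_add_cancel] at h1
    rw [hc, add_right_comm, sub_add_cancel] at h2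
    omega

theorem exists_periodic_potential (L : ℕ) (c : ℤ → ℤ) (hc : ∀ t, c (t + L) = c t)
    (h0 : ∑ i ∈ Finset.range L, c i = 0) :
    ∃ h : ℤ → ℤ, h 0 = 0 ∧ (∀ t, h (t + 1) = h t + c t) ∧ ∀ t, h (t + L) = h t := by
  obtain ⟨h, hz, hs⟩ := exists_potential c
  refine ⟨h, hz, hs, periodic_of_step hs hc ?_⟩
  have hsum : ∀ n : ℕ, h n = ∑ i ∈ Finset.range n, c i := by
    intro n
    induction n with
    | zero => simpa using hz
    | succ n ih => rw [Finset.sum_range_succ, ← ih]; exact_mod_cast hs n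
  rw [hsum, h0, hz]

/-! ### From an oriented matching to a walk. -/

section Orientation

variable {N : ℕ} {F : ℤ → ℤ}

theorem sum_range_two_mul (s : ℤ → ℤ) (L : ℕ) :
    ∑ p ∈ Finset.range (2 * L), s p = ∑ t ∈ Finset.range L, (s (2 * t) + s (2 * t + 1)) := by
  induction L with
  | zero => simp
  | succ L ih =>
    rw [Finset.sum_range_succ, ← ih, mul_add, mul_one, Finset.sum_range_succ,
      Finset.sum_range_succ]
    push_cast
    ring

-- Exchanging the two ends of each pair reverses the sign and commutes with translation by 2L, so it
-- is a sign-reversing involution of the residues modulo 2L. This is what makes the walk of an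
-- orientation close up after L steps.
open Classical in
theorem IsMatching.sum_sign_eq_zero (hF : IsMatching N F) {up : ℤ → Prop}
    (hup : IsOrientation N F up) {L : ℕ} (hL : 0 < L) (hFL : ∀ p, F (p + 2 * L) = F p + 2 * L)
    (hupL : ∀ p, up (p + 2 * L) ↔ up p) :
    ∑ p ∈ Finset.range (2 * L), (if up p then (1 : ℤ) else -1) = 0 := by
  have hper : ∀ p, up (p + 2 * N) ↔ up p := fun p => by
    rw [← hF.invol, hup.swap, hup.swap, not_not]
  -- The other end of the pair of p for the given orientation: the next partner of an opening point,
  -- the previous partner of a closing one.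
  set m : ℤ → ℤ := fun p => if up p then F p else F p - 2 * N with hm
  have hmup : ∀ p, up (m p) ↔ ¬ up p := by
    intro p
    simp only [hm]
    split_ifs with h
    · exact hup.swap p
    · rw [← hper, sub_add_cancel, hup.swap]
  have hmm : ∀ p, m (m p) = p := by
    intro p
    by_cases h : up p
    · have h1 : ¬ up (m p) := by rw [hmup, not_not]; exact h
      have e1 : m p = F p := if_pos h
      have e2 : m (m p) = F (m p) - 2 * N := if_neg h1
      rw [e2, e1, hF.invol]; ring
    · have h1 : up (m p) := by rw [hmup]; exact h
      have e1 : m p = F p - 2 * N := if_neg h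
      have e2 : m (m p) = F (m p) := if_pos h1
      rw [e2, e1, hF.sub_period, hF.invol]; ring
  have hmod : ∀ p, up (p % (2 * L)) ↔ up p := by
    intro p
    have := (show Function.Periodic up (2 * L : ℤ) from fun p => propext (hupL p)).sub_zsmul_eq
      (p / (2 * L)) (x := p)
    rw [Int.emod_def, ← this, smul_eq_mul, mul_comm]
  have hmL : ∀ p, m (p % (2 * L)) - p % (2 * L) = m p - p := by
    intro p
    have hper : Function.Periodic (fun p => m p - p) (2 * L : ℤ) := by
      intro p
      simp only [hm, hupL, hFL]
      split_ifs <;> ring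
    have := hper.sub_zsmul_eq (p / (2 * L)) (x := p)
    rw [Int.emod_def, mul_comm]
    simpa using this
  have hL' : (0 : ℤ) < 2 * L := by omega
  have hnn : ∀ x : ℤ, ((x % (2 * L)).toNat : ℤ) = x % (2 * L) := fun x =>
    Int.toNat_of_nonneg (Int.emod_nonneg _ hL'.ne')
  refine Finset.sum_involution (fun a _ => (m a % (2 * L)).toNat) ?_ ?_ ?_ ?_
  · intro a _
    rw [hnn]
    simp only [hmod, hmup]
    by_cases h : up a <;> simp [h]
  · intro a _ _ heq
    have h1 := hmup a
    rw [← hmod, ← hnn, heq] at h1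
    tauto
  · intro a _
    rw [Finset.mem_range]
    have := Int.emod_lt_of_pos (m a) hL'
    have := hnn (m a)
    omega
  · intro a ha
    rw [Finset.mem_range] at ha
    rw [hnn]
    have h1 := hmL (m a)
    rw [hmm] at h1
    have h2 : m (m a % (2 * L)) = a - 2 * L * (m a / (2 * L)) := by
      have := Int.emod_def (m a) (2 * L)
      linarith
    rw [h2, Int.sub_mul_emod_self_left, Int.emod_eq_of_lt (by omega) (by omega)]
    simp

/-- The opening points serve as up steps. Since L may be smaller than N, the lemma covers both the
cut matching and the rotationally symmetric one. -/
theorem IsMatching.exists_walk (hF : IsMatching N F) {up : ℤ → Prop} (hup : IsOrientation N F up)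
    {L : ℕ} (hL : 0 < L) (hFL : ∀ p, F (p + 2 * L) = F p + 2 * L)
    (hupL : ∀ p, up (p + 2 * L) ↔ up p) :
    ∃ h, IsWalk L h ∧ (∀ p, doubled h (p + 1) = doubled h p + 1 ↔ up p) ∧
      F = arcMap (doubled h) N := by
  classical
  have hper : ∀ p, up (p + 2 * N) ↔ up p := fun p => by
    rw [← hF.invol, hup.swap, hup.swap, not_not]
  -- Up followed by down would join 2t to 2t+1, the excluded pair. Hence only the three step pairs
  -- used by `doubled` occur.
  have hpair : ∀ t, up (2 * t) → up (2 * t + 1) := by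
    intro t ht
    by_contra hq
    have h1 : F (F (2 * t + 1) - 2 * N) = 2 * t + 1 := by rw [hF.sub_period, hF.invol]; ring
    have h2 : up (F (2 * t + 1) - 2 * N) := by rwa [← hper, sub_add_cancel, hup.swap]
    set p := F (2 * t + 1) - 2 * N
    have h3 := hF.lt p
    have h4 := hF.lt (2 * t)
    rcases eq_or_ne p (2 * t) with h5 | h5
    · rw [h5] at h1; exact hF.ne t h1
    · have := hup.nested p (2 * t) h2 ht (by omega) (by omega)
      omega
  have hsum := hF.sum_sign_eq_zero hup hL hFL hupL
  set c : ℤ → ℤ := fun t => if up (2 * t) then 1 else if up (2 * t + 1) then 0 else -1 with hc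
  have hcs : ∀ t, (if up (2 * t) then (1 : ℤ) else -1) + (if up (2 * t + 1) then 1 else -1) =
      2 * c t := by
    intro t
    have := hpair t
    simp only [hc]
    split_ifs <;> simp_all
  obtain ⟨h, hz, hs, hp⟩ := exists_periodic_potential L c (fun t => by
    simp only [hc, mul_add, hupL, add_right_comm _ (2 * (L : ℤ)) 1]) (by
      rw [sum_range_two_mul (fun p => if up p then (1 : ℤ) else -1) L] at hsum
      simp only [hcs, ← Finset.mul_sum] at hsum
      omega)
  have hw : IsWalk L h := ⟨hL, hz, fun t => by
    rw [hs]; simp only [hc]; split_ifs <;> omega, hp⟩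
  have hupw : ∀ p, doubled h (p + 1) = doubled h p + 1 ↔ up p := by
    intro p
    obtain ⟨t, rfl | rfl⟩ : ∃ t, p = 2 * t ∨ p = 2 * t + 1 := ⟨p / 2, by omega⟩
    · rw [doubled_up_even, hs]
      simp only [hc]
      split_ifs with h1 h2 <;> simp [h1]
    · rw [hw.doubled_up_odd, hs]
      have := hpair t
      simp only [hc]
      split_ifs with h1 h2
      · simp only [this h1, iff_true]; omega
      · simp only [h2, iff_true]; omega
      · simp only [h2, iff_false]; omega
  refine ⟨h, hw, hupw, hF.eq_arcMap hw.isUnitWalk ?_⟩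
  simpa only [hupw] using hup

end Orientation

/-! ### Cutting the circle: all matchings and nonnegative walks. -/

section Dyck

variable {N : ℕ} {F h : ℤ → ℤ}

theorem IsWalk.doubled_mul (hh : IsWalk N h) (w : ℤ) : doubled h (2 * N * w) = 0 := by
  have h1 := (show Function.Periodic (doubled h) (2 * N : ℤ) from hh.isUnitWalk.periodic).zsmul_eq w
  rw [smul_eq_mul, mul_comm] at h1
  rw [h1]
  have := doubled_even h 0
  rw [hh.zero] at this
  simpa using this

/-- An up step at 2i forces one at 2i+1, so no shortest arc occurs there. An arc of length 2N-1
starting at an odd point would have a multiple of 2N strictly inside, where the height is 0, and so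
would start below 0. -/
theorem IsWalk.arcMap_isMatching_of_nonneg (hh : IsWalk N h) (h0 : ∀ p, 0 ≤ doubled h p) :
    IsMatching N (arcMap (doubled h) N) := by
  refine arcMap_isMatching hh.isUnitWalk (fun i ha => ?_) fun i ha => ?_
  · have h1 := ha.up hh.isUnitWalk
    have h2 := ha.down hh.isUnitWalk
    rw [doubled_up_even] at h1
    rw [doubled_two_mul_add_two, doubled_odd, if_pos h1] at h2
    omega
  · have hN := hh.pos
    have h1 := Int.emod_nonneg (2 * i) (show (2 * N : ℤ) ≠ 0 by omega)
    have h2 := Int.emod_lt_of_pos (2 * i) (show (0 : ℤ) < 2 * N by omega)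
    have h3 := Int.emod_def (2 * i) (2 * N)
    have h4 := ha.2.2 (2 * N * (2 * i / (2 * N))) (by
      have : 2 * i + 1 - 2 * N ≠ 2 * N * (2 * i / (2 * N)) := by
        intro h; rw [mul_assoc] at h; omega
      omega) (by omega)
    rw [hh.doubled_mul] at h4
    have := h0 (2 * i + 1 - 2 * N)
    omega

theorem IsWalk.doubled_up_iff_of_nonneg (hh : IsWalk N h) (h0 : ∀ p, 0 ≤ doubled h p) {p : ℤ}
    (hp0 : 0 ≤ p) (hpN : p < 2 * N) :
    doubled h (p + 1) = doubled h p + 1 ↔ arcMap (doubled h) N p < 2 * N := by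
  have hz := hh.doubled_mul 0
  have hN := hh.doubled_mul 1
  rw [mul_zero] at hz
  rw [mul_one] at hN
  rcases hh.isUnitWalk.exists_arc p with ⟨q, ha⟩ | ⟨q, ha⟩
  · rw [ha.arcMap_left]
    refine iff_of_true (ha.up hh.isUnitWalk) ?_
    by_contra hq
    have := ha.2.2 (2 * N) hpN (by omega)
    have := h0 p
    omega
  · rw [ha.arcMap_right hh.isUnitWalk]
    have h1 := ha.down hh.isUnitWalk
    refine iff_of_false (by omega) ?_
    intro hq
    have := ha.2.2 0 (by omega) hp0
    have := h0 q
    omega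

/-- The orientation cuts the circle at the multiples of 2N: a point opens its pair if its next
partner lies in the same window. Noncrossing makes the pairs in a window nested. -/
theorem IsMatching.exists_nonneg_walk (hF : IsMatching N F) (hN : 0 < N) :
    ∃ h, IsWalk N h ∧ (∀ p, 0 ≤ doubled h p) ∧ F = arcMap (doubled h) N := by
  have hN2 : (0 : ℤ) < 2 * N := by omega
  have hadd : ∀ p : ℤ, (p + 2 * N) / (2 * N) = p / (2 * N) + 1 := fun p => by
    rw [Int.add_ediv_of_dvd_right (dvd_refl _), Int.ediv_self hN2.ne']
  have hmono : ∀ {p q : ℤ}, p ≤ q → p / (2 * N) ≤ q / (2 * N) := fun h =>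
    Int.ediv_le_ediv hN2 h
  have hup : IsOrientation N F fun p => F p / (2 * N) = p / (2 * N) := by
    constructor
    · intro p
      rw [hF.invol, hadd]
      have h1 := hmono (hF.lt p).le
      have h2 := hmono (hF.lt_add p).le
      rw [hadd] at h2
      omega
    · intro p q hp hq hpq hqF
      rcases hF.noncrossing p q hpq hqF with h | h
      · rcases eq_or_lt_of_le h with h | h
        · have := hF.injective h; omega
        · exact h
      · have h1 := hmono h
        rw [hadd] at h1
        have h2 := hmono hqF.le
        omega
  obtain ⟨h, hh, hhup, hFh⟩ := hF.exists_walk hup hN hF.add_period (fun p => by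
    rw [hF.add_period, hadd, hadd]; omega)
  refine ⟨h, hh, ?_, hFh⟩
  -- A first step below 0 would close an arc opened in the same window, hence at an earlier
  -- nonnegative height, to which the walk returns.
  have hnat : ∀ n : ℕ, n ≤ 2 * N → 0 ≤ doubled h n := by
    intro n
    induction n using Nat.strong_induction_on with
    | _ n ih =>
      intro hn
      rcases n with _ | p
      · exact (by simpa using (hh.doubled_mul 0).ge)
      · have h1 := ih p (by omega) (by omega)
        have h2 := hh.isUnitWalk.step p
        by_contra hneg
        push_cast at hneg
        obtain ⟨r, hr⟩ := hh.isUnitWalk.exists_arc_of_down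
          (show doubled h (p + 1) = doubled h p - 1 by omega)
        have h3 := (hhup r).mp (hr.up hh.isUnitWalk)
        rw [hFh, hr.arcMap_left, Int.ediv_eq_zero_of_lt (by omega) (by omega)] at h3
        have h4 : 0 ≤ r := by
          by_contra hr0
          have := Int.ediv_neg_of_neg_of_pos (show r < 0 by omega) hN2
          omega
        have h5 := hr.1
        have h6 := hr.2.1
        have h7 := ih r.toNat (by omega) (by omega)
        rw [Int.toNat_of_nonneg h4] at h7
        omega
  intro p
  have h1 := (show Function.Periodic (doubled h) (2 * N : ℤ) from
    hh.isUnitWalk.periodic).sub_zsmul_eq (p / (2 * N)) (x := p)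
  have h2 := Int.emod_nonneg p hN2.ne'
  have h3 := Int.emod_lt_of_pos p hN2
  rw [smul_eq_mul, mul_comm, ← Int.emod_def] at h1
  have h4 := hnat (p % (2 * N)).toNat (by omega)
  rwa [Int.toNat_of_nonneg h2, h1] at h4

theorem IsMatching.odd (hF : IsMatching N F) (hN : 0 < N) (p : ℤ) : (F p - p) % 2 = 1 := by
  obtain ⟨h, hh, -, rfl⟩ := hF.exists_nonneg_walk hN
  rcases hh.isUnitWalk.exists_arc p with ⟨q, ha⟩ | ⟨q, ha⟩
  · rw [ha.arcMap_left]; exact ha.odd hh.isUnitWalk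
  · rw [ha.arcMap_right hh.isUnitWalk]
    have := ha.odd hh.isUnitWalk
    omega

end Dyck

/-! ### Rotationally symmetric matchings and shorter walks. -/

section Rotation

variable {N g : ℕ} {F h : ℤ → ℤ}

/-- Arcs of a walk of period 2g are shorter than 2g ≤ N, so none goes around the circle; no
nonnegativity is needed. -/
theorem IsWalk.arcMap_isMatching_of_dvd (hh : IsWalk g h) (hgN : 2 * g ≤ N) (hd : g ∣ N) :
    IsMatching N (arcMap (doubled h) N) := by
  have hN : 0 < N := by have := hh.pos; omega
  refine arcMap_isMatching (hh.of_dvd hN hd).isUnitWalk (fun i ha => ?_) fun i ha => ?_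
  · have h1 := ha.up hh.isUnitWalk
    have h2 := ha.down hh.isUnitWalk
    rw [doubled_up_even] at h1
    rw [doubled_two_mul_add_two, doubled_odd, if_pos h1] at h2
    omega
  · have := ha.lt_add hh.isUnitWalk.periodic hh.isUnitWalk.pos
    omega

theorem IsWalk.arcMap_add (hh : IsWalk g h) (p : ℤ) :
    arcMap (doubled h) N (p + 2 * g) = arcMap (doubled h) N p + 2 * g :=
  _root_.arcMap_add hh.isUnitWalk hh.isUnitWalk.periodic N p

theorem IsWalk.doubled_up_iff (hh : IsWalk g h) (hgN : 2 * g ≤ N) (p : ℤ) :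
    doubled h (p + 1) = doubled h p + 1 ↔ arcMap (doubled h) N p < p + 2 * g := by
  rcases hh.isUnitWalk.exists_arc p with ⟨q, ha⟩ | ⟨q, ha⟩
  · rw [ha.arcMap_left]
    exact iff_of_true (ha.up hh.isUnitWalk) (ha.lt_add hh.isUnitWalk.periodic hh.isUnitWalk.pos)
  · rw [ha.arcMap_right hh.isUnitWalk]
    have h1 := ha.down hh.isUnitWalk
    have := ha.lt_add hh.isUnitWalk.periodic hh.isUnitWalk.pos
    exact iff_of_false (by omega) (by omega)

/-- A point opens its pair if the next partner is less than 2g away. Since 2g ≤ N this cannot hold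
at both ends of a pair. If it held at neither, the pair would cross its own translate by 2g or form
a diameter-like pair at even distance, which parity excludes. -/
theorem IsMatching.exists_periodic_walk (hF : IsMatching N F) (hg : 0 < g) (hgN : 2 * g ≤ N)
    (hFg : ∀ p, F (p + 2 * g) = F p + 2 * g) :
    ∃ h, IsWalk g h ∧ F = arcMap (doubled h) N := by
  have hodd := hF.odd (by omega)
  have hup : IsOrientation N F fun p => F p < p + 2 * g := by
    constructor
    · intro p
      rw [hF.invol]
      constructor
      · intro h1 h2; omega
      · intro h1
        by_contra h2
        have h3 := hodd p
        rcases hF.noncrossing p (p + 2 * g) (by omega) (by omega) with h4 | h4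
        · rw [hFg] at h4; omega
        · rw [hFg] at h4; omega
    · intro p q hp hq hpq hqF
      rcases hF.noncrossing p q hpq hqF with h | h
      · rcases eq_or_lt_of_le h with h | h
        · have := hF.injective h; omega
        · exact h
      · omega
  obtain ⟨h, hh, -, hFh⟩ := hF.exists_walk hup hg hFg (fun p => by rw [hFg]; omega)
  exact ⟨h, hh, hFh⟩

end Rotation

/-! ### The number of blocks, and its independence of the cut. -/

section BlockCount

variable {N g : ℕ} {F h : ℤ → ℤ}

/-- The number of blocks of the noncrossing partition encoded by the matching `F`, counted by
their first elements after the cut at `c`. -/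
noncomputable def blockCount (N : ℕ) (F : ℤ → ℤ) (c : ℤ) : ℕ :=
  ((Finset.Ico c (c + N)).filter fun x => F (2 * x) < 2 * (c + N)).card

/-- Moving the cut past c only affects the block containing c: c stops being its first element and
the next element takes over. -/
theorem IsMatching.blockCount_add_one (hF : IsMatching N F) (hN : 0 < N) (c : ℤ) :
    blockCount N F (c + 1) = blockCount N F c := by
  have hodd := hF.odd hN
  -- Consecutive elements of a block are joined from odd to even point, so y is the successor of c
  -- in its block.
  obtain ⟨y, hy⟩ : ∃ y, F (2 * c + 1) = 2 * y :=
    ⟨F (2 * c + 1) / 2, by have := hodd (2 * c + 1); omega⟩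
  have hFy : F (2 * y) = 2 * c + 1 + 2 * N := by rw [← hy, hF.invol]
  have hset : ((Finset.Ico (c + 1) (c + 1 + N)).filter fun x => F (2 * x) < 2 * (c + 1 + N)) =
      insert y (((Finset.Ico c (c + N)).filter fun x => F (2 * x) < 2 * (c + N)).erase c) := by
    ext x
    simp only [Finset.mem_filter, Finset.mem_Ico, Finset.mem_insert, Finset.mem_erase]
    have h1 := hodd (2 * x)
    have h2 := hF.lt (2 * x)
    constructor
    · rintro ⟨⟨h3, h4⟩, h5⟩
      rcases eq_or_ne x y with h6 | h6
      · exact Or.inl h6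
      · right
        have h7 : F (2 * x) ≠ 2 * c + 1 + 2 * N := by
          rw [← hFy]
          intro h
          have := hF.injective h
          omega
        omega
    · rintro (rfl | ⟨h3, ⟨h4, h5⟩, h6⟩)
      · have := hF.lt (2 * c + 1)
        have := hF.lt_add (2 * c + 1)
        omega
      · omega
  rw [blockCount, hset, Finset.card_insert_of_notMem, Finset.card_erase_add_one]
  · rfl
  · have := hF.lt_add (2 * c)
    simp only [Finset.mem_filter, Finset.mem_Ico]
    omega
  · simp only [Finset.mem_filter, Finset.mem_Ico, Finset.mem_erase]
    omega

theorem IsMatching.blockCount_eq (hF : IsMatching N F) (hN : 0 < N) (c : ℤ) :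
    blockCount N F c = blockCount N F 0 := by
  induction c using Int.induction_on with
  | zero => rfl
  | succ c ih => rw [hF.blockCount_add_one hN, ih]
  | pred c ih => rw [← ih, ← hF.blockCount_add_one hN, sub_add_cancel]

/-- The number of up steps in a period. -/
def upCount (L : ℕ) (h : ℤ → ℤ) : ℕ :=
  ((Finset.range L).filter fun i : ℕ => h (i + 1) = h i + 1).card

theorem card_filter_Ico_of_periodic {p : ℤ → Prop} [DecidablePred p] (hp : ∀ t, p (t + g) ↔ p t)
    (c : ℤ) (d : ℕ) :
    ((Finset.Ico c (c + (d * g : ℕ))).filter p).card =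
      d * ((Finset.range g).filter fun i : ℕ => p i).card := by
  have hbase : ∀ c : ℤ, ((Finset.Ico (c + 1) (c + 1 + g)).filter p).card =
      ((Finset.Ico c (c + g)).filter p).card := by
    intro c
    rcases Nat.eq_zero_or_pos g with rfl | hg
    · simp
    have e1 : Finset.Ico c (c + g) = insert c (Finset.Ico (c + 1) (c + g)) := by
      ext x; simp only [Finset.mem_Ico, Finset.mem_insert]; omega
    have e2 : Finset.Ico (c + 1) (c + 1 + g) = insert (c + g) (Finset.Ico (c + 1) (c + g)) := by
      ext x; simp only [Finset.mem_Ico, Finset.mem_insert]; omega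
    rw [e1, e2, Finset.filter_insert, Finset.filter_insert]
    simp only [hp]
    split_ifs
    · rw [Finset.card_insert_of_notMem (by simp), Finset.card_insert_of_notMem (by simp)]
    · rfl
  have hshift : ∀ c : ℤ, ((Finset.Ico c (c + g)).filter p).card =
      ((Finset.Ico (0 : ℤ) (0 + g)).filter p).card := by
    intro c
    induction c using Int.induction_on with
    | zero => rfl
    | succ c ih => rw [hbase, ih]
    | pred c ih => rw [← ih, ← hbase, sub_add_cancel]
  have h0 : ((Finset.Ico (0 : ℤ) (0 + g)).filter p).card =
      ((Finset.range g).filter fun i : ℕ => p i).card := by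
    symm
    refine Finset.card_bij (fun i _ => (i : ℤ)) ?_ ?_ ?_
    · intro i hi; simp at hi ⊢; exact hi
    · intro i _ j _ hij; exact_mod_cast hij
    · intro x hx
      simp only [Finset.mem_filter, Finset.mem_Ico] at hx
      refine ⟨x.toNat, ?_, by omega⟩
      simp only [Finset.mem_filter, Finset.mem_range]
      rw [Int.toNat_of_nonneg hx.1.1]
      exact ⟨by omega, hx.2⟩
  induction d with
  | zero => simp
  | succ d ih =>
    have e : Finset.Ico c (c + ((d + 1) * g : ℕ)) = Finset.Ico c (c + (d * g : ℕ)) ∪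
        Finset.Ico (c + (d * g : ℕ)) (c + (d * g : ℕ) + g) := by
      rw [Finset.Ico_union_Ico_eq_Ico (by omega) (by omega)]
      congr 1
      push_cast; ring
    rw [e, Finset.filter_union, Finset.card_union_of_disjoint, ih, hshift, h0]
    · ring
    · exact Finset.disjoint_filter_filter (Finset.Ico_disjoint_Ico_consecutive _ _ _)

/-- A flat step at the minimal height. -/
def HasFlatAtMin (h : ℤ → ℤ) : Prop := ∃ t, h (t + 1) = h t ∧ ∀ s, h t ≤ h s

theorem IsWalk.exists_min (hh : IsWalk g h) : ∃ t, ∀ s, h t ≤ h s := by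
  obtain ⟨t, -, ht⟩ := Finset.exists_min_image (Finset.range g) (fun i : ℕ => h i)
    ⟨0, Finset.mem_range.mpr hh.pos⟩
  refine ⟨t, fun s => ?_⟩
  have hg : (0 : ℤ) < g := by have := hh.pos; omega
  have h1 := (show Function.Periodic h (g : ℤ) from hh.periodic).sub_zsmul_eq (s / g) (x := s)
  have h2 := Int.emod_nonneg s hg.ne'
  have h3 := Int.emod_lt_of_pos s hg
  rw [smul_eq_mul, mul_comm, ← Int.emod_def] at h1
  have h4 := ht (s % g).toNat (Finset.mem_range.mpr (by omega))
  rwa [Int.toNat_of_nonneg h2, h1] at h4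

theorem IsWalk.up_periodic (hh : IsWalk g h) (t : ℤ) :
    h (t + g + 1) = h (t + g) + 1 ↔ h (t + 1) = h t + 1 := by
  rw [add_right_comm, hh.periodic, hh.periodic]

/-- With the cut at a minimum of h, every arc opened by an up step of h closes before the next cut,
giving d times the up steps of one period. An even point which is a down step can be counted only if
its arc covers the cut, and this forces a flat step at the minimal height. -/
theorem IsWalk.blockCount_arcMap {d : ℕ} (hh : IsWalk g h) (hd : 2 ≤ d) [Decidable (HasFlatAtMin h)] :
    blockCount (d * g) (arcMap (doubled h) (d * g)) 0 =
      d * upCount g h + if HasFlatAtMin h then 1 else 0 := by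
  have hg := hh.pos
  have hU := hh.isUnitWalk
  have hF := hh.arcMap_isMatching_of_dvd (N := d * g) (Nat.mul_le_mul_right g hd) (dvd_mul_left g d)
  have hN : 0 < d * g := by positivity
  have hper := (hh.of_dvd hN (dvd_mul_left g d)).periodic
  set N := d * g with hNdef
  have hcount := fun c => card_filter_Ico_of_periodic (p := fun t => h (t + 1) = h t + 1)
    hh.up_periodic c d
  have hdown : ∀ x, ¬ h (x + 1) = h x + 1 →
      doubled h (2 * x + 1) = 2 * h x - 1 := fun x hx => by rw [doubled_odd, if_neg hx]
  have hupr : ∀ c x, (∀ s, h c ≤ h s) → x < c + N → h (x + 1) = h x + 1 →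
      arcMap (doubled h) N (2 * x) < 2 * (c + N) := by
    intro c x hc hx hux
    obtain ⟨q, ha⟩ := hU.exists_arc_of_up ((doubled_up_even h x).mpr hux)
    rw [ha.arcMap_left]
    by_contra hq
    have h1 := ha.2.2 (2 * (c + N)) (by omega) (by omega)
    rw [doubled_even, doubled_even, hper] at h1
    have := hc x
    omega
  split_ifs with hflat
  · obtain ⟨c, hcf, hc⟩ := hflat
    -- The cut is placed just before the flat step c itself. Then c is the one additional first
    -- element: after the half step down at c, no later arc ending at a down step can reach back
    -- over the cut.
    rw [← hF.blockCount_eq hN c, blockCount, ← upCount] at *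
    have hset : ((Finset.Ico c (c + N)).filter fun x =>
        arcMap (doubled h) N (2 * x) < 2 * (c + N)) =
        insert c ((Finset.Ico c (c + N)).filter fun x => h (x + 1) = h x + 1) := by
      ext x
      simp only [Finset.mem_filter, Finset.mem_Ico, Finset.mem_insert]
      constructor
      · rintro ⟨⟨h1, h2⟩, h3⟩
        rcases eq_or_lt_of_le h1 with h4 | h4
        · exact Or.inl h4.symm
        refine Or.inr ⟨⟨h1, h2⟩, ?_⟩
        by_contra hx
        obtain ⟨r, ha⟩ := hU.exists_arc_of_down (q := 2 * x)
          ((hU.step _).resolve_left (by rwa [doubled_up_even]))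
        rw [ha.arcMap_right hU] at h3
        have h5 := ha.2.2 (2 * c + 1) (by omega) (by omega)
        rw [← ha.2.1, hdown x hx, hdown c (by omega)] at h5
        have := hc x
        omega
      · rintro (rfl | ⟨h1, h2⟩)
        · refine ⟨⟨le_rfl, by omega⟩, ?_⟩
          obtain ⟨r, ha⟩ := hU.exists_arc_of_down (q := 2 * x)
            ((hU.step _).resolve_left (by rw [doubled_up_even]; omega))
          rw [ha.arcMap_right hU]
          have := ha.1
          omega
        · exact ⟨h1, hupr c x hc h1.2 h2⟩
    rw [hset, Finset.card_insert_of_notMem, hcount, upCount]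
    simp only [Finset.mem_filter, not_and]
    omega
  · obtain ⟨c, hc⟩ := hh.exists_min
    rw [← hF.blockCount_eq hN c, blockCount, add_zero]
    rw [upCount, ← hcount c]
    congr 1
    refine Finset.filter_congr fun x hx => ?_
    rw [Finset.mem_Ico] at hx
    constructor
    · intro h3
      by_contra hux
      obtain ⟨r, ha⟩ := hU.exists_arc_of_down (q := 2 * x)
        ((hU.step _).resolve_left (by rwa [doubled_up_even]))
      rw [ha.arcMap_right hU] at h3
      have h5 := ha.2.2 (2 * c) (by omega) (by omega)
      rw [← ha.2.1, hdown x hux, doubled_even] at h5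
      have h6 := hc x
      have h7 : h x = h c := by omega
      rcases hh.step x with h8 | h8 | h8
      · exact hux h8
      · exact hflat ⟨x, h8, fun s => h7 ▸ hc s⟩
      · have := hc (x + 1)
        omega
    · exact hupr c x hc hx.2

theorem IsWalk.blockCount_arcMap_of_nonneg (hh : IsWalk N h) (h0 : ∀ p, 0 ≤ doubled h p) :
    blockCount N (arcMap (doubled h) N) 0 = upCount N h := by
  have hcount := card_filter_Ico_of_periodic (p := fun t => h (t + 1) = h t + 1)
    hh.up_periodic 0 1
  rw [one_mul, one_mul] at hcount
  rw [upCount, ← hcount, blockCount]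
  congr 1
  refine Finset.filter_congr fun x hx => ?_
  rw [Finset.mem_Ico] at hx
  rw [← doubled_up_even, hh.doubled_up_iff_of_nonneg h0 (by omega) (by omega), zero_add]

end BlockCount

/-! ### Words of Motzkin walks. -/

/-- The word of the steps `s, …, s + n - 1` of a Motzkin walk. -/
noncomputable def stepWord (h : ℤ → ℤ) (s : ℤ) (n : ℕ) : List SignType :=
  (List.range n).map fun i : ℕ => SignType.sign (h (s + i + 1) - h (s + i))

theorem stepWord_succ (h : ℤ → ℤ) (s : ℤ) (n : ℕ) :
    stepWord h s (n + 1) = SignType.sign (h (s + 1) - h s) :: stepWord h (s + 1) n := by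
  simp only [stepWord, List.range_succ_eq_map, List.map_cons, List.map_map, Nat.cast_zero, add_zero]
  congr 1
  refine List.map_congr_left fun i _ => ?_
  simp only [Function.comp, Nat.cast_succ]
  rw [show s + ((i : ℤ) + 1) = s + 1 + i by ring]

theorem stepWord_length (h : ℤ → ℤ) (s : ℤ) (n : ℕ) : (stepWord h s n).length = n := by
  simp [stepWord]

section StepWord

variable {h : ℤ → ℤ}

theorem sign_step_cases (hs : ∀ t, h (t + 1) = h t + 1 ∨ h (t + 1) = h t ∨ h (t + 1) = h t - 1)
    (t : ℤ) :
    (h (t + 1) = h t + 1 ∧ SignType.sign (h (t + 1) - h t) = .pos) ∨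
    (h (t + 1) = h t ∧ SignType.sign (h (t + 1) - h t) = .zero) ∨
    (h (t + 1) = h t - 1 ∧ SignType.sign (h (t + 1) - h t) = .neg) := by
  rcases hs t with h1 | h1 | h1
  · exact Or.inl ⟨h1, by rw [h1]; simp⟩
  · exact Or.inr (Or.inl ⟨h1, by rw [h1]; simp⟩)
  · exact Or.inr (Or.inr ⟨h1, by rw [h1]; simp⟩)

theorem pathEnd_stepWord
    (hs : ∀ t, h (t + 1) = h t + 1 ∨ h (t + 1) = h t ∨ h (t + 1) = h t - 1) (s : ℤ) (n : ℕ) :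
    pathEnd (stepWord h s n) = h (s + n) - h s := by
  induction n generalizing s with
  | zero => simp [stepWord, pathEnd]
  | succ n ih =>
    have e : s + ((n + 1 : ℕ) : ℤ) = s + 1 + n := by push_cast; ring
    rw [stepWord_succ, e]
    rcases sign_step_cases hs s with ⟨h1, h2⟩ | ⟨h1, h2⟩ | ⟨h1, h2⟩ <;> rw [h2]
    · rw [pathEnd_cons_pos, ih]; omega
    · rw [pathEnd_cons_zero, ih]; omega
    · rw [pathEnd_cons_neg, ih]; omega

theorem pathDepth_stepWord
    (hs : ∀ t, h (t + 1) = h t + 1 ∨ h (t + 1) = h t ∨ h (t + 1) = h t - 1) (s : ℤ) (n : ℕ) :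
    (∀ t, s ≤ t → t ≤ s + n → h s - pathDepth (stepWord h s n) ≤ h t) ∧
    ∃ t, s ≤ t ∧ t ≤ s + n ∧ h t = h s - pathDepth (stepWord h s n) := by
  induction n generalizing s with
  | zero =>
    refine ⟨fun t h1 h2 => ?_, s, le_rfl, by omega, by simp [stepWord, pathDepth]⟩
    rw [show t = s by push_cast at h2; omega]
    simp [stepWord, pathDepth]
  | succ n ih =>
    obtain ⟨ih1, t, ht1, ht2, ht3⟩ := ih (s + 1)
    have hle := ih1 (s + 1) le_rfl (by omega)
    rw [stepWord_succ]
    push_cast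
    constructor
    · intro t h1 h2
      have h3 : s + 1 ≤ t → _ := fun h => ih1 t h (by omega)
      rcases eq_or_lt_of_le h1 with h4 | h4
      · subst h4; omega
      · have h5 := h3 h4
        rcases sign_step_cases hs s with ⟨h6, h7⟩ | ⟨h6, h7⟩ | ⟨h6, h7⟩ <;> rw [h7, pathDepth] <;>
          push_cast <;> omega
    · by_cases h0 : h (s + 1) = h s + 1 ∧ pathDepth (stepWord h (s + 1) n) = 0
      · refine ⟨s, le_rfl, by omega, ?_⟩
        rcases sign_step_cases hs s with ⟨h6, h7⟩ | ⟨h6, h7⟩ | ⟨h6, h7⟩ <;> rw [h7, pathDepth] <;>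
          omega
      · refine ⟨t, by omega, by omega, ?_⟩
        rcases sign_step_cases hs s with ⟨h6, h7⟩ | ⟨h6, h7⟩ | ⟨h6, h7⟩ <;> rw [h7, pathDepth] <;>
          push_cast <;> omega

theorem flatAtMin_stepWord
    (hs : ∀ t, h (t + 1) = h t + 1 ∨ h (t + 1) = h t ∨ h (t + 1) = h t - 1) (s : ℤ) (n : ℕ) :
    FlatAtMin (stepWord h s n) ↔ ∃ t, s ≤ t ∧ t < s + n ∧ h (t + 1) = h t ∧
      h t = h s - pathDepth (stepWord h s n) := by
  induction n generalizing s with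
  | zero =>
    simp only [stepWord, List.range_zero, List.map_nil, FlatAtMin, false_iff]
    rintro ⟨t, h1, h2, -⟩
    push_cast at h2; omega
  | succ n ih =>
    have ih := ih (s + 1)
    have hd := (pathDepth_stepWord hs (s + 1) n).1
    rw [stepWord_succ]
    rcases sign_step_cases hs s with ⟨h6, h7⟩ | ⟨h6, h7⟩ | ⟨h6, h7⟩ <;>
      rw [h7, FlatAtMin, pathDepth, ih] <;> push_cast
    · constructor
      · rintro ⟨h1, t, h2, h3, h4, h5⟩
        exact ⟨t, by omega, by omega, h4, by omega⟩
      · rintro ⟨t, h2, h3, h4, h5⟩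
        have h8 : t ≠ s := by rintro rfl; omega
        have h9 := hd t (by omega) (by omega)
        exact ⟨by omega, t, by omega, by omega, h4, by omega⟩
    · constructor
      · rintro (h1 | ⟨t, h2, h3, h4, h5⟩)
        · exact ⟨s, le_rfl, by omega, h6, by omega⟩
        · exact ⟨t, by omega, by omega, h4, by omega⟩
      · rintro ⟨t, h2, h3, h4, h5⟩
        rcases eq_or_lt_of_le h2 with rfl | h8
        · left; omega
        · exact Or.inr ⟨t, by omega, by omega, h4, by omega⟩
    · constructor
      · rintro ⟨t, h2, h3, h4, h5⟩
        exact ⟨t, by omega, by omega, h4, by omega⟩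
      · rintro ⟨t, h2, h3, h4, h5⟩
        have h8 : t ≠ s := by rintro rfl; omega
        exact ⟨t, by omega, by omega, h4, by omega⟩

theorem count_pos_stepWord (L : ℕ)
    (hs : ∀ t, h (t + 1) = h t + 1 ∨ h (t + 1) = h t ∨ h (t + 1) = h t - 1) :
    (stepWord h 0 L).count .pos = upCount L h := by
  induction L with
  | zero => simp [stepWord, upCount]
  | succ L ih =>
    have e : stepWord h 0 (L + 1) = stepWord h 0 L ++ [SignType.sign (h (L + 1) - h L)] := by
      simp [stepWord, List.range_succ]
    have e2 : upCount (L + 1) h = upCount L h + if h (L + 1) = h L + 1 then 1 else 0 := by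
      rw [upCount, Finset.range_add_one, Finset.filter_insert]
      split_ifs with h1
      · rw [Finset.card_insert_of_notMem (by simp)]; rfl
      · rfl
    rw [e, List.count_append, ih, e2]
    rcases sign_step_cases hs L with ⟨h6, h7⟩ | ⟨h6, h7⟩ | ⟨h6, h7⟩ <;> rw [h7]
    · rw [if_pos h6]; simp
    · rw [if_neg (by omega)]; simp
    · rw [if_neg (by omega)]; simp

end StepWord

theorem IsWalk.pathEnd_stepWord {L : ℕ} {h : ℤ → ℤ} (hh : IsWalk L h) :
    pathEnd (stepWord h 0 L) = 0 := by
  rw [_root_.pathEnd_stepWord hh.step, zero_add, sub_eq_zero]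
  simpa using hh.periodic 0

theorem IsWalk.stepWord_min {L : ℕ} {h : ℤ → ℤ} (hh : IsWalk L h) (t : ℤ) :
    -(pathDepth (stepWord h 0 L) : ℤ) ≤ h t := by
  have hL : (0 : ℤ) < L := by have := hh.pos; omega
  have h1 := (show Function.Periodic h (L : ℤ) from hh.periodic).sub_zsmul_eq (t / L) (x := t)
  have h2 := Int.emod_nonneg t hL.ne'
  have h3 := Int.emod_lt_of_pos t hL
  rw [smul_eq_mul, mul_comm, ← Int.emod_def] at h1
  have h4 := (pathDepth_stepWord hh.step 0 L).1 (t % L) h2 (by omega)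
  rw [hh.zero] at h4
  omega

theorem IsWalk.flatAtMin_iff {L : ℕ} {h : ℤ → ℤ} (hh : IsWalk L h) :
    FlatAtMin (stepWord h 0 L) ↔ HasFlatAtMin h := by
  rw [flatAtMin_stepWord hh.step, hh.zero, zero_sub]
  constructor
  · rintro ⟨t, -, -, h1, h2⟩
    exact ⟨t, h1, fun s => h2 ▸ hh.stepWord_min s⟩
  · rintro ⟨t, h1, h2⟩
    obtain ⟨s, -, -, hs⟩ := (pathDepth_stepWord hh.step 0 L).2
    rw [hh.zero, zero_sub] at hs
    have hL : (0 : ℤ) < L := by have := hh.pos; omega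
    have h3 : ∀ x, h (x - L * (t / L)) = h x := fun x => by
      have := (show Function.Periodic h (L : ℤ) from hh.periodic).sub_zsmul_eq (t / L) (x := x)
      rwa [smul_eq_mul, mul_comm] at this
    refine ⟨t % L, Int.emod_nonneg t hL.ne', by have := Int.emod_lt_of_pos t hL; omega, ?_, ?_⟩
    · rw [Int.emod_def, h3, ← h1, ← h3 (t + 1)]
      congr 1; ring
    · rw [Int.emod_def, h3]
      have := h2 s
      have := hh.stepWord_min t
      omega

/-- In the doubling a flat step dips one unit below its level, so nonnegativity of the doubled walk
also forbids flat steps at height 0. -/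
theorem IsWalk.nonneg_iff {L : ℕ} {h : ℤ → ℤ} (hh : IsWalk L h) :
    (pathDepth (stepWord h 0 L) = 0 ∧ ¬ FlatAtMin (stepWord h 0 L)) ↔ ∀ p, 0 ≤ doubled h p := by
  rw [hh.flatAtMin_iff]
  constructor
  · rintro ⟨h1, h2⟩
    have h3 : ∀ t, 0 ≤ h t := fun t => by have := hh.stepWord_min t; omega
    intro p
    obtain ⟨t, rfl | rfl⟩ : ∃ t, p = 2 * t ∨ p = 2 * t + 1 := ⟨p / 2, by omega⟩
    · rw [doubled_even]; have := h3 t; omega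
    · rw [doubled_odd]
      have h4 := h3 t
      split_ifs with h5
      · omega
      · have h6 := h3 (t + 1)
        have h7 : h t ≠ 0 := by
          intro h0
          have := hh.step t
          exact h2 ⟨t, by omega, fun s => h0 ▸ h3 s⟩
        omega
  · intro h1
    have h3 : ∀ t, 0 ≤ h t := fun t => by
      have := h1 (2 * t); rw [doubled_even] at this; omega
    obtain ⟨s, -, -, hs⟩ := (pathDepth_stepWord hh.step 0 L).2
    rw [hh.zero] at hs
    refine ⟨by have := h3 s; omega, ?_⟩
    rintro ⟨t, h4, h5⟩
    have h6 := h5 0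
    have h7 := h1 (2 * t + 1)
    rw [doubled_odd, if_neg (by omega)] at h7
    rw [hh.zero] at h6
    omega

theorem IsWalk.stepWord_injective {L : ℕ} {h h' : ℤ → ℤ} (hh : IsWalk L h) (hh' : IsWalk L h')
    (he : stepWord h 0 L = stepWord h' 0 L) : h = h' := by
  have h1 : ∀ i : ℕ, i < L → h (i + 1) - h i = h' (i + 1) - h' i := by
    intro i hi
    have h2 := congrArg (fun l : List SignType => l[i]?) he
    simp only [stepWord, List.getElem?_map, List.getElem?_range hi, Option.map_some, zero_add,
      Option.some.injEq] at h2
    rcases sign_step_cases hh.step i with ⟨h6, h7⟩ | ⟨h6, h7⟩ | ⟨h6, h7⟩ <;>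
    rcases sign_step_cases hh'.step i with ⟨h6', h7'⟩ | ⟨h6', h7'⟩ | ⟨h6', h7'⟩ <;>
    first
    | omega
    | (rw [h7, h7'] at h2; exact absurd h2 (by decide))
  have h2 : ∀ n : ℕ, n ≤ L → h n = h' n := by
    intro n
    induction n with
    | zero => intro _; simp [hh.zero, hh'.zero]
    | succ n ih =>
      intro hn
      have := ih (by omega)
      have := h1 n (by omega)
      push_cast
      omega
  funext t
  have hL : (0 : ℤ) < L := by have := hh.pos; omega
  have e : ∀ f : ℤ → ℤ, (∀ t, f (t + L) = f t) → f (t % L) = f t := fun f hf => by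
    have h1 := (show Function.Periodic f (L : ℤ) from hf).sub_zsmul_eq (t / L) (x := t)
    rwa [smul_eq_mul, mul_comm, ← Int.emod_def] at h1
  have h3 := Int.emod_nonneg t hL.ne'
  have h4 := Int.emod_lt_of_pos t hL
  have h5 := h2 (t % L).toNat (by omega)
  rwa [Int.toNat_of_nonneg h3, e h hh.periodic, e h' hh'.periodic] at h5

theorem exists_walk_of_word (l : List SignType) (hl : l ≠ []) (he : pathEnd l = 0) :
    ∃ h, IsWalk l.length h ∧ stepWord h 0 l.length = l := by
  have hL : (0 : ℤ) < l.length := by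
    have := List.length_pos_iff.mpr hl; omega
  -- The letters, cast to integers, are repeated periodically; the default 0 of `getD` is never used
  -- since the index is reduced modulo the length.
  set c : ℤ → ℤ := fun t => ((l.getD (t % l.length).toNat 0 : SignType) : ℤ) with hc
  obtain ⟨h, hz, hs⟩ := exists_potential c
  have hstep : ∀ t, h (t + 1) = h t + 1 ∨ h (t + 1) = h t ∨ h (t + 1) = h t - 1 := by
    intro t
    rw [hs]
    simp only [hc]
    rcases (l.getD (t % l.length).toNat 0) with _ | _ | _ <;> simp
    omega
  have hw : stepWord h 0 l.length = l := by
    refine List.ext_getElem (stepWord_length _ _ _) fun i h1 h2 => ?_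
    simp only [stepWord, List.getElem_map, List.getElem_range, zero_add, hs, add_sub_cancel_left, hc]
    rw [Int.emod_eq_of_lt (by omega) (by omega), Int.toNat_natCast, List.getD_eq_getElem _ _ h2]
    rcases l[i] with _ | _ | _ <;> simp
  have h0 : h l.length = h 0 := by
    have := pathEnd_stepWord hstep 0 l.length
    rw [hw, he, zero_add] at this
    omega
  exact ⟨h, ⟨by omega, hz, hstep, periodic_of_step hs (fun t => by simp only [hc, Int.add_emod_right]) h0⟩, hw⟩

/-- Counting closed Motzkin walks by counting words. -/
theorem card_walks {L u k : ℕ} (hL : 0 < L) (huk : 2 * u + k = L) (p : List SignType → Prop)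
    (s : Set (ℤ → ℤ))
    (hs : ∀ h, h ∈ s ↔ IsWalk L h ∧ upCount L h = u ∧ p (stepWord h 0 L)) :
    s.ncard = wordCount p u u k := by
  refine Set.ncard_congr (fun h _ => stepWord h 0 L) ?_ ?_ ?_
  · intro h hh
    obtain ⟨h1, h2, h3⟩ := (hs h).mp hh
    have e1 := count_pos_stepWord L h1.step
    have e2 := h1.pathEnd_stepWord
    have e3 := length_eq_count (stepWord h 0 L)
    rw [stepWord_length] at e3
    rw [pathEnd] at e2
    exact ⟨by omega, by omega, by omega, h3⟩
  · intro h h' hh hh' e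
    exact ((hs h).mp hh).1.stepWord_injective ((hs h').mp hh').1 e
  · rintro l ⟨h1, h2, h3, h4⟩
    have e1 := length_eq_count l
    have e2 : l.length = L := by omega
    obtain ⟨h, hh, hw⟩ := exists_walk_of_word l (by rintro rfl; simp at e2; omega)
      (by rw [pathEnd]; omega)
    rw [e2] at hh hw
    refine ⟨h, (hs h).mpr ⟨hh, ?_, by rwa [hw]⟩, hw⟩
    rw [← count_pos_stepWord L hh.step, hw, h1]

/-! ### Increasing enumerations of finite sets. -/

/-- `f 0 < f 1 < ⋯ < f (n - 1)` are the elements of `A`. -/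
structure IsEnum (f : ℕ → ℕ) (n : ℕ) (A : Finset ℕ) : Prop where
  mono : ∀ i j, i < j → j < n → f i < f j
  mem : ∀ x, x ∈ A ↔ ∃ j < n, f j = x

theorem exists_isEnum (A : Finset ℕ) : ∃ f, IsEnum f A.card A := by
  refine ⟨fun j => if h : j < A.card then A.orderEmbOfFin rfl ⟨j, h⟩ else 0, ?_, ?_⟩
  · intro i j hij hj
    simp only [hj, hij.trans hj, dif_pos]
    exact (A.orderEmbOfFin rfl).strictMono hij
  · intro x
    have h := Finset.range_orderEmbOfFin A rfl
    rw [← Finset.mem_coe, ← h]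
    constructor
    · rintro ⟨⟨j, hj⟩, rfl⟩; exact ⟨j, hj, by simp [hj]⟩
    · rintro ⟨j, hj, rfl⟩; exact ⟨⟨j, hj⟩, by simp [hj]⟩

section Enum

variable {f g : ℕ → ℕ} {n : ℕ} {A : Finset ℕ}

theorem IsEnum.inj (h : IsEnum f n A) {i j : ℕ} (hi : i < n) (hj : j < n) (e : f i = f j) :
    i = j := by
  rcases lt_trichotomy i j with h1 | h1 | h1
  · have := h.mono i j h1 hj; omega
  · exact h1
  · have := h.mono j i h1 hi; omega

theorem IsEnum.lt_of_lt (h : IsEnum f n A) {i j : ℕ} (hi : i < n) (e : f i < f j) :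
    i < j := by
  by_contra h1
  rcases eq_or_lt_of_le (not_lt.mp h1) with h2 | h2
  · subst h2; omega
  · have := h.mono j i h2 hi; omega

theorem IsEnum.card_filter_lt (h : IsEnum f n A) {j : ℕ} (hj : j < n) :
    (A.filter (· < f j)).card = j := by
  have e : A.filter (· < f j) = (Finset.range j).image f := by
    ext x
    simp only [Finset.mem_filter, h.mem, Finset.mem_image, Finset.mem_range]
    constructor
    · rintro ⟨⟨i, hi, rfl⟩, hlt⟩; exact ⟨i, h.lt_of_lt hi hlt, rfl⟩
    · rintro ⟨i, hi, rfl⟩; exact ⟨⟨i, by omega, rfl⟩, h.mono i j hi hj⟩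
  rw [e, Finset.card_image_of_injOn, Finset.card_range]
  intro a ha b hb hab
  simp only [Finset.coe_range, Set.mem_Iio] at ha hb
  exact h.inj (by omega) (by omega) hab

theorem IsEnum.card (h : IsEnum f n A) : A.card = n := by
  have e : A = (Finset.range n).image f := by
    ext x
    simp only [h.mem, Finset.mem_image, Finset.mem_range]
  rw [e, Finset.card_image_of_injOn, Finset.card_range]
  intro a ha b hb hab
  simp only [Finset.coe_range, Set.mem_Iio] at ha hb
  exact h.inj ha hb hab

theorem IsEnum.card_filter_lt_succ (h : IsEnum f n A) {j : ℕ} (hj : j < n) :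
    (A.filter (· < f j + 1)).card = j + 1 := by
  have e : A.filter (· < f j + 1) = insert (f j) (A.filter (· < f j)) := by
    ext x
    simp only [Finset.mem_filter, Finset.mem_insert]
    constructor
    · rintro ⟨h1, h2⟩
      by_cases h3 : x = f j
      · exact Or.inl h3
      · exact Or.inr ⟨h1, by omega⟩
    · rintro (rfl | ⟨h1, h2⟩)
      · exact ⟨(h.mem _).mpr ⟨j, hj, rfl⟩, by omega⟩
      · exact ⟨h1, by omega⟩
  rw [e, Finset.card_insert_of_notMem (by simp), h.card_filter_lt hj]

/-- Used to turn comparisons of tableau entries into comparisons of cardinalities, which are heights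
of the walk. -/
theorem IsEnum.lt_iff (h : IsEnum f n A) {j t : ℕ} :
    (j < n ∧ f j < t) ↔ j < (A.filter (· < t)).card := by
  constructor
  · rintro ⟨hj, hlt⟩
    rw [← Nat.succ_le_iff, Nat.succ_eq_add_one, ← h.card_filter_lt_succ hj]
    refine Finset.card_le_card fun x hx => ?_
    simp only [Finset.mem_filter] at hx ⊢
    exact ⟨hx.1, by omega⟩
  · intro hlt
    have hjn : j < n := by
      refine hlt.trans_le ?_
      rw [← h.card]
      exact Finset.card_filter_le _ _
    refine ⟨hjn, ?_⟩
    by_contra hge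
    have h1 : (A.filter (· < t)).card ≤ (A.filter (· < f j)).card := by
      refine Finset.card_le_card fun x hx => ?_
      simp only [Finset.mem_filter] at hx ⊢
      exact ⟨hx.1, by omega⟩
    rw [h.card_filter_lt hjn] at h1
    omega

theorem IsEnum.unique (h : IsEnum f n A) (h' : IsEnum g n A) {j : ℕ} (hj : j < n) :
    f j = g j := by
  have h1 : ∀ t, f j < t ↔ g j < t := fun t => by
    have a := h.lt_iff (j := j) (t := t)
    have b := h'.lt_iff (j := j) (t := t)
    tauto
  have h2 := (h1 (g j + 1)).mpr (by omega)
  have h3 := (h1 (f j + 1)).mp (by omega)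
  omega

end Enum

/-! ### The two rows of a tableau as step sets of a walk. -/

section Rows

/-- The entries of the top row: the positions of the steps `1` and `0`. -/
noncomputable def topRow (N : ℕ) (h : ℤ → ℤ) : Finset ℕ :=
  (Finset.Icc 1 N).filter fun x : ℕ => h x ≠ h (x - 1) - 1

/-- The entries of the bottom row: the positions of the steps `0` and `-1`. -/
noncomputable def bottomRow (N : ℕ) (h : ℤ → ℤ) : Finset ℕ :=
  (Finset.Icc 1 N).filter fun x : ℕ => h x ≠ h (x - 1) + 1

variable {N n : ℕ} {h h' : ℤ → ℤ}

theorem mem_topRow {x : ℕ} : x ∈ topRow N h ↔ (1 ≤ x ∧ x ≤ N) ∧ h x ≠ h (x - 1) - 1 := by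
  simp [topRow]

theorem mem_bottomRow {x : ℕ} : x ∈ bottomRow N h ↔ (1 ≤ x ∧ x ≤ N) ∧ h x ≠ h (x - 1) + 1 := by
  simp [bottomRow]

theorem card_filter_lt_succ (A : Finset ℕ) (t : ℕ) :
    (A.filter (· < t + 1)).card = (A.filter (· < t)).card + if t ∈ A then 1 else 0 := by
  split_ifs with ht
  · have e : A.filter (· < t + 1) = insert t (A.filter (· < t)) := by
      ext x
      simp only [Finset.mem_filter, Finset.mem_insert]
      constructor
      · rintro ⟨h1, h2⟩
        by_cases h3 : x = t
        · exact Or.inl h3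
        · exact Or.inr ⟨h1, by omega⟩
      · rintro (rfl | ⟨h1, h2⟩)
        · exact ⟨ht, by omega⟩
        · exact ⟨h1, by omega⟩
    rw [e, Finset.card_insert_of_notMem (by simp)]
  · congr 1
    refine Finset.filter_congr fun x hx => ?_
    have : x ≠ t := by rintro rfl; exact ht hx
    omega

/-- Flat steps contribute to both rows, so the height is the excess of top over bottom entries read
so far. -/
theorem IsWalk.card_rows (hh : IsWalk N h) (t : ℕ) (ht : t ≤ N) :
    (((topRow N h).filter (· < t + 1)).card : ℤ) = ((bottomRow N h).filter (· < t + 1)).card + h t := by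
  induction t with
  | zero =>
    have e1 : (topRow N h).filter (· < 0 + 1) = ∅ := by
      ext x; simp only [Finset.mem_filter, mem_topRow, Finset.notMem_empty, iff_false]; omega
    have e2 : (bottomRow N h).filter (· < 0 + 1) = ∅ := by
      ext x; simp only [Finset.mem_filter, mem_bottomRow, Finset.notMem_empty, iff_false]; omega
    rw [e1, e2]
    simpa using hh.zero.symm
  | succ t ih =>
    rw [card_filter_lt_succ, card_filter_lt_succ (bottomRow N h)]
    have ih := ih (by omega)
    have hs := hh.step t
    simp only [mem_topRow, mem_bottomRow, show 1 ≤ t + 1 ∧ t + 1 ≤ N from ⟨by omega, ht⟩, true_and]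
    push_cast
    simp only [add_sub_cancel_right]
    split_ifs <;> omega

theorem card_filter_lt_of_subset {A : Finset ℕ} (hA : A ⊆ Finset.Icc 1 N) :
    (A.filter (· < N + 1)).card = A.card := by
  congr 1
  refine Finset.filter_true_of_mem fun x hx => ?_
  have := Finset.mem_Icc.mp (hA hx)
  omega

theorem IsWalk.card_topRow (hh : IsWalk N h) : (topRow N h).card = (bottomRow N h).card := by
  have h1 := hh.card_rows N le_rfl
  rw [card_filter_lt_of_subset (A := topRow N h) (Finset.filter_subset _ _),
    card_filter_lt_of_subset (A := bottomRow N h) (Finset.filter_subset _ _)] at h1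
  have := hh.periodic 0
  rw [zero_add, hh.zero] at this
  omega

theorem card_bottomRow_add (N : ℕ) (h : ℤ → ℤ) : (bottomRow N h).card + upCount N h = N := by
  have e : upCount N h = ((Finset.Icc 1 N).filter fun x : ℕ => ¬ h x ≠ h (x - 1) + 1).card := by
    refine Finset.card_bij (fun i _ => i + 1) ?_ ?_ ?_
    · intro i hi
      simp only [Finset.mem_filter, Finset.mem_range, Finset.mem_Icc] at hi ⊢
      push_cast
      rw [add_sub_cancel_right]
      have := hi.1
      exact ⟨⟨trivial, by omega⟩, not_not.mpr hi.2⟩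
    · intro i _ j _ hij; omega
    · intro x hx
      simp only [Finset.mem_filter, Finset.mem_Icc, not_not] at hx
      refine ⟨x - 1, ?_, by omega⟩
      simp only [Finset.mem_filter, Finset.mem_range]
      rw [Nat.cast_sub hx.1.1, Nat.cast_one, sub_add_cancel]
      exact ⟨by omega, hx.2⟩
  rw [e, bottomRow, Finset.card_filter_add_card_filter_not, Nat.card_Icc]
  omega

theorem one_le_height_of_nonneg (h0 : ∀ p, 0 ≤ doubled h p) {t : ℤ} (ht : h (t + 1) ≠ h t + 1) :
    1 ≤ h t := by
  have := h0 (2 * t + 1)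
  rw [doubled_odd, if_neg ht] at this
  omega

theorem IsWalk.eq_of_rows_eq (hh : IsWalk N h) (hh' : IsWalk N h')
    (h1 : topRow N h = topRow N h') (h2 : bottomRow N h = bottomRow N h') : h = h' := by
  refine hh.ext hh' fun p hp0 hpN => ?_
  obtain ⟨t, rfl | rfl⟩ : ∃ t : ℕ, p = 2 * t ∨ p = 2 * t + 1 := ⟨(p / 2).toNat, by omega⟩
  · rw [doubled_up_even, doubled_up_even]
    have h3 : t + 1 ∈ bottomRow N h ↔ t + 1 ∈ bottomRow N h' := by rw [h2]
    rw [mem_bottomRow, mem_bottomRow] at h3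
    push_cast at h3
    rw [add_sub_cancel_right] at h3
    have : 1 ≤ t + 1 ∧ t + 1 ≤ N := by omega
    tauto
  · rw [hh.doubled_up_odd, hh'.doubled_up_odd]
    have h3 : t + 1 ∈ topRow N h ↔ t + 1 ∈ topRow N h' := by rw [h1]
    rw [mem_topRow, mem_topRow] at h3
    push_cast at h3
    rw [add_sub_cancel_right] at h3
    have : 1 ≤ t + 1 ∧ t + 1 ≤ N := by omega
    tauto

end Rows

/-! ### Tableaux and nonnegative walks. -/

section Tableaux

variable {N n : ℕ} {h h' : ℤ → ℤ}

theorem mem_rectDiagram {m n i j : ℕ} : (i, j) ∈ rectDiagram m n ↔ i < m ∧ j < n := by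
  rw [← YoungDiagram.mem_cells]
  simp [rectDiagram]

theorem IncreasingTableau.ext_entry {μ : YoungDiagram} {M : ℕ} {T T' : IncreasingTableau μ M}
    (e : T.entry = T'.entry) : T = T' := by
  obtain ⟨⟨f, _, _, _⟩, _, _⟩ := T
  obtain ⟨⟨f', _, _, _⟩, _, _⟩ := T'
  obtain rfl : f = f' := e
  rfl

/-- The filling `T` of two rows of length `n` corresponds to the walk `h`. -/
def Represents (n N : ℕ) (T : ℕ → ℕ → ℕ) (h : ℤ → ℤ) : Prop :=
  IsEnum (T 0) n (topRow N h) ∧ IsEnum (T 1) n (bottomRow N h)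

theorem exists_tableau (hh : IsWalk N h) (h0 : ∀ p, 0 ≤ doubled h p)
    (hn : n + upCount N h = N) :
    ∃ T : IncreasingTableau (rectDiagram 2 n) N, Represents n N T.entry h := by
  have hc := card_bottomRow_add N h
  have hct := hh.card_topRow
  obtain ⟨f, hf⟩ := exists_isEnum (topRow N h)
  obtain ⟨g, hg⟩ := exists_isEnum (bottomRow N h)
  rw [show (bottomRow N h).card = n by omega] at hg
  rw [show (topRow N h).card = n by omega] at hf
  -- Before the bottom entry y = g j there are j bottom entries, hence j + h(y-1) top entries. A
  -- step that is not up starts at height at least 1, so the top entry of index j is among them.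
  have hcol : ∀ j < n, f j < g j := by
    intro j hj
    obtain ⟨⟨hy1, hyN⟩, hy⟩ := mem_bottomRow.mp ((hg.mem (g j)).mpr ⟨j, hj, rfl⟩)
    have h1 := hh.card_rows (g j - 1) (by omega)
    rw [show g j - 1 + 1 = g j by omega, hg.card_filter_lt hj, Nat.cast_sub hy1, Nat.cast_one] at h1
    have h2 := one_le_height_of_nonneg h0 (t := (g j : ℤ) - 1) (by rwa [sub_add_cancel])
    exact (hf.lt_iff.mpr (by omega)).2
  set e : ℕ → ℕ → ℕ := fun i j =>
    if j < n then (if i = 0 then f j else if i = 1 then g j else 0) else 0 with he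
  have e0 : ∀ j, j < n → e 0 j = f j := fun j hj => by simp [he, hj]
  have e1 : ∀ j, j < n → e 1 j = g j := fun j hj => by simp [he, hj]
  have hrow : ∀ {i j1 j2 : ℕ}, j1 < j2 → (i, j2) ∈ rectDiagram 2 n → e i j1 < e i j2 := by
    intro i j1 j2 hj hm
    obtain ⟨hi, hj2⟩ := mem_rectDiagram.mp hm
    rcases (show i = 0 ∨ i = 1 by omega) with rfl | rfl
    · rw [e0 _ hj2, e0 _ (hj.trans hj2)]; exact hf.mono _ _ hj hj2
    · rw [e1 _ hj2, e1 _ (hj.trans hj2)]; exact hg.mono _ _ hj hj2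
  refine ⟨⟨⟨e, ?_, ?_, ?_⟩, hrow, ?_⟩, ?_, ?_⟩
  · intro i j1 j2 hj hm; exact (hrow hj hm).le
  · intro i1 i2 j hi hm
    obtain ⟨hi2, hj⟩ := mem_rectDiagram.mp hm
    obtain ⟨rfl, rfl⟩ : i1 = 0 ∧ i2 = 1 := by omega
    rw [e0 _ hj, e1 _ hj]; exact hcol j hj
  · intro i j hm
    rw [mem_rectDiagram] at hm
    simp only [he]
    split_ifs <;> first | rfl | omega
  · ext v
    simp only [Set.mem_ofPred_eq, Set.mem_Icc]
    constructor
    · rintro ⟨i, j, hm, rfl⟩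
      obtain ⟨hi, hj⟩ := mem_rectDiagram.mp hm
      rcases (show i = 0 ∨ i = 1 by omega) with rfl | rfl
      · rw [e0 _ hj]; exact (mem_topRow.mp ((hf.mem _).mpr ⟨j, hj, rfl⟩)).1
      · rw [e1 _ hj]; exact (mem_bottomRow.mp ((hg.mem _).mpr ⟨j, hj, rfl⟩)).1
    · intro hv
      by_cases h1 : h v ≠ h (v - 1) - 1
      · obtain ⟨j, hj, hj'⟩ := (hf.mem v).mp (mem_topRow.mpr ⟨hv, h1⟩)
        exact ⟨0, j, mem_rectDiagram.mpr ⟨by omega, hj⟩, by rw [e0 _ hj, hj']⟩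
      · obtain ⟨j, hj, hj'⟩ := (hg.mem v).mp (mem_bottomRow.mpr ⟨hv, by omega⟩)
        exact ⟨1, j, mem_rectDiagram.mpr ⟨by omega, hj⟩, by rw [e1 _ hj, hj']⟩
  · constructor
    · intro i j hij hj
      change e 0 i < e 0 j
      rw [e0 _ hj, e0 _ (hij.trans hj)]; exact hf.mono _ _ hij hj
    · intro x
      rw [hf.mem]
      exact exists_congr fun j => and_congr_right fun hj => by
        change _ ↔ e 0 j = x; rw [e0 _ hj]
  · constructor
    · intro i j hij hj
      change e 1 i < e 1 j
      rw [e1 _ hj, e1 _ (hij.trans hj)]; exact hg.mono _ _ hij hj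
    · intro x
      rw [hg.mem]
      exact exists_congr fun j => and_congr_right fun hj => by
        change _ ↔ e 1 j = x; rw [e1 _ hj]

theorem IncreasingTableau.exists_walk (hN : 0 < N) (T : IncreasingTableau (rectDiagram 2 n) N) :
    ∃ h, IsWalk N h ∧ (∀ p, 0 ≤ doubled h p) ∧ n + upCount N h = N ∧ Represents n N T.entry h := by
  set A : Finset ℕ := (Finset.range n).image (T.entry 0) with hA
  set C : Finset ℕ := (Finset.range n).image (T.entry 1) with hC
  have eA : IsEnum (T.entry 0) n A :=
    ⟨fun i j hij hj => T.row_strict' hij (mem_rectDiagram.mpr ⟨by omega, hj⟩), fun x => by simp [hA]⟩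
  have eC : IsEnum (T.entry 1) n C :=
    ⟨fun i j hij hj => T.row_strict' hij (mem_rectDiagram.mpr ⟨by omega, hj⟩), fun x => by simp [hC]⟩
  have hcol : ∀ j < n, T.entry 0 j < T.entry 1 j := fun j hj =>
    T.col_strict' (by omega) (mem_rectDiagram.mpr ⟨by omega, hj⟩)
  have hent : ∀ v, (v ∈ A ∨ v ∈ C) ↔ 1 ≤ v ∧ v ≤ N := by
    intro v
    rw [← Set.mem_Icc, ← T.entries_eq', eA.mem, eC.mem]
    constructor
    · rintro (⟨j, hj, e⟩ | ⟨j, hj, e⟩)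
      · exact ⟨0, j, mem_rectDiagram.mpr ⟨by omega, hj⟩, e⟩
      · exact ⟨1, j, mem_rectDiagram.mpr ⟨by omega, hj⟩, e⟩
    · rintro ⟨i, j, hm, e⟩
      obtain ⟨hi, hj⟩ := mem_rectDiagram.mp hm
      rcases (show i = 0 ∨ i = 1 by omega) with rfl | rfl
      · exact Or.inl ⟨j, hj, e⟩
      · exact Or.inr ⟨j, hj, e⟩
  have hN' : (0 : ℤ) < N := by omega
  -- Step t of the walk corresponds to the label t+1, labels starting at 1.
  set c : ℤ → ℤ := fun t => (if (t % N).toNat + 1 ∈ A then 1 else 0) -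
    (if (t % N).toNat + 1 ∈ C then 1 else 0) with hc
  obtain ⟨h, hz, hs⟩ := exists_potential c
  have hcn : ∀ t : ℕ, t < N → c t = (if t + 1 ∈ A then 1 else 0) - (if t + 1 ∈ C then 1 else 0) := by
    intro t ht
    simp only [hc]
    rw [Int.emod_eq_of_lt (by omega) (by omega), Int.toNat_natCast]
  have hcard : ∀ t : ℕ, t ≤ N →
      h t = (A.filter (· < t + 1)).card - (C.filter (· < t + 1)).card := by
    intro t
    induction t with
    | zero =>
      intro _
      have a1 : A.filter (· < 0 + 1) = ∅ := by
        refine Finset.filter_false_of_mem fun x hx => ?_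
        have := (hent x).mp (Or.inl hx)
        omega
      have a2 : C.filter (· < 0 + 1) = ∅ := by
        refine Finset.filter_false_of_mem fun x hx => ?_
        have := (hent x).mp (Or.inr hx)
        omega
      rw [a1, a2]
      simpa using hz
    | succ t ih =>
      intro ht
      have ih := ih (by omega)
      rw [card_filter_lt_succ, card_filter_lt_succ C]
      push_cast
      rw [hs, hcn t (by omega), ih]
      ring
  have hper : ∀ t, h (t + N) = h t := by
    refine periodic_of_step hs (fun t => by simp only [hc, Int.add_emod_right]) ?_
    rw [hcard N le_rfl, card_filter_lt_of_subset, card_filter_lt_of_subset, eA.card, eC.card, hz]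
    · ring
    · intro x hx; exact Finset.mem_Icc.mpr ((hent x).mp (Or.inr hx))
    · intro x hx; exact Finset.mem_Icc.mpr ((hent x).mp (Or.inl hx))
  have hh : IsWalk N h := by
    refine ⟨hN, hz, fun t => ?_, hper⟩
    rw [hs]
    simp only [hc]
    split_ifs <;> omega
  have hsn : ∀ t : ℕ, t < N → h (t + 1) - h t =
      (if t + 1 ∈ A then 1 else 0) - (if t + 1 ∈ C then 1 else 0) := by
    intro t ht
    rw [hs, hcn t ht]; ring
  have htop : topRow N h = A := by
    ext x
    rw [mem_topRow]
    constructor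
    · rintro ⟨h1, h2⟩
      obtain ⟨t, rfl⟩ : ∃ t, x = t + 1 := ⟨x - 1, by omega⟩
      have h3 := hsn t (by omega)
      have h4 := (hent (t + 1)).mpr h1
      push_cast at h2
      rw [add_sub_cancel_right] at h2
      by_contra h5
      rw [if_neg h5, if_pos (h4.resolve_left h5)] at h3
      omega
    · intro hx
      have h1 := (hent x).mp (Or.inl hx)
      obtain ⟨t, rfl⟩ : ∃ t, x = t + 1 := ⟨x - 1, by omega⟩
      have h3 := hsn t (by omega)
      rw [if_pos hx] at h3
      refine ⟨h1, ?_⟩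
      push_cast
      rw [add_sub_cancel_right]
      split_ifs at h3 <;> omega
  have hbot : bottomRow N h = C := by
    ext x
    rw [mem_bottomRow]
    constructor
    · rintro ⟨h1, h2⟩
      obtain ⟨t, rfl⟩ : ∃ t, x = t + 1 := ⟨x - 1, by omega⟩
      have h3 := hsn t (by omega)
      have h4 := (hent (t + 1)).mpr h1
      push_cast at h2
      rw [add_sub_cancel_right] at h2
      by_contra h5
      rw [if_neg h5, if_pos (h4.resolve_right h5)] at h3
      omega
    · intro hx
      have h1 := (hent x).mp (Or.inr hx)
      obtain ⟨t, rfl⟩ : ∃ t, x = t + 1 := ⟨x - 1, by omega⟩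
      have h3 := hsn t (by omega)
      rw [if_pos hx] at h3
      refine ⟨h1, ?_⟩
      push_cast
      rw [add_sub_cancel_right]
      split_ifs at h3 <;> omega
  have hnn : ∀ t : ℕ, t < N → 0 ≤ h t := by
    intro t ht
    rw [hcard t ht.le]
    by_contra hneg
    have h1 := eC.lt_iff.mpr (show (A.filter (· < t + 1)).card < (C.filter (· < t + 1)).card by omega)
    have h2 := eA.lt_iff.mp ⟨h1.1, (hcol _ h1.1).trans h1.2⟩
    exact lt_irrefl _ h2
  -- The label t+1 is a bottom entry in some column j; the top entry of that column is smaller, so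
  -- before it there are at least j+1 top and exactly j bottom entries.
  have hone : ∀ t : ℕ, t < N → h (t + 1) ≠ h t + 1 → 1 ≤ h t := by
    intro t ht h1
    have h2 : t + 1 ∈ C := by
      rw [← hbot, mem_bottomRow]
      push_cast
      rw [add_sub_cancel_right]
      exact ⟨⟨trivial, by omega⟩, h1⟩
    obtain ⟨j, hj, e⟩ := (eC.mem _).mp h2
    have h3 := hcol j hj
    rw [e] at h3
    have h4 := eA.lt_iff.mp ⟨hj, h3⟩
    rw [hcard t ht.le, ← e, eC.card_filter_lt hj, e]
    omega
  refine ⟨h, hh, ?_, ?_, ?_, ?_⟩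
  · intro p
    have e1 : doubled h (p % (2 * N)) = doubled h p := by
      have := (show Function.Periodic (doubled h) (2 * N : ℤ) from
        hh.isUnitWalk.periodic).sub_zsmul_eq (p / (2 * N)) (x := p)
      rwa [smul_eq_mul, mul_comm, ← Int.emod_def] at this
    have h2 := Int.emod_nonneg p (show (2 * N : ℤ) ≠ 0 by omega)
    have h3 := Int.emod_lt_of_pos p (show (0 : ℤ) < 2 * N by omega)
    rw [← e1]
    obtain ⟨t, ht | ht⟩ : ∃ t : ℕ, p % (2 * N) = 2 * t ∨ p % (2 * N) = 2 * t + 1 :=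
      ⟨(p % (2 * N) / 2).toNat, by omega⟩
    · rw [ht, doubled_even]; have := hnn t (by omega); omega
    · rw [ht, doubled_odd]
      have := hnn t (by omega)
      split_ifs with h4
      · omega
      · have := hone t (by omega) h4
        omega
  · have := card_bottomRow_add N h
    rwa [hbot, eC.card] at this
  · rw [htop]; exact eA
  · rw [hbot]; exact eC

theorem Represents.unique (hT : IsWalk N h) (hT' : IsWalk N h') {T : ℕ → ℕ → ℕ}
    (r : Represents n N T h) (r' : Represents n N T h') : h = h' := by
  refine hT.eq_of_rows_eq hT' ?_ ?_
  · ext x; rw [r.1.mem, r'.1.mem]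
  · ext x; rw [r.2.mem, r'.2.mem]

theorem Represents.entry_eq {T : IncreasingTableau (rectDiagram 2 n) N} {T' : ℕ → ℕ → ℕ}
    (r : Represents n N T.entry h) (r' : Represents n N T' h)
    (hz : ∀ i j, (i, j) ∉ rectDiagram 2 n → T' i j = 0) : T.entry = T' := by
  funext i j
  by_cases hm : (i, j) ∈ rectDiagram 2 n
  · obtain ⟨hi, hj⟩ := mem_rectDiagram.mp hm
    rcases (show i = 0 ∨ i = 1 by omega) with rfl | rfl
    · exact r.1.unique r'.1 hj
    · exact r.2.unique r'.2 hj
  · rw [hz i j hm]; exact T.zeros' hm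

end Tableaux

/-! ### The K-jeu de taquin slide for two rows. -/

section Slide

/-- A filling of two rows of length `n`, together with the columns `j₀` and `j₁` in which the two
paths of the K-jeu de taquin slide leave the top row and enter the bottom row. -/
structure SlideData (n : ℕ) (α β : ℕ → ℕ) (j₀ j₁ : ℕ) : Prop where
  top_mono : ∀ i j, i < j → j < n → α i < α j
  bottom_mono : ∀ i j, i < j → j < n → β i < β j
  col : ∀ j < n, α j < β j
  first : α 0 = 1
  le : j₁ ≤ j₀
  lt : j₀ < n
  le_of_lt_exit : ∀ i < j₀, α (i + 1) ≤ β i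
  lt_at_exit : j₀ + 1 < n → β j₀ < α (j₀ + 1)
  lt_of_lt_entry : ∀ i < j₁, α (i + 1) < β i
  le_at_entry : j₁ + 1 < n → β j₁ ≤ α (j₁ + 1)

/-- The top row after the slide. -/
def slidTop (α β : ℕ → ℕ) (j₀ j : ℕ) : ℕ :=
  if j < j₀ then α (j + 1) else if j = j₀ then β j₀ else α j

/-- The bottom row after the slide, with `0` in the empty box. -/
def slidBottom (n : ℕ) (β : ℕ → ℕ) (j₁ j : ℕ) : ℕ :=
  if j < j₁ then β j else if j + 1 < n then β (j + 1) else 0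

/-- The partial filling after `t` rounds of the slide. -/
def slideState (n : ℕ) (α β : ℕ → ℕ) (j₀ j₁ t i j : ℕ) : ℕ :=
  if n ≤ j then 0
  else if i = 0 then
    if j < t then slidTop α β j₀ j else if j = t ∧ t ≤ j₀ then 0 else α j
  else if i = 1 then
    if j + 1 < t then slidBottom n β j₁ j else if j + 1 = t ∧ j₁ ≤ j then 0 else β j
  else 0

variable {n j₀ j₁ : ℕ} {α β : ℕ → ℕ}

theorem SlideData.top_pos (d : SlideData n α β j₀ j₁) {j : ℕ} (hj : j < n) : 0 < α j := by
  rcases Nat.eq_zero_or_pos j with rfl | h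
  · rw [d.first]; exact one_pos
  · exact (Nat.zero_le _).trans_lt (d.top_mono 0 j h hj)

theorem SlideData.bottom_pos (d : SlideData n α β j₀ j₁) {j : ℕ} (hj : j < n) : 0 < β j :=
  (Nat.zero_le _).trans_lt (d.col j hj)

theorem SlideData.slidTop_pos (d : SlideData n α β j₀ j₁) {j : ℕ} (hj : j < n) :
    0 < slidTop α β j₀ j := by
  have := d.lt
  rw [slidTop]
  split_ifs
  · exact d.top_pos (by omega)
  · exact d.bottom_pos d.lt
  · exact d.top_pos hj

theorem SlideData.seLabel_top (d : SlideData n α β j₀ j₁) {t : ℕ} (ht : t ≤ j₀) :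
    seLabel (slideState n α β j₀ j₁ t) 0 t = slidTop α β j₀ t := by
  have h1 := d.lt
  have h2 := d.bottom_pos (show t < n by omega)
  have e1 : slideState n α β j₀ j₁ t (0 + 1) t = β t := by
    rw [slideState, if_neg (by omega), if_neg (by omega), if_pos rfl, if_neg (by omega),
      if_neg (by omega)]
  have e0 : slideState n α β j₀ j₁ t 0 (t + 1) = if t + 1 < n then α (t + 1) else 0 := by
    rw [slideState]
    by_cases h : t + 1 < n
    · rw [if_neg (by omega), if_pos rfl, if_neg (by omega), if_neg (by omega), if_pos h]
    · rw [if_pos (by omega), if_neg h]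
  rw [seLabel, e0, e1, minLabel, slidTop]
  rcases ht.lt_or_eq with h | rfl
  · have h3 := d.le_of_lt_exit t h
    have h4 := d.top_pos (show t + 1 < n by omega)
    rw [if_pos (show t + 1 < n by omega), if_pos h, if_neg (by omega), if_neg (by omega)]
    exact min_eq_left h3
  · rw [if_neg (lt_irrefl _), if_pos rfl]
    by_cases h : t + 1 < n
    · have h3 := d.lt_at_exit h
      rw [if_pos h, if_neg (by omega), if_neg (by omega)]
      exact min_eq_right h3.le
    · rw [if_neg h, if_pos rfl]

theorem SlideData.seLabel_bottom (n : ℕ) (α β : ℕ → ℕ) (j₀ j₁ j : ℕ) :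
    seLabel (slideState n α β j₀ j₁ (j + 1)) 1 j = if j + 1 < n then β (j + 1) else 0 := by
  have e1 : slideState n α β j₀ j₁ (j + 1) (1 + 1) j = 0 := by
    simp [slideState]
  have e0 : slideState n α β j₀ j₁ (j + 1) 1 (j + 1) = if j + 1 < n then β (j + 1) else 0 := by
    rw [slideState]
    by_cases h : j + 1 < n
    · rw [if_neg (by omega), if_neg (by omega), if_pos rfl, if_neg (by omega), if_neg (by omega),
        if_pos h]
    · rw [if_pos (by omega), if_neg h]
  rw [seLabel, e0, e1, minLabel]
  split_ifs <;> first | rfl | omega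

/-- This and the next lemma locate the empty boxes: after t rounds they lie in column t of the top
row, up to j₀, and in column t-1 of the bottom row, from j₁ on. A hole that has reached the end of
the bottom row stays there. -/
theorem SlideData.state_top_eq_zero (d : SlideData n α β j₀ j₁) {t j : ℕ} (hj : j < n) :
    slideState n α β j₀ j₁ t 0 j = 0 ↔ j = t ∧ t ≤ j₀ := by
  have h1 := d.slidTop_pos hj
  have h2 := d.top_pos hj
  rw [slideState, if_neg (by omega), if_pos rfl]
  split_ifs with h3 h4
  · exact iff_of_false (by omega) (by omega)
  · exact iff_of_true rfl h4
  · exact iff_of_false (by omega) h4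

theorem SlideData.state_bottom_eq_zero (d : SlideData n α β j₀ j₁) {t j : ℕ} (hj : j < n) :
    slideState n α β j₀ j₁ t 1 j = 0 ↔ (j + 1 = t ∧ j₁ ≤ j) ∨ (j + 1 = n ∧ j + 1 < t) := by
  have h1 := d.bottom_pos hj
  have h3 := d.le
  have h4 := d.lt
  rw [slideState, if_neg (by omega), if_neg (by omega), if_pos rfl, slidBottom]
  by_cases h : j + 1 < n
  · have := d.bottom_pos h
    split_ifs <;> omega
  · split_ifs <;> omega

theorem SlideData.kSlide_top (d : SlideData n α β j₀ j₁) (t : ℕ) {j : ℕ} (hj : j < n) :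
    kSlide (rectDiagram 2 n) (slideState n α β j₀ j₁ t) 0 j =
      slideState n α β j₀ j₁ (t + 1) 0 j := by
  have hlt := d.lt
  rw [kSlide, if_pos (mem_rectDiagram.mpr ⟨by omega, hj⟩)]
  by_cases hz : j = t ∧ t ≤ j₀
  · rw [if_pos ((d.state_top_eq_zero hj).mpr hz)]
    obtain ⟨rfl, h⟩ := hz
    rw [d.seLabel_top h, slideState, if_neg (by omega), if_pos rfl, if_pos (by omega)]
  · rw [if_neg (fun h => hz ((d.state_top_eq_zero hj).mp h))]
    by_cases hr : j = t + 1 ∧ t < j₀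
    · obtain ⟨rfl, h⟩ := hr
      rw [if_pos]
      · exact ((d.state_top_eq_zero hj).mpr ⟨rfl, h⟩).symm
      · refine Or.inl ⟨by omega, ?_, ?_⟩
        · exact (d.state_top_eq_zero (by omega)).mpr ⟨by omega, h.le⟩
        · rw [Nat.add_sub_cancel, d.seLabel_top h.le, slidTop, if_pos h, slideState,
            if_neg (by omega), if_pos rfl, if_neg (by omega), if_neg (by omega)]
    · rw [if_neg]
      · simp only [slideState, if_pos, if_neg (show ¬n ≤ j by omega), slidTop]
        split_ifs <;> first | rfl | omega
      · rintro (⟨h1, h2, h3⟩ | ⟨h1, -⟩)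
        · obtain ⟨h4, h5⟩ := (d.state_top_eq_zero (by omega)).mp h2
          obtain rfl : t = j₀ := by omega
          have h6 := d.lt_at_exit (by omega)
          rw [h4, d.seLabel_top h5, slidTop, if_neg (by omega), if_pos rfl, slideState,
            if_neg (by omega), if_pos rfl, if_neg (by omega), if_neg (by omega),
            show j = t + 1 by omega] at h3
          omega
        · omega

theorem SlideData.kSlide_bottom (d : SlideData n α β j₀ j₁) (t : ℕ) {j : ℕ} (hj : j < n) :
    kSlide (rectDiagram 2 n) (slideState n α β j₀ j₁ t) 1 j =
      slideState n α β j₀ j₁ (t + 1) 1 j := by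
  have hlt := d.lt
  have hle := d.le
  rw [kSlide, if_pos (mem_rectDiagram.mpr ⟨by omega, hj⟩)]
  by_cases hz : (j + 1 = t ∧ j₁ ≤ j) ∨ (j + 1 = n ∧ j + 1 < t)
  · rw [if_pos ((d.state_bottom_eq_zero hj).mpr hz)]
    rcases hz with ⟨rfl, h⟩ | ⟨h, h'⟩
    · rw [SlideData.seLabel_bottom]
      symm
      rw [slideState, if_neg (by omega), if_neg one_ne_zero, if_pos rfl,
        if_pos (by omega), slidBottom, if_neg (by omega)]
    · have e1 : slideState n α β j₀ j₁ t 1 (j + 1) = 0 := by rw [slideState, if_pos (by omega)]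
      have e2 : slideState n α β j₀ j₁ t (1 + 1) j = 0 := by
        rw [slideState, if_neg (by omega), if_neg (by omega), if_neg (by omega)]
      rw [(d.state_bottom_eq_zero hj).mpr (by omega), seLabel, e1, e2, minLabel, if_pos rfl]
  · rw [if_neg (fun h => hz ((d.state_bottom_eq_zero hj).mp h))]
    by_cases hr : j = t ∧ j₁ ≤ j
    · obtain ⟨rfl, h⟩ := hr
      have e1 : slideState n α β j₀ j₁ j 1 j = β j := by
        rw [slideState, if_neg (by omega), if_neg (by omega), if_pos rfl, if_neg (by omega),
          if_neg (by omega)]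
      rw [if_pos]
      · exact ((d.state_bottom_eq_zero hj).mpr (by omega)).symm
      · rw [e1]
        rcases h.lt_or_eq with h | rfl
        · refine Or.inl ⟨by omega, (d.state_bottom_eq_zero (by omega)).mpr (by omega), ?_⟩
          obtain ⟨i, rfl⟩ : ∃ i, j = i + 1 := ⟨j - 1, by omega⟩
          rw [Nat.add_sub_cancel, SlideData.seLabel_bottom, if_pos hj]
        -- At the entry column the label is pulled up by the hole above. If j₁ < j₀, the
        -- inequalities force α (j₁ + 1) = β j₁, so both SE-neighbors are emptied and the hole
        -- splits; if j₁ = j₀, the hole just moves down.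
        · refine Or.inr ⟨by omega, (d.state_top_eq_zero hj).mpr ⟨rfl, hle⟩, ?_⟩
          rw [Nat.sub_self, d.seLabel_top hle, slidTop]
          split_ifs with h1 h2
          · exact le_antisymm (d.le_of_lt_exit _ h1) (d.le_at_entry (by omega))
          · rw [h2]
          · omega
    · rw [if_neg]
      · simp only [slideState, if_neg (show ¬n ≤ j by omega), if_neg one_ne_zero, if_pos, slidBottom]
        split_ifs <;> first | rfl | omega
      · rintro (⟨h1, h2, h3⟩ | ⟨h1, h2, h3⟩)
        · have := (d.state_bottom_eq_zero (by omega)).mp h2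
          omega
        · obtain ⟨rfl, h5⟩ := (d.state_top_eq_zero hj).mp h2
          have h6 := d.lt_of_lt_entry j (by omega)
          rw [Nat.sub_self, d.seLabel_top h5, slidTop, if_pos (by omega), slideState,
            if_neg (by omega), if_neg (by omega), if_pos rfl, if_neg (by omega),
            if_neg (by omega)] at h3
          omega

theorem SlideData.kSlide_state (d : SlideData n α β j₀ j₁) (t : ℕ) :
    kSlide (rectDiagram 2 n) (slideState n α β j₀ j₁ t) = slideState n α β j₀ j₁ (t + 1) := by
  funext i j
  by_cases hm : (i, j) ∈ rectDiagram 2 n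
  · obtain ⟨hi, hj⟩ := mem_rectDiagram.mp hm
    rcases (show i = 0 ∨ i = 1 by omega) with rfl | rfl
    · exact d.kSlide_top t hj
    · exact d.kSlide_bottom t hj
  · rw [kSlide, if_neg hm, slideState]
    rw [mem_rectDiagram] at hm
    split_ifs <;> first | rfl | omega

theorem SlideData.iterate (d : SlideData n α β j₀ j₁) (t : ℕ) :
    (kSlide (rectDiagram 2 n))^[t] (slideState n α β j₀ j₁ 0) = slideState n α β j₀ j₁ t := by
  induction t with
  | zero => rfl
  | succ t ih => rw [Function.iterate_succ_apply', ih, d.kSlide_state]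

/-- K-promotion of a filling with two rows. -/
theorem SlideData.kPromotion_eq {T : ℕ → ℕ → ℕ} (d : SlideData n (T 0) (T 1) j₀ j₁)
    (hT : ∀ i j, (i, j) ∉ rectDiagram 2 n → T i j = 0) (N : ℕ) {j : ℕ} (hj : j < n) :
    kPromotion (rectDiagram 2 n) N T 0 j = slidTop (T 0) (T 1) j₀ j - 1 ∧
    kPromotion (rectDiagram 2 n) N T 1 j =
      (if slidBottom n (T 1) j₁ j = 0 then N + 1 else slidBottom n (T 1) j₁ j) - 1 := by
  have hlt := d.lt
  have e : (fun a b => if T a b = 1 then 0 else T a b) = slideState n (T 0) (T 1) j₀ j₁ 0 := by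
    funext a b
    by_cases hm : (a, b) ∈ rectDiagram 2 n
    · obtain ⟨ha, hb⟩ := mem_rectDiagram.mp hm
      have h1 := d.first
      rcases (show a = 0 ∨ a = 1 by omega) with rfl | rfl
      · rcases Nat.eq_zero_or_pos b with rfl | hb0
        · rw [if_pos h1, (d.state_top_eq_zero hb).mpr ⟨rfl, by omega⟩]
        · have := d.top_mono 0 b hb0 hb
          rw [if_neg (by omega), slideState, if_neg (by omega), if_pos rfl, if_neg (by omega),
            if_neg (by omega)]
      · have h2 := d.top_pos hb
        have h3 := d.col b hb
        rw [if_neg (by omega), slideState, if_neg (by omega), if_neg one_ne_zero, if_pos rfl,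
          if_neg (by omega), if_neg (by omega)]
    · rw [hT a b hm, slideState]
      rw [mem_rectDiagram] at hm
      split_ifs <;> first | rfl | omega
  have hcard : (rectDiagram 2 n).card = 2 * n := by
    rw [YoungDiagram.card]
    simp [rectDiagram]
  have h1 := d.slidTop_pos hj
  constructor
  · rw [kPromotion, if_pos (mem_rectDiagram.mpr ⟨by omega, hj⟩)]
    have e2 : slideState n (T 0) (T 1) j₀ j₁ (2 * n) 0 j = slidTop (T 0) (T 1) j₀ j := by
      rw [slideState, if_neg (by omega), if_pos rfl, if_pos (by omega)]
    rw [e, d.iterate, hcard, e2, if_neg h1.ne']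
  · rw [kPromotion, if_pos (mem_rectDiagram.mpr ⟨by omega, hj⟩)]
    have e2 : slideState n (T 0) (T 1) j₀ j₁ (2 * n) 1 j = slidBottom n (T 1) j₁ j := by
      rw [slideState, if_neg (by omega), if_neg (by omega), if_pos rfl]
      split_ifs with h2 h3
      · rfl
      · rw [slidBottom, if_neg (by omega), if_neg (by omega)]
      · omega
    rw [e, d.iterate, hcard, e2]

end Slide

/-! ### K-promotion is rotation. -/

section Promotion

variable {N n : ℕ} {h h' : ℤ → ℤ} {T : ℕ → ℕ → ℕ}

/-- The arcs of a nonnegative walk that start at the two halves of its first step. -/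
theorem IsWalk.exists_first_arcs (hh : IsWalk N h) (h0 : ∀ p, 0 ≤ doubled h p) :
    ∃ x₀ x₁ : ℕ, (1 ≤ x₀ ∧ x₀ < N) ∧ (1 ≤ x₁ ∧ x₁ < N) ∧
      IsArc (doubled h) 0 (2 * x₀ + 1) ∧ IsArc (doubled h) 1 (2 * x₁) := by
  have hU := hh.isUnitWalk
  have hN := hh.pos
  have d0 : doubled h 0 = 0 := by simpa using hh.doubled_mul 0
  have dN : doubled h (2 * N) = 0 := by simpa using hh.doubled_mul 1
  have s0 : doubled h (0 + 1) = doubled h 0 + 1 := by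
    have := hU.step 0
    have := h0 (0 + 1)
    omega
  have u1 : h (0 + 1) = h 0 + 1 := (doubled_up_even h 0).mp (by simpa using s0)
  have hz := hh.zero
  have s1 : doubled h (1 + 1) = doubled h 1 + 1 := by
    have := (hh.doubled_up_odd 0).mpr (by omega)
    simpa using this
  rw [zero_add] at s0
  obtain ⟨q0, a0⟩ := hU.exists_arc_of_up (p := 0) (by simpa using s0)
  obtain ⟨q1, a1⟩ := hU.exists_arc_of_up s1
  have o0 := a0.odd hU
  have o1 := a1.odd hU
  have l0 := a0.lt_add hU.periodic hU.pos
  have l1 := a1.lt_add hU.periodic hU.pos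
  have g0 := a0.1
  have g1 := a1.1
  have n0 : q0 ≠ 1 := by
    rintro rfl
    have := a0.2.1
    omega
  have n1 : q1 ≠ 2 * N := by
    rintro rfl
    have := a1.2.2 _ g1 le_rfl
    omega
  refine ⟨((q0 - 1) / 2).toNat, (q1 / 2).toNat, ⟨by omega, by omega⟩, ⟨by omega, by omega⟩, ?_, ?_⟩
  · convert a0 using 1; omega
  · convert a1 using 1; omega

theorem IsWalk.mem_topRow_iff (hh : IsWalk N h) (h0 : ∀ p, 0 ≤ doubled h p) {x : ℕ} :
    x ∈ topRow N h ↔ (1 ≤ x ∧ x ≤ N) ∧ arcMap (doubled h) N (2 * x - 1) < 2 * N := by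
  rw [mem_topRow]
  refine and_congr_right fun hx => ?_
  have h1 := hh.doubled_up_odd (x - 1)
  have h2 := hh.doubled_up_iff_of_nonneg h0 (p := 2 * x - 1) (by omega) (by omega)
  rw [show 2 * ((x : ℤ) - 1) + 1 = 2 * x - 1 by ring, sub_add_cancel (x : ℤ) 1] at h1
  exact h1.symm.trans h2

theorem IsWalk.mem_bottomRow_iff (hh : IsWalk N h) (h0 : ∀ p, 0 ≤ doubled h p) {x : ℕ} :
    x ∈ bottomRow N h ↔ (1 ≤ x ∧ x ≤ N) ∧ 2 * N ≤ arcMap (doubled h) N (2 * x - 2) := by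
  rw [mem_bottomRow]
  refine and_congr_right fun hx => ?_
  have h1 := doubled_up_even h (x - 1)
  have h2 := hh.doubled_up_iff_of_nonneg h0 (p := 2 * x - 2) (by omega) (by omega)
  rw [show 2 * ((x : ℤ) - 1) + 1 = 2 * x - 2 + 1 by ring, sub_add_cancel (x : ℤ) 1,
    show 2 * ((x : ℤ) - 1) = 2 * x - 2 by ring] at h1
  rw [← not_lt]
  exact not_congr (h1.symm.trans h2)

section Rotation

variable {x₀ x₁ : ℕ}

/-- A label is in the top row when the odd point of its step is an opening one. Rotation moves the
window by two points, so only the partners of the points 0 and 1 can change status. The partner 2x₀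
+ 1 of 0 is odd and becomes opening. -/
theorem IsWalk.mem_topRow_rotate (hh : IsWalk N h) (h0 : ∀ p, 0 ≤ doubled h p)
    (hh' : IsWalk N h') (h0' : ∀ p, 0 ≤ doubled h' p)
    (hF : ∀ p, arcMap (doubled h') N p = arcMap (doubled h) N (p + 2) - 2)
    (hx₀ : 1 ≤ x₀ ∧ x₀ < N) (hx₁ : 1 ≤ x₁ ∧ x₁ < N) (e0 : arcMap (doubled h) N 0 = 2 * x₀ + 1)
    (e1 : arcMap (doubled h) N 1 = 2 * x₁) (x : ℕ) :
    x ∈ topRow N h' ↔ (1 ≤ x ∧ x + 1 ∈ topRow N h) ∨ x = x₀ := by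
  have hM := hh.arcMap_isMatching_of_nonneg h0
  have p0 := hM.add_period 0
  have p1 := hM.add_period 1
  rw [hh'.mem_topRow_iff h0', hh.mem_topRow_iff h0, hF]
  push_cast
  rw [show 2 * (x : ℤ) - 1 + 2 = 2 * x + 1 by ring, show 2 * ((x : ℤ) + 1) - 1 = 2 * x + 1 by ring]
  constructor
  · rintro ⟨⟨hx1, hxN⟩, hlt⟩
    by_cases hx : x = N
    · subst hx
      rw [show 2 * (x : ℤ) + 1 = 1 + 2 * x by ring] at hlt
      omega
    · by_cases hl : arcMap (doubled h) N (2 * x + 1) < 2 * N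
      · exact Or.inl ⟨hx1, ⟨trivial, by omega⟩, hl⟩
      · right
        rcases (show arcMap (doubled h) N (2 * x + 1) = 0 + 2 * N ∨
          arcMap (doubled h) N (2 * x + 1) = 1 + 2 * N by omega) with e | e
        · have := hM.invol (2 * x + 1)
          rw [e, p0] at this
          omega
        · have := hM.invol (2 * x + 1)
          rw [e, p1] at this
          omega
  · rintro (⟨h1, ⟨h2, h3⟩, h4⟩ | rfl)
    · exact ⟨⟨by omega, by omega⟩, by omega⟩
    · have := hM.invol 0
      rw [e0] at this
      exact ⟨⟨by omega, by omega⟩, by omega⟩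

/-- The bottom row reads the even points. The partner 2x₁ of 1 is even and becomes opening, so x₁
drops out; the point 0 reappears at the end of the window as a closing one, which adds N. -/
theorem IsWalk.mem_bottomRow_rotate (hh : IsWalk N h) (h0 : ∀ p, 0 ≤ doubled h p)
    (hh' : IsWalk N h') (h0' : ∀ p, 0 ≤ doubled h' p)
    (hF : ∀ p, arcMap (doubled h') N p = arcMap (doubled h) N (p + 2) - 2)
    (hx₀ : 1 ≤ x₀ ∧ x₀ < N) (hx₁ : 1 ≤ x₁ ∧ x₁ < N) (e0 : arcMap (doubled h) N 0 = 2 * x₀ + 1)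
    (e1 : arcMap (doubled h) N 1 = 2 * x₁) (x : ℕ) :
    x ∈ bottomRow N h' ↔ (1 ≤ x ∧ x + 1 ∈ bottomRow N h ∧ x ≠ x₁) ∨ x = N := by
  have hM := hh.arcMap_isMatching_of_nonneg h0
  have p0 := hM.add_period 0
  have p1 := hM.add_period 1
  have i1 := hM.invol 1
  rw [e1] at i1
  rw [hh'.mem_bottomRow_iff h0', hh.mem_bottomRow_iff h0, hF]
  push_cast
  rw [show 2 * (x : ℤ) - 2 + 2 = 2 * x by ring, show 2 * ((x : ℤ) + 1) - 2 = 2 * x by ring]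
  have hodd := hM.odd hh.pos (2 * x)
  constructor
  · rintro ⟨⟨hx1, hxN⟩, hlt⟩
    by_cases hx : x = N
    · exact Or.inr hx
    · refine Or.inl ⟨hx1, ⟨⟨trivial, by omega⟩, by omega⟩, ?_⟩
      rintro rfl
      omega
  · rintro (⟨h1, ⟨⟨h2, h3⟩, h4⟩, h5⟩ | rfl)
    · refine ⟨⟨by omega, by omega⟩, ?_⟩
      by_contra hlt
      have e : arcMap (doubled h) N (2 * x) = 1 + 2 * N := by omega
      have := hM.invol (2 * x)
      rw [e, p1] at this
      omega
    · rw [zero_add] at p0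
      exact ⟨⟨by omega, le_rfl⟩, by omega⟩

end Rotation

/-- Comparing T 0 (i + 1) with T 1 i amounts to asking for the height around the label T 1 i. The
hole leaves the top row at the first return of h to 0, where the arc from 0 ends. It enters the
bottom row where the doubled walk first returns to 1, at the end of the arc from 1. -/
theorem Represents.exists_slideData (hr : Represents n N T h) (hh : IsWalk N h)
    (hcol : ∀ j < n, T 0 j < T 1 j) {x₀ x₁ : ℕ}
    (hx₀ : 1 ≤ x₀ ∧ x₀ < N) (hx₁ : 1 ≤ x₁ ∧ x₁ < N)
    (a0 : IsArc (doubled h) 0 (2 * x₀ + 1)) (a1 : IsArc (doubled h) 1 (2 * x₁)) :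
    ∃ j₀ j₁, SlideData n (T 0) (T 1) j₀ j₁ ∧ T 1 j₀ = x₀ + 1 ∧ T 1 j₁ = x₁ + 1 := by
  obtain ⟨hα, hβ⟩ := hr
  have hU := hh.isUnitWalk
  have hz := hh.zero
  have d0 : doubled h 0 = 0 := by simpa using hh.doubled_mul 0
  have d1 : doubled h 1 = 1 := by
    have := a0.up hU
    rw [zero_add] at this
    omega
  have h1 : h 1 = 1 := by
    have := (doubled_up_even h 0).mp (by simpa [d0] using d1)
    rw [zero_add] at this
    omega
  have f0 : h (x₀ + 1) = 0 := by
    have := a0.2.1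
    rw [doubled_two_mul_add_two] at this
    omega
  have f1 : ∀ t : ℤ, 0 < t → t ≤ x₀ → 1 ≤ h t := fun t ht ht' => by
    have := a0.2.2 (2 * t) (by omega) (by omega)
    rw [doubled_even] at this
    omega
  have g0 : doubled h (2 * x₁ + 1) = 1 := by rw [a1.2.1, d1]
  have g2 : ∀ t : ℤ, 0 < t → t ≤ x₁ → 1 ≤ h t := fun t ht ht' => by
    have := a1.2.2 (2 * t) (by omega) (by omega)
    rw [doubled_even] at this
    omega
  have g3 : h (x₁ + 1) ≠ h x₁ + 1 ∧ h x₁ = 1 := by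
    have := g2 x₁ (by omega) le_rfl
    rw [doubled_odd] at g0
    split_ifs at g0 with hs
    · omega
    · exact ⟨hs, by omega⟩
  have g4 : ∀ t : ℤ, 0 < t → t < x₁ → h (t + 1) ≠ h t + 1 → 2 ≤ h t := fun t ht ht' hs => by
    have := a1.2.2 (2 * t + 1) (by omega) (by omega)
    rw [doubled_odd, if_neg hs] at this
    omega
  have m0 : x₀ + 1 ∈ bottomRow N h := by
    rw [mem_bottomRow]
    have := f1 x₀ (by omega) le_rfl
    push_cast
    rw [add_sub_cancel_right, f0]
    exact ⟨⟨trivial, by omega⟩, by omega⟩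
  have m1 : x₁ + 1 ∈ bottomRow N h := by
    rw [mem_bottomRow]
    push_cast
    rw [add_sub_cancel_right]
    exact ⟨⟨trivial, by omega⟩, g3.1⟩
  obtain ⟨j₀, hj₀, e0⟩ := (hβ.mem _).mp m0
  obtain ⟨j₁, hj₁, e1⟩ := (hβ.mem _).mp m1
  have hle_exit : ∀ i < j₀, i + 1 < n ∧ T 0 (i + 1) < T 1 i + 1 := fun i hi => by
    have hm := hβ.mono i j₀ hi hj₀
    have hy := (mem_bottomRow.mp ((hβ.mem _).mpr ⟨i, by omega, rfl⟩)).1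
    have hc := hh.card_rows (T 1 i) hy.2
    rw [hβ.card_filter_lt_succ (by omega)] at hc
    have := f1 (T 1 i) (by omega) (by omega)
    exact hα.lt_iff.mpr (by omega)
  have hlt_exit : ∀ i, i ≤ j₀ → ¬ (j₀ + 1 < n ∧ T 0 (j₀ + 1) < T 1 j₀ + 1) := fun i _ hi => by
    have hc := hh.card_rows (x₀ + 1) (by omega)
    rw [← e0, hβ.card_filter_lt_succ hj₀, e0] at hc
    have := hα.lt_iff.mp hi
    rw [e0] at this
    push_cast at hc
    omega
  have hlt_entry : ∀ i < j₁, i + 1 < n ∧ T 0 (i + 1) < T 1 i := fun i hi => by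
    have hm := hβ.mono i j₁ hi hj₁
    obtain ⟨hy, hs⟩ := mem_bottomRow.mp ((hβ.mem _).mpr ⟨i, by omega, rfl⟩)
    have hc := hh.card_rows (T 1 i - 1) (by omega)
    rw [show T 1 i - 1 + 1 = T 1 i by omega, hβ.card_filter_lt (by omega), Nat.cast_sub hy.1,
      Nat.cast_one] at hc
    have hne : T 1 i ≠ 1 := by
      intro e
      rw [e] at hs
      simp only [Nat.cast_one, sub_self] at hs
      omega
    have := g4 ((T 1 i : ℤ) - 1) (by omega) (by omega) (by rwa [sub_add_cancel])
    exact hα.lt_iff.mpr (by omega)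
  have hle_entry : ¬ (j₁ + 1 < n ∧ T 0 (j₁ + 1) < T 1 j₁) := fun hi => by
    have hc := hh.card_rows x₁ (by omega)
    rw [← e1, hβ.card_filter_lt hj₁, e1] at hc
    have := hα.lt_iff.mp hi
    rw [e1] at this
    omega
  refine ⟨j₀, j₁, ⟨hα.mono, hβ.mono, hcol, ?_, ?_, hj₀, fun i hi => ?_, fun hj => ?_,
    fun i hi => (hlt_entry i hi).2, fun hj => ?_⟩, e0, e1⟩
  · have m : 1 ∈ topRow N h := by
      rw [mem_topRow]
      simp only [Nat.cast_one, sub_self]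
      omega
    obtain ⟨j, hj, e⟩ := (hα.mem _).mp m
    rcases Nat.eq_zero_or_pos j with rfl | hj0
    · exact e
    · have := hα.mono 0 j hj0 hj
      have := (mem_topRow.mp ((hα.mem _).mpr ⟨0, by omega, rfl⟩)).1
      omega
  · by_contra hlt
    have := hlt_entry j₀ (by omega)
    exact hlt_exit j₀ le_rfl ⟨this.1, by omega⟩
  · have := (hle_exit i hi).2
    omega
  · by_contra hlt
    exact hlt_exit j₀ le_rfl ⟨hj, by omega⟩
  · by_contra hlt
    exact hle_entry ⟨hj, by omega⟩

theorem SlideData.isEnum_top {α β : ℕ → ℕ} {j₀ j₁ : ℕ} (d : SlideData n α β j₀ j₁)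
    {A A' : Finset ℕ} (hα : IsEnum α n A) {x₀ : ℕ} (e0 : β j₀ = x₀ + 1)
    (hA : ∀ x, x ∈ A' ↔ (1 ≤ x ∧ x + 1 ∈ A) ∨ x = x₀) :
    IsEnum (fun j => slidTop α β j₀ j - 1) n A' := by
  have hlt := d.lt
  have hcol := d.col j₀ hlt
  have h1 : ∀ j, 0 < j → j < n → 1 < α j := fun j hj hj' => d.first ▸ d.top_mono 0 j hj hj'
  have hp0 := d.top_pos hlt
  have hmono : ∀ i j, i < j → j < n → slidTop α β j₀ i < slidTop α β j₀ j := by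
    intro i j hij hj
    have m1 : ∀ i' j', i' < j' → j' < n → α i' < α j' := d.top_mono
    rw [slidTop, slidTop]
    split_ifs with a b c d' e' f' <;> try omega
    · exact m1 _ _ (by omega) (by omega)
    · rcases (show i + 1 ≤ j₀ by omega).lt_or_eq with h | h
      · exact (m1 _ _ h hlt).trans hcol
      · rwa [h]
    · exact m1 _ _ (by omega) (by omega)
    · have h2 := d.lt_at_exit (by omega)
      rcases (show j₀ + 1 ≤ j by omega).lt_or_eq with h | h
      · exact h2.trans (m1 _ _ h hj)
      · rwa [← h]
    · exact m1 _ _ hij hj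
  refine ⟨fun i j hij hj => ?_, fun x => ?_⟩
  · have := hmono i j hij hj
    have := d.slidTop_pos (show i < n by omega)
    omega
  · rw [hA, hα.mem]
    constructor
    · rintro (⟨hx, i, hi, e⟩ | rfl)
      · have hi0 : i ≠ 0 := by
          rintro rfl
          have := d.first
          omega
        by_cases h : i ≤ j₀
        · refine ⟨i - 1, by omega, ?_⟩
          rw [slidTop, if_pos (by omega), show i - 1 + 1 = i by omega]
          omega
        · refine ⟨i, hi, ?_⟩
          rw [slidTop, if_neg (by omega), if_neg (by omega)]
          omega
      · refine ⟨j₀, hlt, ?_⟩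
        rw [slidTop, if_neg (by omega), if_pos rfl]
        omega
    · rintro ⟨j, hj, e⟩
      rw [slidTop] at e
      split_ifs at e with h2 h3
      · have := h1 (j + 1) (by omega) (by omega)
        exact Or.inl ⟨by omega, j + 1, by omega, by omega⟩
      · exact Or.inr (by omega)
      · have := h1 j (by omega) hj
        exact Or.inl ⟨by omega, j, hj, by omega⟩

theorem SlideData.isEnum_bottom {α β : ℕ → ℕ} {j₀ j₁ : ℕ} (d : SlideData n α β j₀ j₁)
    {A A' : Finset ℕ} (hβ : IsEnum β n A) {x₁ : ℕ} (e1 : β j₁ = x₁ + 1) (hAN : ∀ x ∈ A, x ≤ N)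
    (hA : ∀ x, x ∈ A' ↔ (1 ≤ x ∧ x + 1 ∈ A ∧ x ≠ x₁) ∨ x = N) :
    IsEnum (fun j => (if slidBottom n β j₁ j = 0 then N + 1 else slidBottom n β j₁ j) - 1) n A' := by
  have hlt := d.lt
  have hle := d.le
  have hval : ∀ j < n, (if slidBottom n β j₁ j = 0 then N + 1 else slidBottom n β j₁ j) =
      if j < j₁ then β j else if j + 1 < n then β (j + 1) else N + 1 := by
    intro j hj
    rw [slidBottom]
    have := d.bottom_pos hj
    by_cases h : j + 1 < n
    · have := d.bottom_pos h
      split_ifs <;> omega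
    · split_ifs <;> omega
  have hbN : ∀ j < n, β j ≤ N := fun j hj => hAN _ ((hβ.mem _).mpr ⟨j, hj, rfl⟩)
  have hb2 : ∀ j < n, 2 ≤ β j := fun j hj => by
    have := d.col j hj
    have := d.top_pos hj
    omega
  refine ⟨fun i j hij hj => ?_, fun x => ?_⟩
  · rw [hval i (by omega), hval j hj]
    have := hb2 i (by omega)
    have := hbN i (by omega)
    have m1 := d.bottom_mono i j hij hj
    have m2 := d.bottom_mono i (i + 1) (by omega) (by omega)
    have := hb2 (i + 1) (by omega)
    have := hbN (i + 1) (by omega)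
    by_cases h : j + 1 < n
    · have m3 := d.bottom_mono j (j + 1) (by omega) h
      have m4 := d.bottom_mono (i + 1) (j + 1) (by omega) h
      split_ifs <;> omega
    · split_ifs <;> omega
  · rw [hA, hβ.mem]
    constructor
    · rintro (⟨hx, ⟨i, hi, e⟩, hne⟩ | rfl)
      · have hi1 : i ≠ j₁ := by
          rintro rfl
          omega
        by_cases h : i < j₁
        · refine ⟨i, hi, ?_⟩
          rw [hval i hi, if_pos h]
          omega
        · refine ⟨i - 1, by omega, ?_⟩
          rw [hval (i - 1) (by omega), if_neg (by omega), if_pos (by omega),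
            show i - 1 + 1 = i by omega]
          omega
      · refine ⟨n - 1, by omega, ?_⟩
        rw [hval (n - 1) (by omega), if_neg (by omega), if_neg (by omega)]
        omega
    · rintro ⟨j, hj, e⟩
      rw [hval j hj] at e
      split_ifs at e with h2 h3
      · have := hb2 j hj
        have := d.bottom_mono j j₁ h2 (by omega)
        exact Or.inl ⟨by omega, ⟨j, hj, by omega⟩, by omega⟩
      · have := hb2 (j + 1) h3
        have := d.bottom_mono j₁ (j + 1) (by omega) h3
        exact Or.inl ⟨by omega, ⟨j + 1, h3, by omega⟩, by omega⟩
      · exact Or.inr (by omega)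

/-- K-promotion corresponds to the rotation of the matching. -/
theorem Represents.kPromotion {T : IncreasingTableau (rectDiagram 2 n) N}
    (hr : Represents n N T.entry h) (hh : IsWalk N h) (h0 : ∀ p, 0 ≤ doubled h p)
    (hh' : IsWalk N h') (h0' : ∀ p, 0 ≤ doubled h' p)
    (hF : ∀ p, arcMap (doubled h') N p = arcMap (doubled h) N (p + 2) - 2) :
    Represents n N (kPromotion (rectDiagram 2 n) N T.entry) h' := by
  obtain ⟨x₀, x₁, hx₀, hx₁, a0, a1⟩ := hh.exists_first_arcs h0
  have e0 : arcMap (doubled h) N 0 = 2 * x₀ + 1 := a0.arcMap_left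
  have e1 : arcMap (doubled h) N 1 = 2 * x₁ := a1.arcMap_left
  obtain ⟨j₀, j₁, d, f0, f1⟩ := hr.exists_slideData hh
    (fun j hj => T.col_strict' zero_lt_one (mem_rectDiagram.mpr ⟨one_lt_two, hj⟩)) hx₀ hx₁ a0 a1
  have hk := fun j (hj : j < n) => d.kPromotion_eq (fun i j hm => T.zeros' hm) N hj
  have t0 := d.isEnum_top hr.1 f0 (hh.mem_topRow_rotate h0 hh' h0' hF hx₀ hx₁ e0 e1)
  have t1 := d.isEnum_bottom (N := N) hr.2 f1 (fun x hx => (mem_bottomRow.mp hx).1.2)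
    (hh.mem_bottomRow_rotate h0 hh' h0' hF hx₀ hx₁ e0 e1)
  constructor
  · refine ⟨fun i j hij hj => ?_, fun x => ?_⟩
    · rw [(hk i (hij.trans hj)).1, (hk j hj).1]
      exact t0.mono i j hij hj
    · rw [t0.mem]
      exact exists_congr fun j => and_congr_right fun hj => by rw [(hk j hj).1]
  · refine ⟨fun i j hij hj => ?_, fun x => ?_⟩
    · rw [(hk i (hij.trans hj)).2, (hk j hj).2]
      exact t1.mono i j hij hj
    · rw [t1.mem]
      exact exists_congr fun j => and_congr_right fun hj => by rw [(hk j hj).2]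

end Promotion

/-! ### The rotation action of the cyclic group. -/

section Rotation

variable {N : ℕ} {F : ℤ → ℤ}

/-- Rotation of a lifted matching by `2 m` points. -/
def rotate (m : ℤ) (F : ℤ → ℤ) (p : ℤ) : ℤ := F (p + 2 * m) - 2 * m

theorem IsMatching.rotate (hF : IsMatching N F) (m : ℤ) : IsMatching N (rotate m F) where
  lt p := by
    have := hF.lt (p + 2 * m)
    rw [_root_.rotate]; omega
  invol p := by
    rw [_root_.rotate, _root_.rotate, sub_add_cancel, hF.invol]; ring
  noncrossing p q h1 h2 := by
    rw [_root_.rotate] at *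
    have := hF.noncrossing (p + 2 * m) (q + 2 * m) (by omega) (by omega)
    rw [_root_.rotate]
    omega
  ne i := by
    have := hF.ne (i + m)
    rw [mul_add] at this
    rw [_root_.rotate]; omega

theorem blockCount_rotate (m : ℤ) : blockCount N (rotate m F) 0 = blockCount N F m := by
  refine Finset.card_bij (fun x _ => x + m) ?_ ?_ ?_
  · intro x hx
    simp only [Finset.mem_filter, Finset.mem_Ico] at hx ⊢
    rw [rotate] at hx
    rw [mul_add]
    omega
  · intro x _ y _ h; omega
  · intro x hx
    simp only [Finset.mem_filter, Finset.mem_Ico] at hx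
    refine ⟨x - m, ?_, by omega⟩
    simp only [Finset.mem_filter, Finset.mem_Ico]
    rw [rotate, show 2 * (x - m) + 2 * m = 2 * x by ring]
    omega

/-- The translations by even numbers that commute with `F`. -/
def halfPeriods (F : ℤ → ℤ) : AddSubgroup ℤ where
  carrier := {m | ∀ p, F (p + 2 * m) = F p + 2 * m}
  zero_mem' p := by simp
  add_mem' {a b} ha hb p := by
    rw [show p + 2 * (a + b) = p + 2 * a + 2 * b by ring, hb, ha]; ring
  neg_mem' {a} ha p := by
    have := ha (p + 2 * -a)
    rw [show p + 2 * -a + 2 * a = p by ring] at this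
    omega

theorem mem_halfPeriods {m : ℤ} : m ∈ halfPeriods F ↔ ∀ p, F (p + 2 * m) = F p + 2 * m := Iff.rfl

theorem rotate_eq_self_iff {m : ℤ} : rotate m F = F ↔ m ∈ halfPeriods F := by
  rw [mem_halfPeriods, funext_iff]
  refine forall_congr' fun p => ?_
  rw [rotate, sub_eq_iff_eq_add]

theorem rotate_rotate (a b : ℤ) (F : ℤ → ℤ) : rotate a (rotate b F) = rotate (a + b) F := by
  funext p
  simp only [rotate]
  rw [show p + 2 * a + 2 * b = p + 2 * (a + b) by ring]
  ring

/-- The half periods form a subgroup of ℤ containing N, so Bézout reduces any rotation to one by a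
divisor of N. -/
theorem IsMatching.mem_halfPeriods_iff_gcd (hF : IsMatching N F) (m : ℤ) :
    m ∈ halfPeriods F ↔ (Int.gcd m N : ℤ) ∈ halfPeriods F := by
  have hN : (N : ℤ) ∈ halfPeriods F := hF.add_period
  constructor
  · intro hm
    rw [Int.gcd_eq_gcd_ab, mul_comm m, mul_comm (N : ℤ)]
    exact add_mem (zsmul_mem hm _) (zsmul_mem hN _)
  · intro hg
    obtain ⟨w, hw⟩ := Int.gcd_dvd_left m N
    rw [hw, mul_comm]
    exact zsmul_mem hg w

theorem IsMatching.rotate_congr (hF : IsMatching N F) {a b : ℤ} (h : (a : ZMod N) = b) :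
    _root_.rotate a F = _root_.rotate b F := by
  obtain ⟨w, hw⟩ := (ZMod.intCast_eq_intCast_iff_dvd_sub a b N).mp h
  have hN : (N : ℤ) ∈ halfPeriods F := hF.add_period
  have h1 : w * N ∈ halfPeriods F := zsmul_mem hN w
  rw [show b = a + w * N by rw [mul_comm]; omega, ← rotate_rotate, rotate_eq_self_iff.mpr h1]

/-- Matchings with `b` blocks. -/
def BlockMatching (N b : ℕ) : Type := {F : ℤ → ℤ // IsMatching N F ∧ blockCount N F 0 = b}

/-- Rotation of matchings as an action of the cyclic group of order `N`. -/
noncomputable abbrev rotationAction (b : ℕ) (hN : 0 < N) :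
    MulAction (Multiplicative (ZMod N)) (BlockMatching N b) where
  smul z F := ⟨rotate ((Multiplicative.toAdd z).cast : ℤ) F.1, F.2.1.rotate _, by
    rw [blockCount_rotate, F.2.1.blockCount_eq hN, F.2.2]⟩
  one_smul F := Subtype.ext <| by
    change rotate ((0 : ZMod N).cast : ℤ) F.1 = F.1
    rw [ZMod.cast_zero, rotate_eq_self_iff]
    exact zero_mem _
  mul_smul z w F := Subtype.ext <| by
    change rotate ((Multiplicative.toAdd z + Multiplicative.toAdd w : ZMod N).cast : ℤ) F.1 =
      rotate ((Multiplicative.toAdd z).cast : ℤ) (rotate ((Multiplicative.toAdd w).cast : ℤ) F.1)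
    rw [rotate_rotate]
    exact F.2.1.rotate_congr (by simp)

theorem rotationAction_smul (b : ℕ) (hN : 0 < N) (z : ℤ) (F : BlockMatching N b) :
    letI := rotationAction b hN
    (Multiplicative.ofAdd (z : ZMod N) • F).1 = rotate z F.1 :=
  F.2.1.rotate_congr (ZMod.intCast_zmod_cast _)

end Rotation

/-! ### Tableaux and matchings with a given number of blocks. -/

section Bijection

variable {N n b : ℕ} {h h' : ℤ → ℤ}

theorem IsWalk.eq_of_arcMap_eq (hh : IsWalk N h) (h0 : ∀ p, 0 ≤ doubled h p) (hh' : IsWalk N h')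
    (h0' : ∀ p, 0 ≤ doubled h' p) (e : arcMap (doubled h) N = arcMap (doubled h') N) : h = h' :=
  hh.ext hh' fun p hp hp' => by
    rw [hh.doubled_up_iff_of_nonneg h0 hp hp', hh'.doubled_up_iff_of_nonneg h0' hp hp', e]

/-- Increasing tableaux with two rows correspond to noncrossing matchings, and K-promotion to
rotation. -/
theorem exists_equiv_blockMatching (hN : 0 < N) (hb : n + b = N) :
    ∃ e : IncreasingTableau (rectDiagram 2 n) N ≃ BlockMatching N b,
      ∀ T T', (e T').1 = rotate 1 (e T).1 → T'.entry = kPromotion (rectDiagram 2 n) N T.entry := by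
  choose w hw w0 hwb hwr using fun T : IncreasingTableau (rectDiagram 2 n) N => T.exists_walk hN
  let f : IncreasingTableau (rectDiagram 2 n) N → BlockMatching N b := fun T =>
    ⟨arcMap (doubled (w T)) N, (hw T).arcMap_isMatching_of_nonneg (w0 T), by
      rw [(hw T).blockCount_arcMap_of_nonneg (w0 T)]
      have := hwb T
      omega⟩
  have hf : Function.Bijective f := by
    constructor
    · intro T T' e
      have h1 := (hw T).eq_of_arcMap_eq (w0 T) (hw T') (w0 T') (congrArg Subtype.val e)
      have h2 := hwr T'
      rw [← h1] at h2
      exact IncreasingTableau.ext_entry ((hwr T).entry_eq h2 fun i j hm => T'.zeros' hm)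
    · rintro ⟨F, hF, hFb⟩
      obtain ⟨h, hh, h0, rfl⟩ := hF.exists_nonneg_walk hN
      rw [hh.blockCount_arcMap_of_nonneg h0] at hFb
      obtain ⟨T, hT⟩ := exists_tableau hh h0 (n := n) (by omega)
      refine ⟨T, Subtype.ext ?_⟩
      change arcMap (doubled (w T)) N = _
      rw [(hwr T).unique (hw T) hh hT]
  refine ⟨Equiv.ofBijective f hf, fun T T' e => ?_⟩
  refine (hwr T').entry_eq ((hwr T).kPromotion (hw T) (w0 T) (hw T') (w0 T') fun p => ?_)
    fun i j hm => ?_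
  · exact congrFun e p
  · rw [kPromotion, if_neg hm]

theorem IncreasingTableau.finite (n N : ℕ) : Finite (IncreasingTableau (rectDiagram 2 n) N) := by
  have hlt : ∀ (T : IncreasingTableau (rectDiagram 2 n) N) (i : Fin 2) (j : Fin n),
      T.entry i j < N + 1 := fun T i j => by
    have h1 : T.entry i j ∈ {v : ℕ | ∃ i j : ℕ, (i, j) ∈ rectDiagram 2 n ∧ T.entry i j = v} :=
      ⟨i, j, mem_rectDiagram.mpr ⟨i.2, j.2⟩, rfl⟩
    rw [T.entries_eq'] at h1
    exact Nat.lt_succ_of_le h1.2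
  refine Finite.of_injective (β := Fin 2 → Fin n → Fin (N + 1))
    (fun T i j => ⟨T.entry i j, hlt T i j⟩) fun T T' e => ?_
  refine IncreasingTableau.ext_entry ?_
  funext i j
  by_cases hm : (i, j) ∈ rectDiagram 2 n
  · obtain ⟨hi, hj⟩ := mem_rectDiagram.mp hm
    have := congrFun (congrFun e ⟨i, hi⟩) ⟨j, hj⟩
    exact congrArg Fin.val this
  · exact (T.zeros' hm).trans (T'.zeros' hm).symm

end Bijection

/-! ### Counting symmetric matchings and comparing with the polynomial. -/

section Counting

variable {N b k d g : ℕ}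

/-- The number of matchings with `b` blocks. -/
theorem card_blockMatching (hN : 2 * b + k = N) (hN0 : 0 < N) :
    ({F | IsMatching N F ∧ blockCount N F 0 = b}.ncard : ℤ) = ballot 0 b b k := by
  rw [← wordCount_nonneg_noflat b b k le_rfl, ← card_walks hN0 hN _
    {h | IsWalk N h ∧ upCount N h = b ∧ ∀ p, 0 ≤ doubled h p}]
  · congr 1
    symm
    refine Set.ncard_congr (fun h _ => arcMap (doubled h) N) ?_ ?_ ?_
    · rintro h ⟨hh, hb, h0⟩
      exact ⟨hh.arcMap_isMatching_of_nonneg h0, by rw [hh.blockCount_arcMap_of_nonneg h0, hb]⟩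
    · rintro h h' ⟨hh, -, h0⟩ ⟨hh', -, h0'⟩ e
      exact hh.eq_of_arcMap_eq h0 hh' h0' e
    · rintro F ⟨hF, hFb⟩
      obtain ⟨h, hh, h0, rfl⟩ := hF.exists_nonneg_walk hN0
      rw [hh.blockCount_arcMap_of_nonneg h0] at hFb
      exact ⟨h, ⟨hh, hFb, h0⟩, rfl⟩
  · intro h
    rw [Set.mem_ofPred_eq]
    refine and_congr_right fun hh => and_congr_right fun _ => ?_
    exact hh.nonneg_iff.symm

open Classical in
/-- Matchings with rotational symmetry correspond to walks with a shorter period. -/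
theorem card_symmetric (hg : 0 < g) (hd : 2 ≤ d) :
    {F | (IsMatching (d * g) F ∧ blockCount (d * g) F 0 = b) ∧ (g : ℤ) ∈ halfPeriods F}.ncard =
      {h | IsWalk g h ∧ (d * upCount g h + if HasFlatAtMin h then 1 else 0) = b}.ncard := by
  have hgN : 2 * g ≤ d * g := Nat.mul_le_mul_right g hd
  symm
  refine Set.ncard_congr (fun h _ => arcMap (doubled h) (d * g)) ?_ ?_ ?_
  · rintro h ⟨hh, hb⟩
    exact ⟨⟨hh.arcMap_isMatching_of_dvd hgN (dvd_mul_left g d), by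
      rw [hh.blockCount_arcMap hd, hb]⟩, hh.arcMap_add⟩
  · rintro h h' ⟨hh, -⟩ ⟨hh', -⟩ e
    -- The matching determines the up steps: they are the points whose partner is less than 2g away.
    refine hh.ext hh' fun p _ _ => ?_
    rw [hh.doubled_up_iff hgN, hh'.doubled_up_iff hgN]
    exact (congrFun e p) ▸ Iff.rfl
  · rintro F ⟨⟨hF, hFb⟩, hFg⟩
    obtain ⟨h, hh, rfl⟩ := hF.exists_periodic_walk hg hgN hFg
    rw [hh.blockCount_arcMap hd] at hFb
    exact ⟨h, ⟨hh, hFb⟩, rfl⟩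

/-- The number of matchings with rotational symmetry is the value of the sieving polynomial at a
primitive root of unity. -/
theorem card_symmetric_eq_aeval {ω : ℂ} (hω : IsPrimitiveRoot ω d) (hg : 0 < g)
    (hN : 2 * (b + 1) + k = d * g) :
    ({F | (IsMatching (d * g) F ∧ blockCount (d * g) F 0 = b + 1) ∧
      (g : ℤ) ∈ halfPeriods F}.ncard : ℂ) = aeval ω (sievingNumerator b k) := by
  classical
  have hd0 : d ≠ 0 := by
    rintro rfl
    omega
  rcases (show d = 1 ∨ 2 ≤ d by omega) with rfl | hd
  · rw [IsPrimitiveRoot.one_right_iff.mp hω, aeval_sievingNumerator_one]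
    have e : {F | (IsMatching (1 * g) F ∧ blockCount (1 * g) F 0 = b + 1) ∧
        (g : ℤ) ∈ halfPeriods F} = {F | IsMatching (1 * g) F ∧ blockCount (1 * g) F 0 = b + 1} := by
      ext F
      refine and_iff_left_of_imp fun hF => ?_
      have := hF.1.add_period
      rwa [one_mul] at this
    have h1 := card_blockMatching hN (by omega)
    rw [e, ← Int.cast_natCast, h1, ballot]
    simp only [Nat.multichoose_eq, choosePred_add_one, add_zero, ← two_mul]
    push_cast
    rw [show b + 1 + k - 1 = b + k by omega, show b + 1 + 1 + k - 1 = b + 1 + k by omega]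
    ring
  · rw [card_symmetric hg hd]
    -- The number b+1 of blocks is a multiple of d, or one more, according to whether the walk has
    -- no flat step at its minimum or has one. Divisibility thus selects the words to be counted
    -- and, on the other side, the surviving term of the polynomial.
    by_cases h0 : d ∣ b + 1
    · obtain ⟨c, hc⟩ := h0
      have hcg : 2 * c ≤ g := by
        refine le_of_mul_le_mul_left (a := d) ?_ (by omega)
        rw [← hN, mul_left_comm, ← hc]
        omega
      obtain ⟨j, rfl⟩ := Nat.exists_eq_add_of_le hcg
      have hk : k = d * j := by
        rw [mul_add d, mul_left_comm, ← hc] at hN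
        omega
      rw [aeval_sievingNumerator_of_dvd hd hω hc hk, card_walks hg rfl (fun l => ¬ FlatAtMin l),
        wordCount_noflat, Nat.multichoose_eq]
      · push_cast; rfl
      · intro h
        rw [Set.mem_ofPred_eq]
        refine and_congr_right fun hh => ?_
        rw [hh.flatAtMin_iff, hc]
        split_ifs with hf
        · refine iff_of_false (fun e => ?_) (fun e => e.2 hf)
          have h1 : d ∣ 1 := (Nat.dvd_add_right (dvd_mul_right d _)).mp (e ▸ dvd_mul_right d c)
          have := Nat.le_of_dvd one_pos h1
          omega
        · rw [add_zero, Nat.mul_right_inj hd0]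
          exact (and_iff_left hf).symm
    · by_cases h1 : d ∣ b
      · obtain ⟨c, hc⟩ := h1
        have hcg : 2 * c < g := by
          refine Nat.lt_of_mul_lt_mul_left (a := d) ?_
          rw [← hN, mul_left_comm, ← hc]
          omega
        obtain ⟨j, rfl⟩ := Nat.exists_eq_add_of_lt hcg
        have hk : k + 2 = d * (j + 1) := by
          rw [add_assoc (2 * c), mul_add d, mul_left_comm, ← hc] at hN
          omega
        rw [aeval_sievingNumerator_of_dvd_pred hd hω hc hk,
          card_walks hg (add_assoc (2 * c) j 1).symm FlatAtMin, wordCount_flat, Nat.multichoose_eq,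
          show c + 1 + j - 1 = c + j by omega]
        · push_cast; rfl
        · intro h
          rw [Set.mem_ofPred_eq]
          refine and_congr_right fun hh => ?_
          rw [hh.flatAtMin_iff, hc]
          split_ifs with hf
          · rw [Nat.add_right_cancel_iff, Nat.mul_right_inj hd0]
            exact (and_iff_left hf).symm
          · refine iff_of_false (fun e => ?_) (fun e => hf e.2)
            rw [add_zero, ← hc] at e
            exact h0 ⟨_, e.symm⟩
      · rw [aeval_sievingNumerator_eq_zero hd hω ⟨g, hN⟩ h0 h1]
        rw [Nat.cast_eq_zero]
        refine (congrArg Set.ncard (Set.eq_empty_iff_forall_notMem.mpr ?_)).trans (Set.ncard_empty _)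
        rintro h ⟨-, e⟩
        split_ifs at e
        · exact h1 ⟨_, (Nat.add_right_cancel e).symm⟩
        · exact h0 ⟨_, e.symm⟩

end Counting

/-! ### Assembling the cyclic sieving phenomenon. -/

theorem IsPrimitiveRoot.zpow_gcd {ζ : ℂ} {N : ℕ} (hN : 0 < N) (hζ : IsPrimitiveRoot ζ N) (m : ℤ) :
    IsPrimitiveRoot (ζ ^ m) (N / Int.gcd m N) := by
  have hg : 0 < Int.gcd m N := Int.gcd_pos_of_ne_zero_right m (by omega)
  have hdvd : Int.gcd m N ∣ N := by
    have := Int.gcd_dvd_right m (N : ℤ)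
    exact_mod_cast this
  have h1 := hζ.pow hN (Nat.mul_div_cancel' hdvd).symm
  have h2 := h1.zpow_of_gcd_eq_one (m / Int.gcd m N) (by
    rw [Int.natCast_div]
    exact Int.gcd_div_gcd_div_gcd hg)
  rwa [← zpow_natCast, ← zpow_mul, Int.mul_ediv_cancel' (Int.gcd_dvd_left m N)] at h2

/-- The rotation action is transported to tableaux along the bijection, under which one rotation
step is K-promotion. Being fixed by c^m means having gcd(m, N) as a half period, and ζ^m has the
complementary order. -/
theorem exists_action_hasCyclicSieving {n b k N : ℕ} (hn : n = b + 1 + k) (hN : 2 * (b + 1) + k = N) :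
    ∃ _ : MulAction (Multiplicative (ZMod N)) (IncreasingTableau (rectDiagram 2 n) N),
      (∀ T : IncreasingTableau (rectDiagram 2 n) N,
        (Multiplicative.ofAdd (1 : ZMod N) • T).entry = kPromotion (rectDiagram 2 n) N T.entry) ∧
      HasCyclicSieving N (IncreasingTableau (rectDiagram 2 n) N) (sievingNumerator b k) := by
  have hN0 : 0 < N := by omega
  obtain ⟨e, he⟩ := exists_equiv_blockMatching (n := n) (b := b + 1) hN0 (by omega)
  let act := rotationAction (N := N) (b + 1) hN0
  have hsmul : ∀ (z : ℤ) (T : IncreasingTableau (rectDiagram 2 n) N),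
      (Multiplicative.ofAdd (z : ZMod N) • e T).1 = rotate z (e T).1 :=
    fun z T => rotationAction_smul (b + 1) hN0 z (e T)
  refine ⟨e.mulAction _, fun T => he T _ ?_, IncreasingTableau.finite n N, fun m ζ hζ => ?_⟩
  · have h1 := hsmul 1 T
    rw [Int.cast_one] at h1
    rw [← h1]
    exact congrArg Subtype.val (e.apply_symm_apply _)
  · have hg : 0 < Int.gcd m N := Int.gcd_pos_of_ne_zero_right m (by omega)
    have hdvd : Int.gcd m N ∣ N := by
      have := Int.gcd_dvd_right m (N : ℤ)
      exact_mod_cast this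
    have hdg := Nat.div_mul_cancel hdvd
    rw [← card_symmetric_eq_aeval (hζ.zpow_gcd hN0 m) hg (by rw [hdg, hN]), hdg]
    refine congrArg Nat.cast (Nat.card_congr ((e.subtypeEquiv fun T => ?_).trans
      (Equiv.subtypeSubtypeEquivSubtypeInter
        (fun F => IsMatching N F ∧ blockCount N F 0 = b + 1)
        (fun F => (Int.gcd m N : ℤ) ∈ halfPeriods F))))
    change e.symm (Multiplicative.ofAdd (1 : ZMod N) ^ m • e T) = T ↔ _
    rw [Equiv.symm_apply_eq, ← ofAdd_zsmul, zsmul_one, ← (e T).2.1.mem_halfPeriods_iff_gcd,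
      ← rotate_eq_self_iff, ← hsmul]
    exact Subtype.ext_iff

/-- A nonnegative doubled walk has to begin with an up step, so N exceeds n by at least 1. -/
theorem IncreasingTableau.isEmpty {n N : ℕ} (hN : 0 < N) (hn : N ≤ n) :
    IsEmpty (IncreasingTableau (rectDiagram 2 n) N) := by
  refine ⟨fun T => ?_⟩
  obtain ⟨h, hh, h0, hc, -⟩ := T.exists_walk hN
  have h1 : h (0 + 1) = h 0 + 1 := by
    by_contra hne
    have := one_le_height_of_nonneg h0 hne
    have := hh.zero
    omega
  have h2 : 0 < upCount N h :=
    Finset.card_pos.mpr ⟨0, Finset.mem_filter.mpr ⟨Finset.mem_range.mpr hN, by simpa using h1⟩⟩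
  omega

/-- Let `n ≥ 1` and `0 ≤ k < 2n`. The quotient defining `f` is exact in `ℤ[q]`, and there is an
action of the cyclic group of order `2n-k` on the increasing tableaux of shape `2 × n` with
maximum entry `2n-k`, whose generator acts by K-promotion, such that the set of these tableaux
with this action and `f` has the cyclic sieving phenomenon. -/
theorem theorem1p4 (n k : ℕ) (hk : k < 2 * n) :
    sievingPoly n k * qInt (n - k) = qBinom (n - 1) k * qBinom (2 * n - k) (n - k - 1) ∧
    ∃ _ : MulAction (Multiplicative (ZMod (2 * n - k)))
        (IncreasingTableau (rectDiagram 2 n) (2 * n - k)),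
      (∀ T : IncreasingTableau (rectDiagram 2 n) (2 * n - k),
        (Multiplicative.ofAdd (1 : ZMod (2 * n - k)) • T).entry =
          kPromotion (rectDiagram 2 n) (2 * n - k) T.entry) ∧
      HasCyclicSieving (2 * n - k) (IncreasingTableau (rectDiagram 2 n) (2 * n - k))
        (sievingPoly n k) := by
  by_cases hkn : k < n
  · obtain ⟨b, rfl⟩ : ∃ b, n = b + 1 + k := ⟨n - k - 1, by omega⟩
    rw [sievingPoly_eq]
    refine ⟨?_, exists_action_hasCyclicSieving rfl (by omega)⟩
    rw [show b + 1 + k - 1 = b + k by omega, show 2 * (b + 1 + k) - k = 2 * (b + 1) + k by omega,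
      show b + 1 + k - k - 1 = b by omega, show b + 1 + k - k = b + 1 by omega,
      sievingNumerator_mul_qInt, mul_comm]
  · have h0 : qBinom (n - 1) k = 0 := qBinom_eq_zero_of_lt _ _ (by omega)
    have hf : sievingPoly n k = 0 := by rw [sievingPoly, h0, zero_mul, zero_divByMonic]
    have hE := IncreasingTableau.isEmpty (n := n) (N := 2 * n - k) (by omega) (by omega)
    -- For k ≥ n there are no tableaux, so the trivial action serves and both counts are 0.
    refine ⟨by rw [hf, h0, zero_mul, zero_mul], { smul := fun _ T => T, one_smul := fun _ => rfl, mul_smul := fun _ _ _ => rfl },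
      hE.elim, inferInstance, fun m ζ _ => ?_⟩
    rw [hf, map_zero, Nat.card_of_isEmpty, Nat.cast_zero]
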